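/- Let $k$ be a field, $n\ge 0$, and let $\{f_1,\dots,f_s\}$ be a finite reduced Gröbner basis, with respect to the degree-lexicographic order $\prec$ with $x_1\succ\dots\succ x_n$, of the ideal $\mathfrak a=\langle f_1,\dots,f_s\rangle$ generated by it, where $\mathfrak a$ is either (N) a two-sided ideal of $k\langle x_1,\dots,x_n\rangle$ or (C) an ideal of $k[x_1,\dots,x_n]$. Let $A$ be the quotient algebra, $\mathcal G$ the set of standard monomials of degree $\ge 1$ (so $\mathcal G\cup\{1\}$ is a $k$-basis of $A$ if $A\neq0$), and $A^e=A\otimes_kA^{op}$, acting on $A$ by $(a\otimes b)x=axb$. **The complex.** The normalized Hochschild (two-sided Bar) resolution is the complex of free $A^e$-modules with basis the tuples (cells) $[w_1|\dots|w_l]$, $w_i\in\mathcal G$, in degree $l\ge 0$, and differential $$\partial[w_1|\dots|w_l]=(w_1\otimes1)[w_2|\dots|w_l]+\sum_{j=1}^{l-1}(-1)^j\sum_{v\in\mathcal G}a_{j,v}[w_1|\dots|w_{j-1}|v|w_{j+2}|\dots|w_l]+(-1)^l(1\otimes w_l)[w_1|\dots|w_{l-1}],$$ where $w_jw_{j+1}=a_{j,1}+\sum_{v\in\mathcal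 G}a_{j,v}v$ in $A$ (if $w_jw_{j+1}\in\mathcal G$, this is the trivial representation $v=w_jw_{j+1}$). Write $[c:c']$ for the coefficient of $c'$ in $\partial c$, and draw an edge $c\to c'$ if $[c:c']\ne0$. **The matching.** Let $B^0$ be the set of all cells. Given $B^{j-1}$, let $\mathcal M_j$ be the set of pairs $[p|u_1|u_2|q]\to[p|w_j|q]$ of cells in $B^{j-1}$, with $p=(w_1,\dots,w_{j-1})$ and $w_j=u_1u_2$, such that $u_1$ is the $\prec$-maximal monomial among those $u$ for which $w_j=uv$ with $[p|u|v|q]\in B^{j-1}$, while no proper prefix (in case (C): proper divisor) $u'$ of $u$ has this property. Let $B^j$ be the set of cells of $B^{j-1}$ that lie in no pair of $\mathcal M_j$, and put $\mathcal M=\bigcup_{j\ge1}\mathcal M_j$. A cell in no pair of $\mathcal M$ is called critical. **The complex $F_\bullet$.** Let $G_{\mathcal M}$ be the directed graph obtained by reversing the edges in $\mathcal M$; an unreversed edge $c\to c'$ has weight $[c:c']$, a reversed edge $c'\to c$ has weight $-[c:c']^{-1}$, and the weight of a path is the ordered product of the weights of its steps. Let $F_i$ be the free $A^e$-module on the critical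 cells of degree $i$, and $\partial e=\sum_f[e:f]_{\mathcal M}\,f$, where $[e:f]_{\mathcal M}$ is the sum of the weights of all paths from $e$ to $f$ in $G_{\mathcal M}$. **Reductions.** A contraction replaces a cell $[w_1|\dots|w_l]$ by a cell $[w_1|\dots|w_{j-1}|v|w_{j+2}|\dots|w_l]$ with $a_{j,v}\neq0$. A reduction of Type I is a passage from $c$ to some $c_2\ne c$ by a contraction $c\rightsquigarrow c'$ followed by a reversed edge $c'\to c_2$ of $\mathcal M$. A reduction of Type II is a contraction to a critical cell. We say that no reduction of Type II occurs if no sequence of Type I reductions that starts at a critical cell can be followed by a reduction of Type II. **Theorem.** In both cases (N) and (C): 1. $\mathcal M$ is an acyclic matching on the normalized Hochschild complex: its pairs are edges, each cell lies in at most one of them, their coefficients are central units, and $G_{\mathcal M}$ has no directed cycles. Only finitely many paths of $G_{\mathcal M}$ start at a given cell, so $\partial$ is well defined. In case (N) the critical cells are exactly the fully attached tuples: $[\,]$, $[x_i]$ with $x_i\in\mathcal G$, and $[u_1|v_1t_1|v_2t_2|\dots|v_rt_r]$, $r\geq 1$, with entries in $\mathcal G$, where $|u_1|=1$, every $u_jv_jt_j$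 is a minimal generator of the initial ideal of $\mathfrak a$, $u_{j+1}=t_j$, and $v_jt_jq\in\mathcal G$ for each proper prefix $q$ of $v_{j+1}t_{j+1}$. 2. $(F_\bullet,\partial)$ is a free resolution of $A$ as an $A\otimes A^{op}$-module, with augmentation $F_0\to A$, $[\,]\mapsto 1$. 3. If no reduction of Type II occurs, then $(F_\bullet,\partial)$ is minimal, that is, $\partial F_{i+1}\subseteq\mathfrak m F_i$ for all $i\ge0$, where $\mathfrak m\subseteq A\otimes A^{op}$ is the ideal generated by all $x_i\otimes1$ and $1\otimes x_i$. -/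

import Mathlib

universe u

open scoped TensorProduct

noncomputable section


/-! ### Algebraic discrete Morse theory on a weighted directed graph -/

namespace AlgMorse

variable {V R : Type*} [Ring R]

/-- The based complex is given by the matrix `wt c c' = [c : c']` of its differential and by the
homological degree `deg`; `c ⟶ c'` is an edge iff `c'` is one degree lower and `[c : c'] ≠ 0`. -/
def Edge (deg : V → ℕ) (wt : V → V → R) (c c' : V) : Prop :=
  deg c = deg c' + 1 ∧ wt c c' ≠ 0

/-- Edges of the graph `G_M`: the edges of `M` are reversed, the other ones are kept. -/
def MEdge (deg : V → ℕ) (wt : V → V → R) (M : Set (V × V)) (c c' : V) : Prop :=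
  (Edge deg wt c c' ∧ (c, c') ∉ M) ∨ (Edge deg wt c' c ∧ (c', c) ∈ M)

structure IsAcyclicMatching (deg : V → ℕ) (wt : V → V → R) (M : Set (V × V)) : Prop where
  edge : ∀ e ∈ M, Edge deg wt e.1 e.2
  matching : ∀ e ∈ M, ∀ e' ∈ M,
    (e.1 = e'.1 ∨ e.1 = e'.2 ∨ e.2 = e'.1 ∨ e.2 = e'.2) → e = e'
  central : ∀ e ∈ M, wt e.1 e.2 ∈ Subring.center R
  invertible : ∀ e ∈ M, IsUnit (wt e.1 e.2)
  acyclic : ∀ c, ¬ Relation.TransGen (MEdge deg wt M) c c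

/-- The critical vertices: those that lie in no edge of `M`. -/
def Critical (M : Set (V × V)) (c : V) : Prop := ∀ e ∈ M, e.1 ≠ c ∧ e.2 ≠ c

/-- The weight of one step of `G_M`. -/
def stepWeight (deg : V → ℕ) (wt : V → V → R) (c c' : V) : R :=
  open Classical in if deg c < deg c' then - Ring.inverse (wt c' c) else wt c c'

/-- The weight of a path, as the ordered product of the weights of its steps. -/
def pathWeight (deg : V → ℕ) (wt : V → V → R) : List V → R
  | [] => 1
  | [_] => 1
  | c :: c' :: p => stepWeight deg wt c c' * pathWeight deg wt (c' :: p)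

/-- All paths of `G_M` that start at `c` (as lists of vertices). -/
def pathsFrom (deg : V → ℕ) (wt : V → V → R) (M : Set (V × V)) (c : V) : Set (List V) :=
  {p | p.head? = some c ∧ p.IsChain (MEdge deg wt M)}

/-- All paths of `G_M` from `c` to `c'`. -/
def paths (deg : V → ℕ) (wt : V → V → R) (M : Set (V × V)) (c c' : V) : Set (List V) :=
  {p | p ∈ pathsFrom deg wt M c ∧ p.getLast? = some c'}

/-- `Γ(c, c')`, the sum of the weights of all paths from `c` to `c'`. -/
def Gam (deg : V → ℕ) (wt : V → V → R) (M : Set (V × V)) (c c' : V) : R :=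
  ∑ᶠ p ∈ paths deg wt M c c', pathWeight deg wt p

/-- The critical vertices of degree `i`. -/
def CritCell (deg : V → ℕ) (M : Set (V × V)) (i : ℕ) : Type _ :=
  {c : V // Critical M c ∧ deg c = i}

/-- The differential of the Morse complex, `e ↦ ∑_f Γ(e, f) f`. -/
def morseD (deg : V → ℕ) (wt : V → V → R) (M : Set (V × V)) (i : ℕ) :
    (CritCell deg M (i + 1) →₀ R) →ₗ[R] (CritCell deg M i →₀ R) :=
  Finsupp.linearCombination R fun e =>
    ∑ᶠ f : CritCell deg M i, Finsupp.single f (Gam deg wt M e.1 f.1)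

end AlgMorse

/-! ### Free resolutions -/

/-- `⋯ → F 2 → F 1 → F 0 → N → 0` is exact and all `F i` are free. -/
structure IsFreeRes (R : Type*) [Ring R] {N : Type*} [AddCommGroup N] [Module R N]
    (F : ℕ → Type*) [∀ i, AddCommGroup (F i)] [∀ i, Module R (F i)]
    (d : ∀ i, F (i + 1) →ₗ[R] F i) (ε : F 0 →ₗ[R] N) : Prop where
  free : ∀ i, Module.Free R (F i)
  exact : ∀ i, Function.Exact (d (i + 1)) (d i)
  exact_zero : Function.Exact (d 0) ε
  surjective : Function.Surjective ε

/-! ### The normalized acyclic Hochschild complex of an algebra with standard monomials -/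

/-- The ring `A ⊗ A^op`. -/
abbrev Env (k A : Type*) [Field k] [Ring A] [Algebra k A] : Type _ := A ⊗[k] Aᵐᵒᵖ

/-- `A` as an `A ⊗ A^op`-module: `(a ⊗ b) • x = a * x * b`. -/
instance Env.instModule (k A : Type*) [Field k] [Ring A] [Algebra k A] : Module (Env k A) A :=
  TensorProduct.Algebra.module

theorem Env.tmul_smul {k A : Type*} [Field k] [Ring A] [Algebra k A] (a b x : A) :
    ((a ⊗ₜ[k] MulOpposite.op b : Env k A) • x : A) = a * x * b := by
  change a • (MulOpposite.op b • x) = _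
  simp [mul_assoc]

/-- The monomials of an algebra `A` presented by a Gröbner basis: their residue classes in `A`, the
set `G` of standard monomials of degree at least one, and the monomial order. -/
structure StdMonomials (k A Mon : Type*) [Field k] [Ring A] [Algebra k A] [Monoid Mon] where
  val : Mon →* A
  G : Set Mon
  lt : Mon → Mon → Prop

namespace StdMonomials

variable {k A Mon : Type*} [Field k] [Ring A] [Algebra k A] [Monoid Mon]
  (D : StdMonomials k A Mon)

/-- `r` writes `a` as a linear combination of standard monomials (the monomial `1` included). -/
def IsRepr (a : A) (r : Mon →₀ k) : Prop :=
  (∀ v ∈ r.support, v ∈ D.G ∨ v = 1) ∧ r.sum (fun v t => t • D.val v) = a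

/-- The coefficients of `a` in the basis `G ∪ {1}` of `A`. -/
def repr (a : A) : Mon →₀ k :=
  open Classical in if h : ∃ r, D.IsRepr a r then h.choose else 0

/-- The basis elements `[w₁|…|w_l]`, `w_i ∈ G`, of the normalized Hochschild complex. -/
def Cell : Type _ := {c : List Mon // ∀ w ∈ c, w ∈ D.G}

/-- The homological degree. -/
def deg (c : D.Cell) : ℕ := c.1.length

/-- `∑_v a_v [p|v|s]`, where `∑_v a_v v` represents `w`. -/
def contraction (p : List Mon) (w : Mon) (s : List Mon) : List Mon →₀ Env k A :=
  (D.repr (D.val w)).sum fun v a => Finsupp.single (p ++ [v] ++ s) (algebraMap k (Env k A) a)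

/-- `∂[w₁|…|w_l] = (w₁ ⊗ 1)[w₂|…|w_l] + ∑_j (-1)^j [w₁|…|w_j w_{j+1}|…|w_l]
+ (-1)^l (1 ⊗ w_l)[w₁|…|w_{l-1}]`, with the products written in the basis `G ∪ {1}`. Tuples with
an entry `1` have to be omitted; they are not cells, so `bdCoeff` does not see them. -/
def boundary : List Mon → (List Mon →₀ Env k A)
  | [] => 0
  | w :: t =>
      Finsupp.single t (D.val w ⊗ₜ[k] 1)
      + ∑ j ∈ Finset.range t.length,
          ((-1 : Env k A) ^ (j + 1)) •
            D.contraction ((w :: t).take j) ((w :: t).getD j 1 * (w :: t).getD (j + 1) 1)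
              ((w :: t).drop (j + 2))
      + Finsupp.single ((w :: t).dropLast)
          ((-1 : Env k A) ^ (t.length + 1) *
            (1 ⊗ₜ[k] MulOpposite.op (D.val ((w :: t).getLastD 1))))

/-- The coefficient `[c : c']` of the differential of the normalized Hochschild complex. -/
def bdCoeff (c c' : D.Cell) : Env k A := D.boundary c.1 c'.1

/-! ### The matching

In a monoid of words `u ∣ w` means that `u` is a prefix of `w`, in a commutative monoid of
monomials it is divisibility. -/

/-- `w = u v` with `[p|u|v|s] ∈ B`. -/
def Splits (B : Set D.Cell) (p s : List Mon) (w u : Mon) : Prop :=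
  ∃ v, u * v = w ∧ ∃ c ∈ B, c.1 = p ++ [u, v] ++ s

/-- `u` splits `w`, and no proper divisor (prefix) of `u` does. -/
def MinSplits (B : Set D.Cell) (p s : List Mon) (w u : Mon) : Prop :=
  D.Splits B p s w u ∧ ∀ u', u' ∣ u → u' ≠ u → ¬ D.Splits B p s w u'

/-- `u` is the largest one among the minimal splittings of `w`. (For words, the minimal splitting
is unique.) -/
def Chosen (B : Set D.Cell) (p s : List Mon) (w u : Mon) : Prop :=
  D.MinSplits B p s w u ∧ ∀ u', D.MinSplits B p s w u' → ¬ D.lt u u'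

/-- The edges `[p|u|v|s] ⟶ [p|uv|s]` between elements of `B` that satisfy the matching condition
in the coordinate `j + 1`, where `j` is the length of `p`. For `j = 0` and `B` the set of all cells,
the minimal `u` are variables, and `u` is the largest variable that divides `w = uv` (for words: the
first letter of `w`). -/
def matchAt (B : Set D.Cell) (j : ℕ) : Set (D.Cell × D.Cell) :=
  {e | e.1 ∈ B ∧ e.2 ∈ B ∧ ∃ p s : List Mon, ∃ u v : Mon, p.length = j ∧
    e.1.1 = p ++ [u, v] ++ s ∧ e.2.1 = p ++ [u * v] ++ s ∧ D.Chosen B p s (u * v) u}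

/-- The cells that are still critical after the matchings in the first `j` coordinates. -/
def critAfter : ℕ → Set D.Cell
  | 0 => Set.univ
  | j + 1 => {c | c ∈ critAfter j ∧ AlgMorse.Critical (D.matchAt (critAfter j) j) c}

/-- The union of the matchings in all coordinates. -/
def matching : Set (D.Cell × D.Cell) := ⋃ j, D.matchAt (D.critAfter j) j

/-- The critical cells. -/
def Crit (c : D.Cell) : Prop := AlgMorse.Critical D.matching c

/-! ### The complex `F` -/

/-- `F_i`, the free `A ⊗ A^op`-module on the critical cells of degree `i`. -/
abbrev F (i : ℕ) : Type _ := AlgMorse.CritCell D.deg D.matching i →₀ Env k A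

/-- The differential `e ↦ ∑_f [e : f] f` of `F`, where `[e : f]` is the sum of the weights of all
paths from `e` to `f` in the graph of the matching. -/
def d (i : ℕ) : D.F (i + 1) →ₗ[Env k A] D.F i :=
  AlgMorse.morseD D.deg D.bdCoeff D.matching i

/-- The augmentation `F_0 → A`. It sends the basis element `[ ]` to `1`. -/
def aug : D.F 0 →ₗ[Env k A] A := Finsupp.linearCombination (Env k A) fun _ => (1 : A)

/-- `⋯ → F_1 → F_0 → A → 0` is a free resolution of `A` as an `A ⊗ A^op`-module. -/
def IsFreeResolution : Prop := IsFreeRes (Env k A) D.F D.d D.aug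

/-- `D.matching` is an acyclic matching on the normalized Hochschild complex. -/
def IsAcyclicMatching : Prop := AlgMorse.IsAcyclicMatching D.deg D.bdCoeff D.matching

/-- Only finitely many paths start at a given cell, so the sums that define `D.d` are finite. -/
def FinitePaths : Prop :=
  ∀ c, (AlgMorse.pathsFrom D.deg D.bdCoeff D.matching c).Finite

/-! ### Reductions -/

/-- `c = [p|a|b|s]`, `c' = [p|v|s]`, and `v` occurs in the representation of `ab`. -/
def Contracts (c c' : D.Cell) : Prop :=
  ∃ p s : List Mon, ∃ a b v : Mon, c.1 = p ++ [a, b] ++ s ∧ c'.1 = p ++ [v] ++ s ∧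
    D.repr (D.val (a * b)) v ≠ 0

/-- Reduction of type I: a contraction, followed by the splitting that the matching prescribes. -/
def TypeI (c c₂ : D.Cell) : Prop :=
  c₂ ≠ c ∧ ∃ c', D.Contracts c c' ∧ (c₂, c') ∈ D.matching

/-- Reduction of type II: a contraction to a critical cell. -/
def TypeII (c f : D.Cell) : Prop := D.Crit f ∧ D.Contracts c f

/-- Starting from a critical cell, no sequence of reductions of type I ends with a reduction of
type II. -/
def NoTypeII : Prop :=
  ∀ e c f : D.Cell, D.Crit e → Relation.ReflTransGen D.TypeI e c → ¬ D.TypeII c f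

/-- Minimality with respect to an ideal `m` of `A ⊗ A^op`: `∂ F_{i+1} ⊆ m F_i`. -/
def IsMinimal (m : Ideal (Env k A)) : Prop := ∀ i (x : D.F (i + 1)) f, D.d i x f ∈ m

end StdMonomials

/-- The ideal of `A ⊗ A^op` generated by the elements `x_i ⊗ 1` and `1 ⊗ x_i`. -/
def envIdeal (k : Type*) {A ι : Type*} [Field k] [Ring A] [Algebra k A] (x : ι → A) :
    Ideal (Env k A) :=
  Ideal.span (Set.range (fun i => (x i ⊗ₜ[k] 1 : Env k A)) ∪
    Set.range (fun i => (1 ⊗ₜ[k] MulOpposite.op (x i) : Env k A)))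

/-! ### Gröbner bases -/

namespace Groebner

variable {k P Mon : Type*} [Field k] [Ring P] [Monoid Mon]

/-- `w` is the leading monomial of the polynomial with coefficients `q`. -/
def IsLead (lt : Mon → Mon → Prop) (q : Mon → k) (w : Mon) : Prop :=
  q w ≠ 0 ∧ ∀ v, q v ≠ 0 → v ≠ w → lt v w

/-- Divisibility of monomials (for words: being a subword). -/
def Factor (u w : Mon) : Prop := ∃ a b, w = a * u * b

/-- `S` is a reduced Gröbner basis of the ideal `I`; `coef` lists the coefficients of a
polynomial. -/
structure IsReduced (coef : P → Mon → k) (lt : Mon → Mon → Prop) (I : Set P) (S : Finset P) :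
    Prop where
  subset : ∀ f ∈ S, f ∈ I
  basis : ∀ p ∈ I, p ≠ 0 → ∃ f ∈ S, ∃ u w, IsLead lt (coef f) u ∧ IsLead lt (coef p) w ∧
    Factor u w
  monic : ∀ f ∈ S, ∃ u, IsLead lt (coef f) u ∧ coef f u = 1
  reduced : ∀ f ∈ S, ∀ g ∈ S, f ≠ g → ∀ u v, IsLead lt (coef g) u → coef f v ≠ 0 → ¬ Factor u v

/-- The standard monomials, `1` included (if the ideal is proper). -/
def Std (coef : P → Mon → k) (lt : Mon → Mon → Prop) (S : Finset P) : Set Mon :=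
  {w | ∀ f ∈ S, ∀ u, IsLead lt (coef f) u → ¬ Factor u w}

/-- The minimal generators of the initial ideal. -/
def MinGen (coef : P → Mon → k) (lt : Mon → Mon → Prop) (S : Finset P) : Set Mon :=
  {m | m ∉ Std coef lt S ∧ ∀ w, Factor w m → w ≠ m → w ∈ Std coef lt S}

end Groebner

/-! ### Quotients of the free algebra -/

namespace NonComm

variable {k : Type u} [Field k] {n : ℕ}

/-- The coefficient of a word in a noncommutative polynomial. -/
def coef (p : FreeAlgebra k (Fin n)) (w : FreeMonoid (Fin n)) : k :=
  (FreeAlgebra.equivMonoidAlgebraFreeMonoid p).coeff w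

/-- Degree-lexicographic order on words, with `x_0 ≻ x_1 ≻ ⋯`. -/
def lt (v w : FreeMonoid (Fin n)) : Prop :=
  v.length < w.length ∨
    (v.length = w.length ∧ List.Lex (fun i j : Fin n => j < i) v.toList w.toList)

/-- `k⟨x_0, …, x_{n-1}⟩ / ⟨S⟩`. -/
abbrev Quot (S : Finset (FreeAlgebra k (Fin n))) : Type u :=
  (TwoSidedIdeal.span (S : Set (FreeAlgebra k (Fin n)))).ringCon.Quotient

/-- `S` is a reduced Gröbner basis of the two-sided ideal that it generates. -/
def IsReducedGB (S : Finset (FreeAlgebra k (Fin n))) : Prop :=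
  Groebner.IsReduced coef lt
    {p | p ∈ TwoSidedIdeal.span (S : Set (FreeAlgebra k (Fin n)))} S

/-- The residue class of a polynomial. -/
def mk (S : Finset (FreeAlgebra k (Fin n))) : FreeAlgebra k (Fin n) →+* Quot S :=
  (TwoSidedIdeal.span (S : Set (FreeAlgebra k (Fin n)))).ringCon.mk'

def std (S : Finset (FreeAlgebra k (Fin n))) :
    StdMonomials k (Quot S) (FreeMonoid (Fin n)) where
  val := (mk S : FreeAlgebra k (Fin n) →* Quot S).comp (FreeMonoid.lift (FreeAlgebra.ι k))
  G := {w | w ∈ Groebner.Std coef lt S ∧ w ≠ 1}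
  lt := lt

/-- The ideal of `A ⊗ A^op` generated by the `x_i ⊗ 1` and `1 ⊗ x_i`. -/
def maxIdeal (S : Finset (FreeAlgebra k (Fin n))) : Ideal (Env k (Quot S)) :=
  envIdeal k fun i : Fin n => mk S (FreeAlgebra.ι k i)

/-- Fully attached tuples: `[]`, the tuples `[x_i]`, and the tuples
`[u₀, v₀ t₀, v₁ t₁, …, v_{r-1} t_{r-1}]`, `r ≥ 1`, of standard monomials such that `u₀` is a
letter, `u_j v_j t_j` are minimal generators of the initial ideal with `u_{j+1} = t_j`, and
`v_j t_j q` is standard for each proper prefix `q` of `v_{j+1} t_{j+1}`. -/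
def FullyAttached (S : Finset (FreeAlgebra k (Fin n))) (c : (std S).Cell) : Prop :=
  c.1 = [] ∨ (∃ i, c.1 = [FreeMonoid.of i]) ∨
  ∃ r : ℕ, 1 ≤ r ∧ ∃ u v t : ℕ → FreeMonoid (Fin n),
    c.1 = u 0 :: (List.range r).map (fun j => v j * t j) ∧
    (u 0).length = 1 ∧
    (∀ j < r, u j * v j * t j ∈ Groebner.MinGen coef lt S) ∧
    (∀ j, j + 1 < r → u (j + 1) = t j) ∧
    (∀ j, j + 1 < r → ∀ q, q ∣ v (j + 1) * t (j + 1) → q ≠ v (j + 1) * t (j + 1) →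
      v j * t j * q ∈ (std S).G)

end NonComm

/-! ### Quotients of the commutative polynomial ring -/

namespace Comm

variable {k : Type u} [Field k] {n : ℕ}

/-- The coefficient of a monomial in a polynomial. -/
def coef (p : MvPolynomial (Fin n) k) (w : Multiplicative (Fin n →₀ ℕ)) : k :=
  p.coeff w.toAdd

/-- Degree-lexicographic order on monomials, with `x_0 ≻ x_1 ≻ ⋯`. -/
def lt (v w : Multiplicative (Fin n →₀ ℕ)) : Prop := toDegLex v.toAdd < toDegLex w.toAdd

/-- `k[x_0, …, x_{n-1}] / ⟨S⟩`. -/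
abbrev Quot (S : Finset (MvPolynomial (Fin n) k)) : Type u :=
  MvPolynomial (Fin n) k ⧸ Ideal.span (S : Set (MvPolynomial (Fin n) k))

/-- `S` is a reduced Gröbner basis of the ideal that it generates. -/
def IsReducedGB (S : Finset (MvPolynomial (Fin n) k)) : Prop :=
  Groebner.IsReduced coef lt (Ideal.span (S : Set (MvPolynomial (Fin n) k)) : Set _) S

/-- The residue class of a polynomial. -/
def mk (S : Finset (MvPolynomial (Fin n) k)) : MvPolynomial (Fin n) k →+* Quot S :=
  Ideal.Quotient.mk (Ideal.span (S : Set (MvPolynomial (Fin n) k)))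

def std (S : Finset (MvPolynomial (Fin n) k)) :
    StdMonomials k (Quot S) (Multiplicative (Fin n →₀ ℕ)) where
  val := (mk S : MvPolynomial (Fin n) k →* Quot S).comp
    (MvPolynomial.monomialOneHom k (Fin n))
  G := {w | w ∈ Groebner.Std coef lt S ∧ w ≠ 1}
  lt := lt

/-- The ideal of `A ⊗ A^op` generated by the `x_i ⊗ 1` and `1 ⊗ x_i`. -/
def maxIdeal (S : Finset (MvPolynomial (Fin n) k)) : Ideal (Env k (Quot S)) :=
  envIdeal k fun i : Fin n => mk S (MvPolynomial.X i)

end Comm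

end

/-!
An acyclic matching on a based complex with differential `d` can be cancelled all at once. Let `m`
be the part of `d` that belongs to the matching and let `h` send the target of a matching edge back
to its source, divided by the coefficient. By acyclicity `h (d - m)` moves every basis element
strictly down along the graph of the matching, so `1 + h (d - m)` is unitriangular, hence
invertible, and its inverse sums over all zigzag paths. The inverse carries the critical chains
isomorphically onto the chains `x` with `h x = 0` and `h (d x) = 0`, and the Morse differential to
`d`, so exactness passes from the bar resolution to the Morse complex.

Whether a cell `[p|w|…]` survives the matchings in the coordinates before `w` depends only on `p`
and `w`. Hence `[p|w|s]`, where `w` is not minimal among the monomials that survive after `p`, is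
matched with `[p|u|v|s]`, where `u` is the leading minimal divisor of `w = u v`. Along an edge of
the graph the product of the entries cannot increase. Where it stays the same the list of minimal
divisors, which ends with the chosen divisor, does not decrease, and where this also stays the same
the number of entries goes down. The monomial order is well-founded, so there are no cycles.

For words, the minimal divisor is the shortest prefix that survives, and a tuple is critical iff
each entry is the shortest continuation that overlaps with its predecessor in an obstruction, that
is, iff the tuple is fully attached. If no reduction of type II occurs, then every path from a
critical cell to a critical cell one degree below uses the removal of the first or of the last entry
at least once, and the coefficient of this step lies in `m`.
-/

noncomputable section

open Finsupp (single supported)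

/-! ### Unitriangular endomorphisms and the graph of an acyclic matching -/

section Basis

variable {V R N : Type*} [Semiring R] [AddCommMonoid N] [Module R N]

theorem map_mem_of_single_mem {s : Set V} {f : (V →₀ R) →ₗ[R] N} {T : Submodule R N}
    (h : ∀ c ∈ s, f (single c 1) ∈ T) {x : V →₀ R} (hx : x ∈ supported R R s) : f x ∈ T := by
  rw [Finsupp.supported_eq_span_single] at hx
  have hle : Submodule.span R ((fun c => single c (1 : R)) '' s) ≤ T.comap f :=
    Submodule.span_le.2 (Set.image_subset_iff.2 h)
  exact hle hx

theorem map_eq_map_of_single_eq {s : Set V} {f g : (V →₀ R) →ₗ[R] N}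
    (h : ∀ c ∈ s, f (single c 1) = g (single c 1)) {x : V →₀ R} (hx : x ∈ supported R R s) :
    f x = g x := by
  rw [Finsupp.supported_eq_span_single] at hx
  exact LinearMap.eqOn_span (Set.forall_mem_image.2 h) hx

theorem linearMap_ext_single_one {f g : (V →₀ R) →ₗ[R] N}
    (h : ∀ c, f (single c 1) = g (single c 1)) : f = g :=
  Finsupp.lhom_ext' fun c => LinearMap.ext_ring (h c)

theorem single_eq_smul_single_one (c : V) (a : R) : single c a = a • single c (1 : R) := by
  simp

end Basis

section Unitriangular

variable {V R : Type*} [Ring R] {r : V → V → Prop} [IsTrans V r]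

theorem exists_unitriangular_preimage (hr : WellFounded r) {T : (V →₀ R) →ₗ[R] (V →₀ R)}
    (hT : ∀ c, T (single c 1) ∈ supported R R {c' | r c' c}) (c : V) :
    ∃ y ∈ supported R R {c' | r c' c},
      single c 1 + y + T (single c 1 + y) = single c 1 := by
  induction c using hr.induction with
  | h c ih =>
    have hlower : T (single c 1) ∈
        (supported R R {c' | r c' c}).map (LinearMap.id + T : (V →₀ R) →ₗ[R] (V →₀ R)) := by
      refine map_mem_of_single_mem (f := LinearMap.id) (fun c' hc' => ?_) (hT c)
      obtain ⟨y, hy, hTy⟩ := ih c' hc'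
      have hmono : {c'' | r c'' c'} ⊆ {c'' | r c'' c} := fun _ h => _root_.trans h hc'
      exact ⟨_, add_mem (Finsupp.single_mem_supported R _ hc')
        (Finsupp.supported_mono hmono hy), hTy⟩
    obtain ⟨y, hy, hTy⟩ := hlower
    refine ⟨-y, neg_mem hy, ?_⟩
    rw [map_add, map_neg, ← hTy, LinearMap.add_apply, LinearMap.id_apply]
    abel

/-- The preimages of the basis elements form a right inverse which is again unitriangular, hence
also surjective. -/
theorem bijective_id_add_of_unitriangular (hr : WellFounded r) {T : (V →₀ R) →ₗ[R] (V →₀ R)}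
    (hT : ∀ c, T (single c 1) ∈ supported R R {c' | r c' c}) :
    Function.Bijective (LinearMap.id + T : (V →₀ R) →ₗ[R] (V →₀ R)) := by
  have rightInverse : ∀ T : (V →₀ R) →ₗ[R] (V →₀ R),
      (∀ c, T (single c 1) ∈ supported R R {c' | r c' c}) →
      ∃ T' : (V →₀ R) →ₗ[R] (V →₀ R), (∀ c, T' (single c 1) ∈ supported R R {c' | r c' c}) ∧
        ∀ x, x + T' x + T (x + T' x) = x := by
    intro T hT
    choose y hy hTy using exists_unitriangular_preimage hr hT
    refine ⟨Finsupp.linearCombination R y, fun c => by simpa using hy c, fun x => ?_⟩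
    refine LinearMap.congr_fun (f := (LinearMap.id + T) ∘ₗ
      (LinearMap.id + Finsupp.linearCombination R y)) (g := LinearMap.id)
      (linearMap_ext_single_one fun c => ?_) x
    simpa using hTy c
  obtain ⟨T', hT', hinv⟩ := rightInverse T hT
  obtain ⟨T'', -, hinv'⟩ := rightInverse T' hT'
  refine ⟨fun x x' h => ?_, fun x => ⟨x + T' x, hinv x⟩⟩
  rw [LinearMap.add_apply, LinearMap.add_apply, LinearMap.id_apply, LinearMap.id_apply,
    ← hinv' x, ← hinv' x', hinv, hinv] at h
  rw [← hinv' x, ← hinv' x', h]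

end Unitriangular

namespace AlgMorse

variable {V R : Type*} [Ring R] {deg : V → ℕ} {wt : V → V → R} {M : Set (V × V)}

section Paths

theorem cons_mem_pathsFrom {c c' : V} {p : List V} (hc : MEdge deg wt M c c')
    (hp : p ∈ pathsFrom deg wt M c') : c :: p ∈ pathsFrom deg wt M c := by
  refine ⟨rfl, List.isChain_cons.2 ⟨fun y hy => ?_, hp.2⟩⟩
  obtain rfl : c' = y := Option.some_inj.1 (hp.1.symm.trans hy)
  exact hc

theorem pathsFrom_eq_union (c : V) : pathsFrom deg wt M c =
    {[c]} ∪ ⋃ c' ∈ {c' | MEdge deg wt M c c'}, List.cons c '' pathsFrom deg wt M c' := by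
  ext p
  simp only [Set.mem_union, Set.mem_singleton_iff, Set.mem_iUnion, Set.mem_image, Set.mem_ofPred_eq]
  constructor
  · rintro ⟨hhead, hchain⟩
    rcases p with _ | ⟨a, _ | ⟨c', q⟩⟩
    · simp at hhead
    · exact .inl (by simpa using hhead)
    · obtain rfl : a = c := by simpa using hhead
      rw [List.isChain_cons_cons] at hchain
      exact .inr ⟨c', hchain.1, c' :: q, ⟨rfl, hchain.2⟩, rfl⟩
  · rintro (rfl | ⟨c', hc, q, hq, rfl⟩)
    · exact ⟨rfl, List.isChain_singleton c⟩
    · exact cons_mem_pathsFrom hc hq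

theorem getLast?_cons_of_mem_pathsFrom {c' : V} {q : List V} (hq : q ∈ pathsFrom deg wt M c')
    (c : V) : (c :: q).getLast? = q.getLast? := by
  rcases q with _ | ⟨b, q⟩
  · simp [pathsFrom] at hq
  · exact List.getLast?_cons_cons

theorem mem_paths_iff {c f : V} {p : List V} : p ∈ paths deg wt M c f ↔
    (p = [c] ∧ c = f) ∨ ∃ c', MEdge deg wt M c c' ∧ ∃ q ∈ paths deg wt M c' f, c :: q = p := by
  rw [paths, Set.mem_ofPred_eq, pathsFrom_eq_union]
  simp only [Set.mem_union, Set.mem_singleton_iff, Set.mem_iUnion, Set.mem_image, Set.mem_ofPred_eq]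
  constructor
  · rintro ⟨rfl | ⟨c', hc, q, hq, rfl⟩, hlast⟩
    · exact .inl ⟨rfl, by simpa using hlast⟩
    · exact .inr ⟨c', hc, q, ⟨hq, by rw [← hlast, getLast?_cons_of_mem_pathsFrom hq]⟩, rfl⟩
  · rintro (⟨rfl, rfl⟩ | ⟨c', hc, q, ⟨hq, hlast⟩, rfl⟩)
    · exact ⟨.inl rfl, rfl⟩
    · exact ⟨.inr ⟨c', hc, q, hq, rfl⟩, by rw [← hlast, getLast?_cons_of_mem_pathsFrom hq]⟩

theorem paths_eq_union (c f : V) : paths deg wt M c f =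
    {p | p = [c] ∧ c = f} ∪
      ⋃ c' ∈ {c' | MEdge deg wt M c c'}, List.cons c '' paths deg wt M c' f := by
  ext p
  simp [mem_paths_iff (c := c)]

theorem pathsFrom_finite (hwf : WellFounded fun c' c => MEdge deg wt M c c')
    (hfin : ∀ c, {c' | MEdge deg wt M c c'}.Finite) (c : V) : (pathsFrom deg wt M c).Finite := by
  induction c using hwf.induction with
  | h c ih =>
    rw [pathsFrom_eq_union]
    exact (Set.finite_singleton _).union ((hfin c).biUnion fun c' hc => (ih c' hc).image _)

theorem pathWeight_cons {c c' : V} {p : List V} (hp : p ∈ pathsFrom deg wt M c') :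
    pathWeight deg wt (c :: p) = stepWeight deg wt c c' * pathWeight deg wt p := by
  rcases p with _ | ⟨b, p⟩
  · simp [pathsFrom] at hp
  · obtain rfl : b = c' := by simpa using hp.1
    rfl

theorem disjoint_image_cons_paths (c f : V) {a b : V} (hab : a ≠ b) :
    Disjoint (List.cons c '' paths deg wt M a f) (List.cons c '' paths deg wt M b f) := by
  refine Set.disjoint_left.2 ?_
  rintro _ ⟨q, hq, rfl⟩ ⟨q', hq', he⟩
  obtain rfl := List.cons_injective he
  exact hab (Option.some_inj.1 (hq.1.1.symm.trans hq'.1.1))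

theorem Gam_eq_single_add_finsum (hpaths : ∀ c, (pathsFrom deg wt M c).Finite)
    (hfin : ∀ c, {c' | MEdge deg wt M c c'}.Finite) (c f : V) :
    Gam deg wt M c f = single c (1 : R) f +
      ∑ᶠ c' ∈ {c' | MEdge deg wt M c c'}, stepWeight deg wt c c' * Gam deg wt M c' f := by
  have hpf : ∀ c, (paths deg wt M c f).Finite := fun c => (hpaths c).subset fun p hp => hp.1
  have htrivial : ∑ᶠ p ∈ {p : List V | p = [c] ∧ c = f}, pathWeight deg wt p =
      single c (1 : R) f := by
    by_cases h : c = f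
    · subst h
      simp [pathWeight]
    · simp [h]
  have hcons : ∀ c', ∑ᶠ p ∈ List.cons c '' paths deg wt M c' f, pathWeight deg wt p =
      stepWeight deg wt c c' * Gam deg wt M c' f := by
    intro c'
    rw [finsum_mem_image List.cons_injective.injOn, Gam, mul_finsum_mem' _ _ (hpf c')]
    exact finsum_mem_congr rfl fun p hp => pathWeight_cons hp.1
  have hdisjoint : Disjoint {p | p = [c] ∧ c = f}
      (⋃ c' ∈ {c' | MEdge deg wt M c c'}, List.cons c '' paths deg wt M c' f) := by
    simp only [Set.disjoint_left, Set.mem_iUnion, Set.mem_image, not_exists, not_and]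
    rintro _ ⟨rfl, -⟩ c' - q hq he
    simp [paths, pathsFrom, List.cons_injective he] at hq
  rw [Gam, paths_eq_union, finsum_mem_union hdisjoint
    ((Set.finite_singleton [c]).subset fun p hp => hp.1)
    ((hfin c).biUnion fun c' _ => (hpf c').image _), htrivial,
    finsum_mem_biUnion (fun a _ b _ hab => disjoint_image_cons_paths c f hab) (hfin c)
      fun c' _ => (hpf c').image _]
  simp only [hcons]

end Paths

namespace IsAcyclicMatching

variable (hM : IsAcyclicMatching deg wt M)
include hM

theorem target_unique {u l l' : V} (h : (u, l) ∈ M) (h' : (u, l') ∈ M) : l = l' :=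
  (Prod.ext_iff.1 (hM.matching _ h _ h' (.inl rfl))).2

theorem source_unique {u u' l : V} (h : (u, l) ∈ M) (h' : (u', l) ∈ M) : u = u' :=
  (Prod.ext_iff.1 (hM.matching _ h _ h' (.inr (.inr (.inr rfl))))).1

theorem target_not_source {u l l' : V} (h : (u, l) ∈ M) : (l, l') ∉ M := by
  intro h'
  obtain ⟨hu, hl⟩ := Prod.ext_iff.1 (hM.matching _ h _ h' (.inr (.inr (.inl rfl))))
  obtain rfl : u = l := hu
  obtain rfl : u = l' := hl
  exact Nat.succ_ne_self _ (hM.edge _ h).1.symm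

/-- No path contains two consecutive reversed edges, and its last step into a critical cell is not
a reversed one. -/
theorem deg_of_mem_paths {f : V} (hf : Critical M f) :
    ∀ (p : List V) (c : V), p ∈ paths deg wt M c f →
      deg f ≤ deg c ∧ ((∀ u, (u, c) ∉ M) → c = f ∨ deg f < deg c)
  | [], c, h => by simpa using h.1.1
  | a :: p, c, h => by
    obtain ⟨-, rfl⟩ | ⟨c', hc, q, hq, he⟩ := mem_paths_iff.1 h
    · exact ⟨le_rfl, fun _ => .inl rfl⟩
    obtain ⟨rfl, rfl⟩ := List.cons.inj he
    have ih := deg_of_mem_paths hf q c' hq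
    rcases hc with ⟨⟨hdeg, -⟩, -⟩ | ⟨⟨hdeg, -⟩, hmem⟩
    · have : deg f < deg c := by omega
      exact ⟨this.le, fun _ => .inr this⟩
    · refine ⟨?_, fun hc => absurd hmem (hc c')⟩
      rcases ih.2 fun u hu => hM.target_not_source hu hmem with rfl | h
      · exact absurd rfl (hf _ hmem).1
      · omega

theorem Gam_eq_zero_of_deg_lt {c f : V} (hf : Critical M f) (h : deg c < deg f) :
    Gam deg wt M c f = 0 := by
  have hempty : paths deg wt M c f = ∅ :=
    Set.eq_empty_of_forall_notMem fun p hp => (hM.deg_of_mem_paths hf p c hp).1.not_gt h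
  rw [Gam, hempty, finsum_mem_empty]

end IsAcyclicMatching

theorem Critical.notMem_source {c : V} (h : Critical M c) (l : V) : (c, l) ∉ M :=
  fun h' => (h _ h').1 rfl

theorem Critical.notMem_target {c : V} (h : Critical M c) (u : V) : (u, c) ∉ M :=
  fun h' => (h _ h').2 rfl

theorem critical_iff {c : V} : Critical M c ↔ (∀ l, (c, l) ∉ M) ∧ ∀ u, (u, c) ∉ M :=
  ⟨fun h => ⟨h.notMem_source, h.notMem_target⟩, fun ⟨hsource, htarget⟩ e he =>
    ⟨fun h => hsource e.2 (by rwa [← h]), fun h => htarget e.1 (by rwa [← h])⟩⟩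

theorem critical_or_source_or_target (c : V) :
    Critical M c ∨ (∃ l, (c, l) ∈ M) ∨ ∃ u, (u, c) ∈ M := by
  by_contra! h
  exact h.1 (critical_iff.2 h.2)

section Operators

variable (R deg) in
/-- The chains of degree `i`, as a submodule of the sum of all chain modules. -/
abbrev gr (i : ℕ) : Submodule R (V →₀ R) := supported R R {c | deg c = i}

variable (wt M)

open Classical in
/-- The map `h` that sends the target `c'` of a matching edge `c ⟶ c'` to `[c : c']⁻¹ c`, and all
other cells to `0`. -/
def reverseMap : (V →₀ R) →ₗ[R] (V →₀ R) :=
  Finsupp.linearCombination R fun c => if hc : ∃ u, (u, c) ∈ M then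
    single hc.choose (Ring.inverse (wt hc.choose c)) else 0

open Classical in
/-- The part `m` of the differential that belongs to the matching edges. -/
def matchedMap : (V →₀ R) →ₗ[R] (V →₀ R) :=
  Finsupp.linearCombination R fun c => if hc : ∃ l, (c, l) ∈ M then
    single hc.choose (wt c hc.choose) else 0

/-- The map `1 + h (d - m)`. Its inverse is the geometric series that sums over the paths which
alternate between unmatched edges and reversed edges. -/
def zigzagMap (d : (V →₀ R) →ₗ[R] (V →₀ R)) : (V →₀ R) →ₗ[R] (V →₀ R) :=
  LinearMap.id + reverseMap wt M ∘ₗ (d - matchedMap wt M)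

variable {wt M}

theorem zigzagMap_apply (d : (V →₀ R) →ₗ[R] (V →₀ R)) (x : V →₀ R) :
    zigzagMap wt M d x = x + reverseMap wt M (d x) - reverseMap wt M (matchedMap wt M x) := by
  simp [zigzagMap, add_sub_assoc]

theorem reverseMap_single_of_notMem {c : V} (hc : ∀ u, (u, c) ∉ M) :
    reverseMap wt M (single c 1) = 0 := by
  simp [reverseMap, hc]

theorem matchedMap_single_of_notMem {c : V} (hc : ∀ l, (c, l) ∉ M) :
    matchedMap wt M (single c 1) = 0 := by
  simp [matchedMap, hc]

namespace IsAcyclicMatching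

variable (hM : IsAcyclicMatching deg wt M)
include hM

theorem reverseMap_single {u l : V} (h : (u, l) ∈ M) :
    reverseMap wt M (single l 1) = single u (Ring.inverse (wt u l)) := by
  have hl : ∃ u, (u, l) ∈ M := ⟨u, h⟩
  rw [reverseMap, Finsupp.linearCombination_single, dif_pos hl, one_smul,
    hM.source_unique hl.choose_spec h]

theorem matchedMap_single {u l : V} (h : (u, l) ∈ M) :
    matchedMap wt M (single u 1) = single l (wt u l) := by
  have hu : ∃ l, (u, l) ∈ M := ⟨l, h⟩
  rw [matchedMap, Finsupp.linearCombination_single, dif_pos hu, one_smul,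
    hM.target_unique hu.choose_spec h]

theorem reverseMap_matchedMap_single {u l : V} (h : (u, l) ∈ M) :
    reverseMap wt M (matchedMap wt M (single u 1)) = single u 1 := by
  rw [hM.matchedMap_single h, single_eq_smul_single_one, map_smul, hM.reverseMap_single h,
    Finsupp.smul_single, smul_eq_mul, Ring.mul_inverse_cancel _ (hM.invertible _ h)]

theorem matchedMap_reverseMap_single {u l : V} (h : (u, l) ∈ M) :
    matchedMap wt M (reverseMap wt M (single l 1)) = single l 1 := by
  rw [hM.reverseMap_single h, single_eq_smul_single_one, map_smul, hM.matchedMap_single h,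
    Finsupp.smul_single, smul_eq_mul, Ring.inverse_mul_cancel _ (hM.invertible _ h)]

theorem reverseMap_reverseMap (x : V →₀ R) : reverseMap wt M (reverseMap wt M x) = 0 := by
  suffices reverseMap wt M ∘ₗ reverseMap wt M = 0 from LinearMap.congr_fun this x
  refine linearMap_ext_single_one fun c => ?_
  rw [LinearMap.comp_apply, LinearMap.zero_apply]
  by_cases hc : ∃ u, (u, c) ∈ M
  · obtain ⟨u, hu⟩ := hc
    rw [hM.reverseMap_single hu, single_eq_smul_single_one, map_smul,
      reverseMap_single_of_notMem fun w hw => hM.target_not_source hw hu, smul_zero]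
  · rw [reverseMap_single_of_notMem (not_exists.1 hc), map_zero]

theorem reverseMap_matchedMap_reverseMap (x : V →₀ R) :
    reverseMap wt M (matchedMap wt M (reverseMap wt M x)) = reverseMap wt M x := by
  suffices reverseMap wt M ∘ₗ matchedMap wt M ∘ₗ reverseMap wt M = reverseMap wt M from
    LinearMap.congr_fun this x
  refine linearMap_ext_single_one fun c => ?_
  simp only [LinearMap.comp_apply]
  by_cases hc : ∃ u, (u, c) ∈ M
  · obtain ⟨u, hu⟩ := hc
    rw [hM.matchedMap_reverseMap_single hu]
  · rw [reverseMap_single_of_notMem (not_exists.1 hc), map_zero, map_zero]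

theorem reverseMap_mem_gr {i : ℕ} {x : V →₀ R} (hx : x ∈ gr R deg i) :
    reverseMap wt M x ∈ gr R deg (i + 1) := by
  refine map_mem_of_single_mem (fun c hc => ?_) hx
  by_cases h : ∃ u, (u, c) ∈ M
  · obtain ⟨u, hu⟩ := h
    rw [hM.reverseMap_single hu]
    exact Finsupp.single_mem_supported _ _ ((hM.edge _ hu).1.trans (congrArg (· + 1) hc))
  · rw [reverseMap_single_of_notMem (not_exists.1 h)]
    exact zero_mem _

theorem matchedMap_mem_gr {i : ℕ} {x : V →₀ R} (hx : x ∈ gr R deg (i + 1)) :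
    matchedMap wt M x ∈ gr R deg i := by
  refine map_mem_of_single_mem (fun c hc => ?_) hx
  by_cases h : ∃ l, (c, l) ∈ M
  · obtain ⟨l, hl⟩ := h
    rw [hM.matchedMap_single hl]
    exact Finsupp.single_mem_supported _ _ (Nat.succ_injective ((hM.edge _ hl).1.symm.trans hc))
  · rw [matchedMap_single_of_notMem (not_exists.1 h)]
    exact zero_mem _

theorem matchedMap_apply_eq_zero {f : V} (hf : ∀ u, (u, f) ∉ M) (x : V →₀ R) :
    matchedMap wt M x f = 0 := by
  suffices Finsupp.lapply f ∘ₗ matchedMap wt M = 0 from LinearMap.congr_fun this x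
  refine linearMap_ext_single_one fun c => ?_
  rw [LinearMap.comp_apply, Finsupp.lapply_apply, LinearMap.zero_apply]
  by_cases hc : ∃ l, (c, l) ∈ M
  · obtain ⟨l, hl⟩ := hc
    rw [hM.matchedMap_single hl, Finsupp.single_eq_of_ne (by rintro rfl; exact hf c hl)]
  · rw [matchedMap_single_of_notMem (not_exists.1 hc), Finsupp.zero_apply]

end IsAcyclicMatching

end Operators
end AlgMorse

/-! ### The Morse complex of a based complex -/

namespace AlgMorse

variable {V R : Type*} [Ring R] {deg : V → ℕ} {wt : V → V → R} {M : Set (V × V)}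
  {d : (V →₀ R) →ₗ[R] (V →₀ R)}

/-- `d` is the differential of the based complex with the matrix `wt`, and `M` is an acyclic
matching on it such that no infinite path exists. All chain modules are put into the single module
`V →₀ R`. -/
structure IsMatchedComplex (deg : V → ℕ) (wt : V → V → R) (M : Set (V × V))
    (d : (V →₀ R) →ₗ[R] (V →₀ R)) : Prop where
  isAcyclicMatching : IsAcyclicMatching deg wt M
  wellFounded : WellFounded fun c' c => MEdge deg wt M c c'
  d_single_apply : ∀ c c', d (single c 1) c' = wt c c'
  deg_eq : ∀ {c c'}, wt c c' ≠ 0 → deg c = deg c' + 1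
  d_d : ∀ x, d (d x) = 0

section CriticalPart

variable (R deg M) in
/-- The inclusion of the free module on the critical cells of degree `i`. -/
def critIncl (i : ℕ) : (CritCell deg M i →₀ R) →ₗ[R] (V →₀ R) :=
  Finsupp.lmapDomain R R fun c => c.1

variable (R deg M) in
/-- The projection to the free module on the critical cells of degree `i`. -/
def critPart (i : ℕ) : (V →₀ R) →ₗ[R] (CritCell deg M i →₀ R) :=
  Finsupp.lcomapDomain (fun c => c.1) Subtype.val_injective

variable {i : ℕ}

theorem critIncl_single (c : CritCell deg M i) (a : R) :
    critIncl R deg M i (single c a) = single c.1 a :=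
  Finsupp.mapDomain_single

theorem critPart_apply (x : V →₀ R) (c : CritCell deg M i) : critPart R deg M i x c = x c.1 :=
  rfl

theorem critPart_critIncl (x : CritCell deg M i →₀ R) :
    critPart R deg M i (critIncl R deg M i x) = x :=
  Finsupp.comapDomain_mapDomain _ Subtype.val_injective x

theorem critIncl_mem_gr (x : CritCell deg M i →₀ R) : critIncl R deg M i x ∈ gr R deg i :=
  map_mem_of_single_mem (s := Set.univ)
    (fun c _ => by
      rw [critIncl_single]
      exact Finsupp.single_mem_supported _ _ c.2.2)
    (by simp)

theorem reverseMap_critIncl (x : CritCell deg M i →₀ R) :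
    reverseMap wt M (critIncl R deg M i x) = 0 := by
  suffices reverseMap wt M ∘ₗ critIncl R deg M i = 0 from LinearMap.congr_fun this x
  refine linearMap_ext_single_one fun c => ?_
  rw [LinearMap.comp_apply, critIncl_single, reverseMap_single_of_notMem c.2.1.notMem_target,
    LinearMap.zero_apply]

theorem matchedMap_critIncl (x : CritCell deg M i →₀ R) :
    matchedMap wt M (critIncl R deg M i x) = 0 := by
  suffices matchedMap wt M ∘ₗ critIncl R deg M i = 0 from LinearMap.congr_fun this x
  refine linearMap_ext_single_one fun c => ?_
  rw [LinearMap.comp_apply, critIncl_single, matchedMap_single_of_notMem c.2.1.notMem_source,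
    LinearMap.zero_apply]

theorem critPart_single_eq_zero {c : V} (hc : ¬ Critical M c) (a : R) :
    critPart R deg M i (single c a) = 0 := by
  ext f
  rw [critPart_apply, Finsupp.single_eq_of_ne (by rintro rfl; exact hc f.2.1), Finsupp.zero_apply]

theorem critIncl_critPart_single (c : CritCell deg M i) (a : R) :
    critIncl R deg M i (critPart R deg M i (single c.1 a)) = single c.1 a := by
  rw [← critIncl_single, critPart_critIncl]

theorem IsAcyclicMatching.critIncl_critPart (hM : IsAcyclicMatching deg wt M) {x : V →₀ R}
    (hx : x ∈ gr R deg i) : critIncl R deg M i (critPart R deg M i x) =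
      x - reverseMap wt M (matchedMap wt M x) - matchedMap wt M (reverseMap wt M x) := by
  refine map_eq_map_of_single_eq (f := critIncl R deg M i ∘ₗ critPart R deg M i)
    (g := LinearMap.id - reverseMap wt M ∘ₗ matchedMap wt M - matchedMap wt M ∘ₗ reverseMap wt M)
    (fun c hdeg => ?_) hx
  simp only [LinearMap.comp_apply, LinearMap.sub_apply, LinearMap.id_apply]
  rcases critical_or_source_or_target (M := M) c with hc | ⟨l, hl⟩ | ⟨u, hu⟩
  · have hcrit := critIncl_critPart_single (⟨c, hc, hdeg⟩ : CritCell deg M i) (1 : R)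
    rw [hcrit, matchedMap_single_of_notMem hc.notMem_source,
      reverseMap_single_of_notMem hc.notMem_target, map_zero, map_zero, sub_zero, sub_zero]
  · rw [critPart_single_eq_zero fun hc => hc.notMem_source l hl, hM.reverseMap_matchedMap_single hl,
      reverseMap_single_of_notMem fun u hu => hM.target_not_source hu hl, map_zero, map_zero,
      sub_self, sub_zero]
  · rw [critPart_single_eq_zero fun hc => hc.notMem_target u hu, hM.matchedMap_reverseMap_single hu,
      matchedMap_single_of_notMem fun l hl => hM.target_not_source hu hl, map_zero, map_zero,
      sub_zero, sub_self]

end CriticalPart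

namespace IsAcyclicMatching

variable (hM : IsAcyclicMatching deg wt M)
include hM

theorem reverseMap_zigzagMap (y : V →₀ R) :
    reverseMap wt M (zigzagMap wt M d y) = reverseMap wt M y := by
  simp only [zigzagMap_apply, map_sub, map_add, hM.reverseMap_reverseMap, add_zero, sub_zero]

theorem reverseMap_matchedMap_zigzagMap (y : V →₀ R) :
    reverseMap wt M (matchedMap wt M (zigzagMap wt M d y)) = reverseMap wt M (d y) := by
  simp only [zigzagMap_apply, map_sub, map_add, hM.reverseMap_matchedMap_reverseMap]
  abel

end IsAcyclicMatching

theorem isTrans_transGen_and_deg_eq : IsTrans V fun c₂ c =>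
    Relation.TransGen (fun c' c => MEdge deg wt M c c') c₂ c ∧ deg c₂ = deg c :=
  ⟨fun _ _ _ h h' => ⟨h.1.trans h'.1, h.2.trans h'.2⟩⟩

namespace IsMatchedComplex

variable (H : IsMatchedComplex deg wt M d) {i : ℕ}
include H

theorem d_mem_gr {x : V →₀ R} (hx : x ∈ gr R deg (i + 1)) : d x ∈ gr R deg i := by
  refine map_mem_of_single_mem (fun c hc => ?_) hx
  intro c' hc'
  rw [Finset.mem_coe, Finsupp.mem_support_iff, H.d_single_apply] at hc'
  exact Nat.succ_injective ((H.deg_eq hc').symm.trans hc)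

theorem finite_setOf_mEdge (c : V) : {c' | MEdge deg wt M c c'}.Finite := by
  have hsource : {u | (u, c) ∈ M}.Subsingleton := fun u hu u' hu' =>
    H.isAcyclicMatching.source_unique hu hu'
  refine ((d (single c 1)).support.finite_toSet.union hsource.finite).subset ?_
  rintro c' (⟨⟨-, h⟩, -⟩ | ⟨-, h⟩)
  · exact .inl (by simpa [H.d_single_apply] using h)
  · exact .inr h

theorem pathsFrom_finite (c : V) : (pathsFrom deg wt M c).Finite :=
  AlgMorse.pathsFrom_finite H.wellFounded H.finite_setOf_mEdge c

theorem sub_matchedMap_single_apply (c c' : V) [Decidable ((c, c') ∈ M)] :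
    (d - matchedMap wt M) (single c 1) c' = if (c, c') ∈ M then 0 else wt c c' := by
  rw [LinearMap.sub_apply, Finsupp.sub_apply, H.d_single_apply]
  split_ifs with h
  · rw [H.isAcyclicMatching.matchedMap_single h, Finsupp.single_eq_same, sub_self]
  by_cases hc : ∃ l, (c, l) ∈ M
  · obtain ⟨l, hl⟩ := hc
    rw [H.isAcyclicMatching.matchedMap_single hl,
      Finsupp.single_eq_of_ne (by rintro rfl; exact h hl), sub_zero]
  · rw [matchedMap_single_of_notMem (not_exists.1 hc), Finsupp.zero_apply, sub_zero]

theorem sub_matchedMap_single_mem (c : V) : (d - matchedMap wt M) (single c 1) ∈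
    supported R R {c' | Edge deg wt c c' ∧ (c, c') ∉ M} := by
  intro c' hc'
  classical
  rw [Finset.mem_coe, Finsupp.mem_support_iff, H.sub_matchedMap_single_apply,
    ne_eq, ite_eq_left_iff, not_forall] at hc'
  obtain ⟨hM, hwt⟩ := hc'
  exact ⟨⟨H.deg_eq hwt, hwt⟩, hM⟩

section Zigzag

theorem reverseMap_sub_matchedMap_single_mem (c : V) :
    reverseMap wt M ((d - matchedMap wt M) (single c 1)) ∈ supported R R
      {c₂ | Relation.TransGen (fun c' c => MEdge deg wt M c c') c₂ c ∧ deg c₂ = deg c} := by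
  refine map_mem_of_single_mem (fun c' hc' => ?_) (H.sub_matchedMap_single_mem c)
  by_cases h : ∃ u, (u, c') ∈ M
  · obtain ⟨u, hu⟩ := h
    rw [H.isAcyclicMatching.reverseMap_single hu]
    have hedge := H.isAcyclicMatching.edge _ hu
    exact Finsupp.single_mem_supported _ _
      ⟨.tail (.single (.inr ⟨hedge, hu⟩)) (.inl hc'), hedge.1.trans hc'.1.1.symm⟩
  · rw [reverseMap_single_of_notMem (not_exists.1 h)]
    exact zero_mem _

theorem wellFounded_transGen_and_deg_eq : WellFounded fun c₂ c =>
    Relation.TransGen (fun c' c => MEdge deg wt M c c') c₂ c ∧ deg c₂ = deg c :=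
  Subrelation.wf And.left H.wellFounded.transGen

/-- `zigzagMap` as an automorphism. -/
def zigzagEquiv : (V →₀ R) ≃ₗ[R] (V →₀ R) :=
  haveI := isTrans_transGen_and_deg_eq (deg := deg) (wt := wt) (M := M)
  LinearEquiv.ofBijective (zigzagMap wt M d) (bijective_id_add_of_unitriangular
    H.wellFounded_transGen_and_deg_eq H.reverseMap_sub_matchedMap_single_mem)

theorem zigzagEquiv_symm_mem_gr {x : V →₀ R} (hx : x ∈ gr R deg i) :
    H.zigzagEquiv.symm x ∈ gr R deg i := by
  refine map_mem_of_single_mem (f := H.zigzagEquiv.symm.toLinearMap) (fun c hc => ?_) hx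
  have := isTrans_transGen_and_deg_eq (deg := deg) (wt := wt) (M := M)
  obtain ⟨y, hy, hzy⟩ := exists_unitriangular_preimage H.wellFounded_transGen_and_deg_eq
    (T := reverseMap wt M ∘ₗ (d - matchedMap wt M)) H.reverseMap_sub_matchedMap_single_mem c
  have hsymm : H.zigzagEquiv.symm (single c 1) = single c 1 + y :=
    (LinearEquiv.symm_apply_eq _).2 hzy.symm
  rw [LinearEquiv.coe_coe, hsymm]
  exact add_mem (Finsupp.single_mem_supported _ _ hc)
    (Finsupp.supported_mono (fun c' h => h.2.trans hc) hy)

end Zigzag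

end IsMatchedComplex

end AlgMorse

namespace AlgMorse

variable {V R : Type*} [Ring R] {deg : V → ℕ} {wt : V → V → R} {M : Set (V × V)}
  {d : (V →₀ R) →ₗ[R] (V →₀ R)}

section PathSum

variable (deg wt M) in
/-- The linear extension of `c ↦ Γ(c, f)`. -/
def pathSum (f : V) : (V →₀ R) →ₗ[R] R :=
  Finsupp.linearCombination R fun c => Gam deg wt M c f

theorem pathSum_single (c f : V) : pathSum deg wt M f (single c 1) = Gam deg wt M c f := by
  rw [pathSum, Finsupp.linearCombination_single, one_smul]

theorem IsAcyclicMatching.pathSum_eq_zero (hM : IsAcyclicMatching deg wt M) {f : V}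
    (hf : Critical M f) {x : V →₀ R} (hx : x ∈ supported R R {c | deg c < deg f}) :
    pathSum deg wt M f x = 0 := by
  refine map_eq_map_of_single_eq (g := 0) (fun c hc => ?_) hx
  rw [pathSum_single, hM.Gam_eq_zero_of_deg_lt hf hc, LinearMap.zero_apply]

end PathSum

theorem IsAcyclicMatching.reverseMap_single_apply (hM : IsAcyclicMatching deg wt M) (c c' : V)
    [Decidable ((c', c) ∈ M)] :
    reverseMap wt M (single c 1) c' = if (c', c) ∈ M then Ring.inverse (wt c' c) else 0 := by
  split_ifs with h
  · rw [hM.reverseMap_single h, Finsupp.single_eq_same]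
  by_cases hc : ∃ u, (u, c) ∈ M
  · obtain ⟨u, hu⟩ := hc
    rw [hM.reverseMap_single hu, Finsupp.single_eq_of_ne (by rintro rfl; exact h hu)]
  · rw [reverseMap_single_of_notMem (not_exists.1 hc), Finsupp.zero_apply]

theorem critIncl_critPart_zero (hcrit : ∀ c, deg c = 0 → Critical M c)
    {x : V →₀ R} (hx : x ∈ gr R deg 0) :
    critIncl R deg M 0 (critPart R deg M 0 x) = x :=
  map_eq_map_of_single_eq (f := critIncl R deg M 0 ∘ₗ critPart R deg M 0) (g := LinearMap.id)
    (fun c hc => critIncl_critPart_single (⟨c, hcrit c hc, hc⟩ : CritCell deg M 0) 1) hx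

namespace IsMatchedComplex

variable (H : IsMatchedComplex deg wt M d) {i : ℕ}
include H

open Classical in
theorem sub_sub_single_apply (c c' : V) :
    (d - matchedMap wt M - reverseMap wt M) (single c 1) c' =
      if MEdge deg wt M c c' then stepWeight deg wt c c' else 0 := by
  rw [LinearMap.sub_apply, Finsupp.sub_apply, H.sub_matchedMap_single_apply,
    H.isAcyclicMatching.reverseMap_single_apply]
  by_cases hrev : (c', c) ∈ M
  · have hedge := H.isAcyclicMatching.edge _ hrev
    have hlt : deg c < deg c' := Nat.lt_of_succ_le hedge.1.ge
    have hwt : wt c c' = 0 := by_contra fun h => hlt.not_gt (Nat.lt_of_succ_le (H.deg_eq h).ge)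
    have hstep : MEdge deg wt M c c' := .inr ⟨hedge, hrev⟩
    rw [if_pos hrev, if_pos hstep, stepWeight, if_pos hlt, hwt, ite_self, zero_sub]
  · have hstep : MEdge deg wt M c c' ↔ (c, c') ∉ M ∧ wt c c' ≠ 0 :=
      ⟨fun h => h.elim (fun h => ⟨h.2, h.1.2⟩) fun h => absurd h.2 hrev,
        fun h => .inl ⟨⟨H.deg_eq h.2, h.2⟩, h.1⟩⟩
    rw [if_neg hrev, sub_zero]
    by_cases hM : (c, c') ∈ M
    · rw [if_pos hM, if_neg fun h => (hstep.1 h).1 hM]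
    by_cases hwt : wt c c' = 0
    · rw [if_neg hM, if_neg fun h => (hstep.1 h).2 hwt, hwt]
    · have hgt : ¬ deg c < deg c' := (Nat.lt_of_succ_le (H.deg_eq hwt).ge).not_gt
      rw [if_neg hM, if_pos (hstep.2 ⟨hM, hwt⟩), stepWeight, if_neg hgt]

theorem pathSum_eq (f : V) (x : V →₀ R) :
    pathSum deg wt M f x = x f + pathSum deg wt M f ((d - matchedMap wt M) x) -
      pathSum deg wt M f (reverseMap wt M x) := by
  classical
  rw [add_sub_assoc, ← map_sub, ← LinearMap.sub_apply]
  suffices pathSum deg wt M f = Finsupp.lapply f +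
      pathSum deg wt M f ∘ₗ (d - matchedMap wt M - reverseMap wt M) from
    LinearMap.congr_fun this x
  refine linearMap_ext_single_one fun c => ?_
  have hsupp : ((d - matchedMap wt M - reverseMap wt M) (single c 1)).support ⊆
      (H.finite_setOf_mEdge c).toFinset := by
    intro c' hc'
    rw [Finsupp.mem_support_iff, H.sub_sub_single_apply] at hc'
    simpa using fun h => hc' (if_neg h)
  rw [pathSum_single, Gam_eq_single_add_finsum H.pathsFrom_finite H.finite_setOf_mEdge,
    LinearMap.add_apply, LinearMap.comp_apply, Finsupp.lapply_apply, pathSum,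
    Finsupp.linearCombination_apply, Finsupp.sum_of_support_subset _ hsupp _ (by simp),
    finsum_mem_eq_finite_toFinset_sum _ (H.finite_setOf_mEdge c)]
  refine congrArg _ (Finset.sum_congr rfl fun c' hc' => ?_)
  rw [H.sub_sub_single_apply, if_pos (by simpa using hc'), smul_eq_mul]

theorem pathSum_sub_matchedMap_eq_zero {f : V} (hf : Critical M f) {x : V →₀ R}
    (hx : x ∈ gr R deg (deg f)) : pathSum deg wt M f ((d - matchedMap wt M) x) = 0 := by
  refine H.isAcyclicMatching.pathSum_eq_zero hf (map_mem_of_single_mem (fun c hc => ?_) hx)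
  refine Finsupp.supported_mono (fun c' hc' => ?_) (H.sub_matchedMap_single_mem c)
  exact Nat.lt_of_succ_le (hc'.1.1.symm.trans hc).le

theorem pathSum_eq_apply {f : V} (hf : Critical M f) {x : V →₀ R} (hx : x ∈ gr R deg (deg f))
    (h0 : reverseMap wt M x = 0) : pathSum deg wt M f x = x f := by
  rw [H.pathSum_eq, H.pathSum_sub_matchedMap_eq_zero hf hx, h0, map_zero, add_zero, sub_zero]

theorem pathSum_zigzagMap_eq_d_apply {f : V} (hf : Critical M f) {y : V →₀ R}
    (hy : y ∈ gr R deg (deg f + 1)) (h0 : reverseMap wt M y = 0)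
    (hd : reverseMap wt M (d y) = 0) :
    pathSum deg wt M f (zigzagMap wt M d y) = d y f := by
  have hyf : y f = 0 := by
    by_contra h
    exact Nat.succ_ne_self _ (hy (Finsupp.mem_support_iff.2 h)).symm
  have hy_sum : pathSum deg wt M f y = d y f - pathSum deg wt M f (matchedMap wt M y) := by
    rw [H.pathSum_eq, hyf, h0, LinearMap.sub_apply, map_sub,
      H.pathSum_eq_apply hf (H.d_mem_gr hy) hd, map_zero, zero_add, sub_zero]
  have hmy_sum : pathSum deg wt M f (matchedMap wt M y) =
      - pathSum deg wt M f (reverseMap wt M (matchedMap wt M y)) := by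
    have hmy := H.isAcyclicMatching.matchedMap_mem_gr hy
    rw [H.pathSum_eq, H.isAcyclicMatching.matchedMap_apply_eq_zero hf.notMem_target,
      H.pathSum_sub_matchedMap_eq_zero hf hmy, add_zero, zero_sub]
  rw [zigzagMap_apply, hd, add_zero, map_sub, hy_sum, hmy_sum, sub_neg_eq_add, add_sub_cancel_right]

section Lift

/-- The inclusion of the Morse complex into the given complex. -/
def lift (i : ℕ) : (CritCell deg M i →₀ R) →ₗ[R] (V →₀ R) :=
  H.zigzagEquiv.symm.toLinearMap ∘ₗ critIncl R deg M i

theorem zigzagMap_lift (x : CritCell deg M i →₀ R) :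
    zigzagMap wt M d (H.lift i x) = critIncl R deg M i x :=
  H.zigzagEquiv.apply_symm_apply _

theorem lift_mem_gr (x : CritCell deg M i →₀ R) : H.lift i x ∈ gr R deg i :=
  H.zigzagEquiv_symm_mem_gr (critIncl_mem_gr x)

theorem reverseMap_lift (x : CritCell deg M i →₀ R) : reverseMap wt M (H.lift i x) = 0 := by
  rw [← H.isAcyclicMatching.reverseMap_zigzagMap (d := d), H.zigzagMap_lift, reverseMap_critIncl]

theorem reverseMap_d_lift (x : CritCell deg M i →₀ R) :
    reverseMap wt M (d (H.lift i x)) = 0 := by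
  rw [← H.isAcyclicMatching.reverseMap_matchedMap_zigzagMap, H.zigzagMap_lift, matchedMap_critIncl,
    map_zero]

theorem lift_critPart {y : V →₀ R} (hy : y ∈ gr R deg i) (h0 : reverseMap wt M y = 0)
    (hd : reverseMap wt M (d y) = 0) : H.lift i (critPart R deg M i y) = y := by
  have hzigzag : critIncl R deg M i (critPart R deg M i y) = zigzagMap wt M d y := by
    rw [H.isAcyclicMatching.critIncl_critPart hy, zigzagMap_apply, h0, hd, map_zero, add_zero,
      sub_zero]
  rw [lift, LinearMap.comp_apply, hzigzag]
  exact H.zigzagEquiv.symm_apply_apply y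

theorem lift_injective : Function.Injective (H.lift i) :=
  H.zigzagEquiv.symm.injective.comp (Function.LeftInverse.injective critPart_critIncl)

theorem Gam_eq_d_lift_apply (e : CritCell deg M (i + 1)) (f : CritCell deg M i) :
    Gam deg wt M e.1 f.1 = d (H.lift (i + 1) (single e 1)) f.1 := by
  have hmem : H.lift (i + 1) (single e 1) ∈ gr R deg (deg f.1 + 1) := by
    rw [f.2.2]
    exact H.lift_mem_gr _
  rw [← H.pathSum_zigzagMap_eq_d_apply f.2.1 hmem (H.reverseMap_lift _) (H.reverseMap_d_lift _),
    H.zigzagMap_lift, critIncl_single, pathSum_single]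

theorem morseD_eq_critPart (x : CritCell deg M (i + 1) →₀ R) :
    morseD deg wt M i x = critPart R deg M i (d (H.lift (i + 1) x)) := by
  suffices morseD deg wt M i = critPart R deg M i ∘ₗ d ∘ₗ H.lift (i + 1) from
    LinearMap.congr_fun this x
  refine linearMap_ext_single_one fun e => ?_
  rw [morseD, Finsupp.linearCombination_single, one_smul]
  simp only [H.Gam_eq_d_lift_apply, LinearMap.comp_apply, ← critPart_apply]
  set g := critPart R deg M i (d (H.lift (i + 1) (single e 1)))
  rw [finsum_eq_sum_of_support_subset (s := g.support) _ fun f hf => by simpa using hf]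
  exact Finsupp.sum_single _

theorem lift_morseD (x : CritCell deg M (i + 1) →₀ R) :
    H.lift i (morseD deg wt M i x) = d (H.lift (i + 1) x) := by
  rw [H.morseD_eq_critPart]
  exact H.lift_critPart (H.d_mem_gr (H.lift_mem_gr x)) (H.reverseMap_d_lift x)
    (by rw [H.d_d, map_zero])

theorem exists_reverseMap_sub_d_eq_zero {z : V →₀ R} (hz : z ∈ gr R deg i) :
    ∃ y ∈ gr R deg (i + 1), reverseMap wt M (z - d y) = 0 := by
  refine ⟨_, H.zigzagEquiv_symm_mem_gr (H.isAcyclicMatching.reverseMap_mem_gr hz), ?_⟩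
  have hzigzag : zigzagMap wt M d (H.zigzagEquiv.symm (reverseMap wt M z)) = reverseMap wt M z :=
    H.zigzagEquiv.apply_symm_apply _
  rw [map_sub, ← H.isAcyclicMatching.reverseMap_matchedMap_zigzagMap, hzigzag,
    H.isAcyclicMatching.reverseMap_matchedMap_reverseMap, sub_self]

theorem exists_morseD_eq {x : CritCell deg M i →₀ R} {z : V →₀ R} (hz : z ∈ gr R deg (i + 1))
    (hzx : d z = H.lift i x) : ∃ x', morseD deg wt M i x' = x := by
  obtain ⟨y, hy, hzy⟩ := H.exists_reverseMap_sub_d_eq_zero hz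
  have hd : d (z - d y) = H.lift i x := by rw [map_sub, H.d_d, sub_zero, hzx]
  refine ⟨critPart R deg M (i + 1) (z - d y), H.lift_injective ?_⟩
  rw [H.lift_morseD, H.lift_critPart (sub_mem hz (H.d_mem_gr hy)) hzy
    (by rw [hd, H.reverseMap_lift]), hd]

theorem morseD_exact (hexact : ∀ x ∈ gr R deg (i + 1), d x = 0 → ∃ y ∈ gr R deg (i + 2), d y = x) :
    Function.Exact (morseD deg wt M (i + 1)) (morseD deg wt M i) := by
  refine fun x => ⟨fun h => ?_, ?_⟩
  · obtain ⟨z, hz, hzx⟩ := hexact _ (H.lift_mem_gr x) (by rw [← H.lift_morseD, h, map_zero])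
    exact H.exists_morseD_eq hz hzx
  · rintro ⟨x, rfl⟩
    exact H.lift_injective (by rw [H.lift_morseD, H.lift_morseD, H.d_d, map_zero])

end Lift

section Augmentation

variable (hcrit : ∀ c, deg c = 0 → Critical M c)
include hcrit

theorem lift_zero_eq_critIncl (x : CritCell deg M 0 →₀ R) :
    H.lift 0 x = critIncl R deg M 0 x := by
  have hmatched : matchedMap wt M (H.lift 0 x) = 0 :=
    map_eq_map_of_single_eq (g := 0) (fun c hc => matchedMap_single_of_notMem
      (hcrit c hc).notMem_source) (H.lift_mem_gr x)
  have h := H.zigzagMap_lift x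
  rwa [zigzagMap_apply, H.reverseMap_d_lift, hmatched, map_zero, add_zero, sub_zero] at h

theorem isFreeRes {N : Type*} [AddCommGroup N] [Module R N] (ε : (V →₀ R) →ₗ[R] N)
    (hexact : ∀ i, ∀ x ∈ gr R deg (i + 1), d x = 0 → ∃ y ∈ gr R deg (i + 2), d y = x)
    (hεd : ∀ x ∈ gr R deg 1, ε (d x) = 0)
    (hε : ∀ x ∈ gr R deg 0, ε x = 0 → ∃ y ∈ gr R deg 1, d y = x)
    (hsurj : ∀ n, ∃ x ∈ gr R deg 0, ε x = n) :
    IsFreeRes R (fun i => CritCell deg M i →₀ R) (morseD deg wt M) (ε ∘ₗ critIncl R deg M 0) where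
  free _ := inferInstance
  exact i := H.morseD_exact (hexact i)
  exact_zero x := by
    rw [LinearMap.comp_apply, ← H.lift_zero_eq_critIncl hcrit]
    constructor
    · intro h
      obtain ⟨z, hz, hzx⟩ := hε _ (H.lift_mem_gr x) h
      exact H.exists_morseD_eq hz hzx
    · rintro ⟨x, rfl⟩
      rw [H.lift_morseD, hεd _ (H.lift_mem_gr x)]
  surjective n := by
    obtain ⟨x, hx, rfl⟩ := hsurj n
    exact ⟨critPart R deg M 0 x, congrArg ε (critIncl_critPart_zero hcrit hx)⟩

end Augmentation

end IsMatchedComplex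

end AlgMorse

/-! ### Standard monomials that survive the matching -/

theorem wellFounded_of_finite_setOf_rel {α : Type*} {r : α → α → Prop} [IsStrictOrder α r]
    (h : ∀ b, {a | r a b}.Finite) : WellFounded r := by
  refine Subrelation.wf (fun {a b} hab => ?_) (measure fun b => {a | r a b}.ncard).wf
  exact Set.ncard_lt_ncard
    ⟨fun _ hc => trans_of r hc hab, fun hba => irrefl_of r a (hba hab)⟩ (h b)

/-- A monomial order that refines the order by the length `len`, with finitely many monomials of
each length. -/
structure IsGradedOrder {Mon : Type*} [Monoid Mon] (lt : Mon → Mon → Prop) (len : Mon → ℕ) : Prop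
    extends IsStrictTotalOrder Mon lt where
  mul_lt : ∀ a b c e, lt a b → lt (c * a * e) (c * b * e)
  cancel : ∀ a b c : Mon, a * b = a * c → b = c
  len_mul : ∀ a b, len (a * b) = len a + len b
  len_eq_zero : ∀ a, len a = 0 → a = 1
  lt_of_len_lt : ∀ a b, len a < len b → lt a b
  finite : ∀ N, {w | len w ≤ N}.Finite

namespace IsGradedOrder

variable {Mon : Type*} [Monoid Mon] {lt : Mon → Mon → Prop} {len : Mon → ℕ}

theorem len_le (H : IsGradedOrder lt len) {a b : Mon} (h : lt a b) : len a ≤ len b :=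
  not_lt.1 fun hlen => H.irrefl a (H.trans _ _ _ h (H.lt_of_len_lt _ _ hlen))

theorem len_one (H : IsGradedOrder lt len) : len 1 = 0 := by
  simpa using H.len_mul 1 1

theorem len_pos (H : IsGradedOrder lt len) {a : Mon} (h : a ≠ 1) : 0 < len a :=
  Nat.pos_of_ne_zero fun h0 => h (H.len_eq_zero a h0)

theorem one_lt (H : IsGradedOrder lt len) {a : Mon} (h : a ≠ 1) : lt 1 a :=
  H.lt_of_len_lt _ _ (H.len_one ▸ H.len_pos h)

theorem len_le_of_dvd (H : IsGradedOrder lt len) {a b : Mon} (h : a ∣ b) : len a ≤ len b := by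
  obtain ⟨c, rfl⟩ := h
  exact H.len_mul a c ▸ Nat.le_add_right _ _

theorem len_lt_of_dvd (H : IsGradedOrder lt len) {a b : Mon} (h : a ∣ b) (hne : a ≠ b) :
    len a < len b := by
  obtain ⟨c, rfl⟩ := h
  have hc : c ≠ 1 := fun h1 => hne (h1 ▸ (mul_one a).symm)
  exact H.len_mul a c ▸ Nat.lt_add_of_pos_right (H.len_pos hc)

theorem ne_mul (H : IsGradedOrder lt len) (a : Mon) {b : Mon} (h : b ≠ 1) : a ≠ a * b := by
  intro hab
  have hlen := H.len_mul a b
  rw [← hab] at hlen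
  have := H.len_pos h
  omega

theorem ne_mul_left (H : IsGradedOrder lt len) {a : Mon} (h : a ≠ 1) (b : Mon) : b ≠ a * b := by
  intro hab
  have hlen := H.len_mul a b
  rw [← hab] at hlen
  have := H.len_pos h
  omega

theorem mul_ne_one (H : IsGradedOrder lt len) {a b : Mon} (h : a ≠ 1 ∨ b ≠ 1) : a * b ≠ 1 := by
  intro hab
  have hlen := H.len_mul a b
  rw [hab, H.len_one] at hlen
  rcases h with h | h
  all_goals have := H.len_pos h; omega

theorem len_le_len_prod (H : IsGradedOrder lt len) {l : List Mon} {w : Mon} (hw : w ∈ l) :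
    len w ≤ len l.prod := by
  obtain ⟨s, t, rfl⟩ := List.append_of_mem hw
  rw [List.prod_append, List.prod_cons, H.len_mul, H.len_mul]
  omega

theorem wellFounded (H : IsGradedOrder lt len) : WellFounded lt :=
  haveI := H.toIsStrictTotalOrder
  wellFounded_of_finite_setOf_rel fun b => (H.finite (len b)).subset fun _ => H.len_le

end IsGradedOrder

namespace StdMonomials

section LeadingDivisor

variable {Mon : Type*} [Monoid Mon]

/-- `u` is a minimal element of `T` for divisibility. -/
def DvdMinimal (T : Mon → Prop) (u : Mon) : Prop := T u ∧ ∀ u', u' ∣ u → u' ≠ u → ¬ T u'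

/-- `u` is the largest of the minimal elements of `T` that divide `w`. The matching splits `w` as
`u * v` for this `u`. -/
def IsLeadingDivisor (lt : Mon → Mon → Prop) (T : Mon → Prop) (w u : Mon) : Prop :=
  DvdMinimal T u ∧ u ∣ w ∧ ∀ u', DvdMinimal T u' → u' ∣ w → ¬ lt u u'

variable {lt : Mon → Mon → Prop} {len : Mon → ℕ}

theorem exists_dvdMinimal_dvd (H : IsGradedOrder lt len) {T : Mon → Prop} {w : Mon} (hw : T w) :
    ∃ u, DvdMinimal T u ∧ u ∣ w := by
  obtain ⟨u, ⟨hu, hdvd⟩, hmin⟩ :=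
    (measure len).wf.has_min {u | T u ∧ u ∣ w} ⟨w, hw, dvd_rfl⟩
  exact ⟨u, ⟨hu, fun u' hu' hne hT =>
    hmin u' ⟨hT, hu'.trans hdvd⟩ (H.len_lt_of_dvd hu' hne)⟩, hdvd⟩

theorem exists_isLeadingDivisor (H : IsGradedOrder lt len) {T : Mon → Prop} {w : Mon}
    (hw : T w) : ∃ u, IsLeadingDivisor lt T w u := by
  have := H.toIsStrictTotalOrder
  obtain ⟨u, hu⟩ := exists_dvdMinimal_dvd H hw
  have hfin : {u | DvdMinimal T u ∧ u ∣ w}.Finite :=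
    (H.finite (len w)).subset fun u hu => H.len_le_of_dvd hu.2
  obtain ⟨b, -, hb⟩ := (hfin.wellFoundedOn (r := Function.swap lt)).has_min Set.univ
    ⟨⟨u, hu⟩, trivial⟩
  exact ⟨b.1, b.2.1, b.2.2, fun u' hu' hdvd => hb ⟨u', hu', hdvd⟩ trivial⟩

theorem IsLeadingDivisor.unique (H : IsGradedOrder lt len) {T : Mon → Prop} {w u u' : Mon}
    (h : IsLeadingDivisor lt T w u) (h' : IsLeadingDivisor lt T w u') : u = u' :=
  H.trichotomous u u' (h.2.2 _ h'.1 h'.2.1) (h'.2.2 _ h.1 h.2.1)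

end LeadingDivisor

variable {k A Mon : Type*} [Field k] [Ring A] [Algebra k A] [Monoid Mon]

/-- The properties of the standard monomials of a quotient by an ideal with a Gröbner basis. -/
structure IsAdmissible (D : StdMonomials k A Mon) (len : Mon → ℕ) : Prop where
  order : IsGradedOrder D.lt len
  left_mem : ∀ a b, a * b ∈ D.G → a ≠ 1 → a ∈ D.G
  right_mem : ∀ a b, a * b ∈ D.G → b ≠ 1 → b ∈ D.G
  one_notMem : (1 : Mon) ∉ D.G
  exists_repr : ∀ w, ∃ r, D.IsRepr (D.val w) r ∧ ∀ v ∈ r.support, v = w ∨ D.lt v w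
  indep : ∀ r : Mon →₀ k, (∀ v ∈ r.support, v ∈ D.G ∨ v = 1) →
    r.sum (fun v t => t • D.val v) = 0 → r = 0
  span : ∀ a, a ∈ Submodule.span k (Set.range D.val)

/-- `D.Survives p w` says that the cells `[p|w|…]` survive the matchings in the coordinates before
that of `w`. The list `p` is in reverse order. -/
def Survives (D : StdMonomials k A Mon) : List Mon → Mon → Prop
  | [], w => w ∈ D.G
  | u :: p, w => w ∈ D.G ∧ DvdMinimal (Survives D p) u ∧
      ¬ (u * w ∈ D.G ∧ IsLeadingDivisor D.lt (Survives D p) (u * w) u)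

/-- Membership in `B` of the cells `[p|w|…]` is decided by `D.Survives p w`. This is the invariant
of the construction of `D.critAfter`. -/
def SurvivorsAt (D : StdMonomials k A Mon) (B : Set D.Cell) (p : List Mon) : Prop :=
  ∀ w s (c : D.Cell), c.1 = p.reverse ++ w :: s → (c ∈ B ↔ D.Survives p w)

variable {D : StdMonomials k A Mon} {len : Mon → ℕ}

theorem Survives.mem_G {p : List Mon} {w : Mon} (h : D.Survives p w) : w ∈ D.G := by
  cases p with
  | nil => exact h
  | cons u p => exact h.1

theorem exists_of_mem_matchAt {B : Set D.Cell} {j : ℕ} {c c' : D.Cell}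
    (h : (c, c') ∈ D.matchAt B j) :
    ∃ (p : List Mon) (u v : Mon) (s : List Mon), p.length = j ∧ c.1 = p.reverse ++ u :: v :: s ∧
      c'.1 = p.reverse ++ (u * v) :: s ∧ D.Chosen B p.reverse s (u * v) u := by
  obtain ⟨-, -, p, s, u, v, hlen, hc, hc', hchosen⟩ := h
  refine ⟨p.reverse, u, v, s, by simpa using hlen, ?_, ?_, by simpa using hchosen⟩
  · simpa using hc
  · simpa using hc'

theorem reverse_append_inj {α : Type*} {p p' s s' : List α} (h : p.reverse ++ s = p'.reverse ++ s')
    (hlen : p.length = p'.length) : p = p' ∧ s = s' := by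
  obtain ⟨hp, hs⟩ := List.append_inj h (by simpa using hlen)
  exact ⟨List.reverse_injective hp, hs⟩

theorem forall_mem_of_replace {α : Type*} {G : Set α} {p l l' s : List α}
    (h : ∀ w ∈ p ++ (l ++ s), w ∈ G) (hl' : ∀ w ∈ l', w ∈ G) : ∀ w ∈ p ++ (l' ++ s), w ∈ G := by
  simp only [List.mem_append, or_imp, forall_and] at h ⊢
  exact ⟨h.1, hl', h.2.2⟩

theorem splits_iff {B : Set D.Cell} {p s : List Mon} (hB : D.SurvivorsAt B p)
    (hcell : ∀ x ∈ p.reverse ++ s, x ∈ D.G) {w u : Mon} :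
    D.Splits B p.reverse s w u ↔ D.Survives p u ∧ ∃ v ∈ D.G, u * v = w := by
  constructor
  · rintro ⟨v, rfl, c, hc, hcs⟩
    rw [List.append_assoc] at hcs
    exact ⟨(hB _ _ c hcs).1 hc, v, c.2 v (by simp [hcs]), rfl⟩
  · rintro ⟨hu, v, hv, rfl⟩
    have hsplit : ∀ x ∈ p.reverse ++ ([u, v] ++ s), x ∈ D.G :=
      forall_mem_of_replace (l := []) hcell (by simp [hu.mem_G, hv])
    exact ⟨v, rfl, ⟨_, hsplit⟩, (hB u (v :: s) ⟨_, hsplit⟩ rfl).2 hu, by simp⟩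

namespace IsAdmissible

theorem ne_one (H : D.IsAdmissible len) {w : Mon} (h : w ∈ D.G) : w ≠ 1 :=
  fun h1 => H.one_notMem (h1 ▸ h)

theorem survives_of_dvd (H : D.IsAdmissible len) {p : List Mon} {v w : Mon}
    (hv : D.Survives p v) (hdvd : v ∣ w) (hw : w ∈ D.G) : D.Survives p w := by
  cases p with
  | nil => exact hw
  | cons u p =>
    obtain ⟨hvG, hu, hlead⟩ := hv
    refine ⟨hw, hu, fun ⟨huw, hdiv⟩ => hlead ?_⟩
    obtain ⟨c, rfl⟩ := hdvd
    rw [← mul_assoc] at huw hdiv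
    exact ⟨H.left_mem _ c huw (H.order.mul_ne_one (.inr (H.ne_one hvG))), hdiv.1, dvd_mul_right _ _,
      fun u' hu' hdvd => hdiv.2.2 u' hu' (hdvd.mul_right c)⟩

theorem splits_iff_dvd (H : D.IsAdmissible len) {B : Set D.Cell} {p s : List Mon}
    (hB : D.SurvivorsAt B p) (hcell : ∀ x ∈ p.reverse ++ s, x ∈ D.G) {w u : Mon} (hw : w ∈ D.G) :
    D.Splits B p.reverse s w u ↔ D.Survives p u ∧ u ∣ w ∧ u ≠ w := by
  rw [splits_iff hB hcell]
  refine and_congr_right fun _ => ⟨?_, ?_⟩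
  · rintro ⟨v, hv, rfl⟩
    exact ⟨dvd_mul_right _ _, H.order.ne_mul _ (H.ne_one hv)⟩
  · rintro ⟨⟨v, rfl⟩, hne⟩
    exact ⟨v, H.right_mem _ _ hw fun h1 => hne (by simp [h1]), rfl⟩

theorem minSplits_iff (H : D.IsAdmissible len) {B : Set D.Cell} {p s : List Mon}
    (hB : D.SurvivorsAt B p) (hcell : ∀ x ∈ p.reverse ++ s, x ∈ D.G) {w u : Mon} (hw : w ∈ D.G) :
    D.MinSplits B p.reverse s w u ↔ DvdMinimal (D.Survives p) u ∧ u ∣ w ∧ u ≠ w := by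
  simp only [MinSplits, H.splits_iff_dvd hB hcell hw, DvdMinimal]
  constructor
  · rintro ⟨⟨hu, hdvd, hne⟩, hmin⟩
    refine ⟨⟨hu, fun u' hu' hne' hsurv => hmin u' hu' hne' ⟨hsurv, hu'.trans hdvd, ?_⟩⟩, hdvd, hne⟩
    rintro rfl
    exact (H.order.len_lt_of_dvd hu' hne').not_ge (H.order.len_le_of_dvd hdvd)
  · rintro ⟨⟨hu, hmin⟩, hdvd, hne⟩
    exact ⟨⟨hu, hdvd, hne⟩, fun u' hu' hne' hsplit => hmin u' hu' hne' hsplit.1⟩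

theorem chosen_iff (H : D.IsAdmissible len) {B : Set D.Cell} {p s : List Mon}
    (hB : D.SurvivorsAt B p) (hcell : ∀ x ∈ p.reverse ++ s, x ∈ D.G) {w u : Mon} (hw : w ∈ D.G) :
    D.Chosen B p.reverse s w u ↔ IsLeadingDivisor D.lt (D.Survives p) w u ∧ u ≠ w := by
  simp only [Chosen, H.minSplits_iff hB hcell hw, IsLeadingDivisor]
  constructor
  · rintro ⟨⟨hu, hdvd, hne⟩, hmax⟩
    refine ⟨⟨hu, hdvd, fun u' hu' hdvd' => hmax u' ⟨hu', hdvd', ?_⟩⟩, hne⟩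
    rintro rfl
    exact hu'.2 u hdvd hne hu.1
  · rintro ⟨⟨hu, hdvd, hmax⟩, hne⟩
    exact ⟨⟨hu, hdvd, hne⟩, fun u' hu' => hmax u' hu'.1 hu'.2.1⟩

theorem mem_matchAt_iff (H : D.IsAdmissible len) {B : Set D.Cell} {p : List Mon}
    (hB : D.SurvivorsAt B p) {c c' : D.Cell} {u v : Mon} {s : List Mon}
    (hc : c.1 = p.reverse ++ u :: v :: s) (hc' : c'.1 = p.reverse ++ (u * v) :: s) :
    (c, c') ∈ D.matchAt B p.length ↔ IsLeadingDivisor D.lt (D.Survives p) (u * v) u := by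
  have huv : u * v ∈ D.G := c'.2 _ (by simp [hc'])
  have hv : v ∈ D.G := c.2 _ (by simp [hc])
  have hcell : ∀ x ∈ p.reverse ++ s, x ∈ D.G :=
    forall_mem_of_replace (l := [u, v]) (l' := []) (hc ▸ c.2) (by simp)
  have hchosen := H.chosen_iff hB hcell huv (u := u)
  constructor
  · intro h
    obtain ⟨p', u', v', s', hlen, h1, -, h'⟩ := exists_of_mem_matchAt h
    obtain ⟨rfl, hs⟩ := reverse_append_inj (hc.symm.trans h1) hlen.symm
    obtain ⟨rfl, rfl, rfl⟩ := by simpa using hs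
    exact (hchosen.1 h').1
  · intro hlead
    exact ⟨(hB _ _ c hc).2 hlead.1.1,
      (hB _ _ c' hc').2 (H.survives_of_dvd hlead.1.1 (dvd_mul_right _ _) huv),
      p.reverse, s, u, v, by simp, by simp [hc], by simp [hc'],
      hchosen.2 ⟨hlead, H.order.ne_mul _ (H.ne_one hv)⟩⟩

theorem exists_mem_matchAt_source_iff (H : D.IsAdmissible len) {B : Set D.Cell} {p : List Mon}
    (hB : D.SurvivorsAt B p) {c : D.Cell} {u w : Mon} {s : List Mon}
    (hc : c.1 = p.reverse ++ u :: w :: s) :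
    (∃ l, (c, l) ∈ D.matchAt B p.length) ↔
      u * w ∈ D.G ∧ IsLeadingDivisor D.lt (D.Survives p) (u * w) u := by
  constructor
  · rintro ⟨l, h⟩
    obtain ⟨p', u', w', s', hlen, h1, h2, -⟩ := exists_of_mem_matchAt h
    obtain ⟨rfl, hs⟩ := reverse_append_inj (hc.symm.trans h1) hlen.symm
    obtain ⟨rfl, rfl, rfl⟩ := by simpa using hs
    exact ⟨l.2 _ (by simp [h2]), (H.mem_matchAt_iff hB hc h2).1 h⟩
  · rintro ⟨huw, hlead⟩
    have hcell : ∀ x ∈ p.reverse ++ ([u * w] ++ s), x ∈ D.G :=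
      forall_mem_of_replace (l := [u, w]) (hc ▸ c.2) (by simpa using huw)
    exact ⟨⟨_, hcell⟩, (H.mem_matchAt_iff hB hc rfl).2 hlead⟩

theorem exists_mem_matchAt_target_iff (H : D.IsAdmissible len) {B : Set D.Cell} {p : List Mon}
    (hB : D.SurvivorsAt B p) {c : D.Cell} {u : Mon} {s : List Mon} (hc : c.1 = p.reverse ++ u :: s)
    (hu : D.Survives p u) :
    (∃ c', (c', c) ∈ D.matchAt B p.length) ↔ ¬ DvdMinimal (D.Survives p) u := by
  constructor
  · rintro ⟨c', h⟩ hmin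
    obtain ⟨p', u', v', s', hlen, h1, h2, -⟩ := exists_of_mem_matchAt h
    obtain ⟨rfl, hs⟩ := reverse_append_inj (hc.symm.trans h2) hlen.symm
    obtain ⟨rfl, rfl⟩ := by simpa using hs
    have hv' : v' ∈ D.G := c'.2 _ (by simp [h1])
    exact hmin.2 u' (dvd_mul_right _ _) (H.order.ne_mul _ (H.ne_one hv'))
      ((H.mem_matchAt_iff hB h1 hc).1 h).1.1
  · intro hmin
    obtain ⟨u₀, hlead⟩ := exists_isLeadingDivisor H.order hu
    obtain ⟨v₀, rfl⟩ := hlead.2.1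
    have hv₀ : v₀ ∈ D.G :=
      H.right_mem _ _ hu.mem_G fun h1 => hmin (by simpa [h1] using hlead.1)
    have hcell : ∀ x ∈ p.reverse ++ ([u₀, v₀] ++ s), x ∈ D.G :=
      forall_mem_of_replace (l := [u₀ * v₀]) (hc ▸ c.2) (by simp [hlead.1.1.mem_G, hv₀])
    exact ⟨⟨_, hcell⟩, (H.mem_matchAt_iff hB rfl hc).2 hlead⟩

theorem survivorsAt_critAfter (H : D.IsAdmissible len) (p : List Mon) :
    D.SurvivorsAt (D.critAfter p.length) p := by
  induction p with
  | nil =>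
    intro w s c hc
    have : w ∈ D.G := c.2 w (by simp [hc])
    simp [critAfter, Survives, this]
  | cons u p ih =>
    intro w s c hc
    replace hc : c.1 = p.reverse ++ u :: w :: s := by simpa using hc
    have hw : w ∈ D.G := c.2 w (by simp [hc])
    change (c ∈ D.critAfter p.length ∧
      AlgMorse.Critical (D.matchAt (D.critAfter p.length) p.length) c) ↔ _
    rw [ih _ _ c hc, AlgMorse.critical_iff, ← not_exists, ← not_exists,
      H.exists_mem_matchAt_source_iff ih hc]
    constructor
    · rintro ⟨hu, hsource, htarget⟩
      rw [H.exists_mem_matchAt_target_iff ih hc hu, not_not] at htarget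
      exact ⟨hw, htarget, hsource⟩
    · rintro ⟨-, hmin, hlead⟩
      rw [H.exists_mem_matchAt_target_iff ih hc hmin.1, not_not]
      exact ⟨hmin.1, hlead, hmin⟩

theorem mem_matching_iff (H : D.IsAdmissible len) {c c' : D.Cell} :
    (c, c') ∈ D.matching ↔ ∃ p u v s, c.1 = p.reverse ++ u :: v :: s ∧
      c'.1 = p.reverse ++ (u * v) :: s ∧ IsLeadingDivisor D.lt (D.Survives p) (u * v) u := by
  simp only [matching, Set.mem_iUnion]
  constructor
  · rintro ⟨_, h⟩
    obtain ⟨p, u, v, s, rfl, hc, hc', -⟩ := exists_of_mem_matchAt h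
    exact ⟨p, u, v, s, hc, hc', (H.mem_matchAt_iff (H.survivorsAt_critAfter p) hc hc').1 h⟩
  · rintro ⟨p, u, v, s, hc, hc', hlead⟩
    exact ⟨p.length, (H.mem_matchAt_iff (H.survivorsAt_critAfter p) hc hc').2 hlead⟩

end IsAdmissible

end StdMonomials

namespace StdMonomials

variable {k A Mon : Type*} [Field k] [Ring A] [Algebra k A] [Monoid Mon]
  {D : StdMonomials k A Mon} {len : Mon → ℕ}

theorem isRepr_iff {a : A} {r : Mon →₀ k} : D.IsRepr a r ↔
    r ∈ supported k k {v | v ∈ D.G ∨ v = 1} ∧ Finsupp.linearCombination k D.val r = a :=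
  and_congr_left' (by rw [Finsupp.mem_supported]; rfl)

namespace IsAdmissible

theorem exists_isRepr (H : D.IsAdmissible len) (a : A) : ∃ r, D.IsRepr a r := by
  have hspan : Submodule.span k (Set.range D.val) ≤
      (supported k k {v | v ∈ D.G ∨ v = 1}).map (Finsupp.linearCombination k D.val) := by
    rw [Submodule.span_le]
    rintro _ ⟨w, rfl⟩
    obtain ⟨r, hr, -⟩ := H.exists_repr w
    exact ⟨r, isRepr_iff.1 hr⟩
  obtain ⟨r, hr⟩ := hspan (H.span a)
  exact ⟨r, isRepr_iff.2 hr⟩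

theorem isRepr_repr (H : D.IsAdmissible len) (a : A) : D.IsRepr a (D.repr a) := by
  rw [repr, dif_pos (H.exists_isRepr a)]
  exact (H.exists_isRepr a).choose_spec

theorem repr_mem (H : D.IsAdmissible len) (a : A) :
    D.repr a ∈ supported k k {v | v ∈ D.G ∨ v = 1} :=
  (isRepr_iff.1 (H.isRepr_repr a)).1

theorem linearCombination_repr (H : D.IsAdmissible len) (a : A) :
    Finsupp.linearCombination k D.val (D.repr a) = a :=
  (isRepr_iff.1 (H.isRepr_repr a)).2

theorem repr_eq (H : D.IsAdmissible len) {a : A} {r : Mon →₀ k} (h : D.IsRepr a r) :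
    D.repr a = r := by
  rw [isRepr_iff] at h
  refine sub_eq_zero.1 (H.indep _ (fun v hv => sub_mem (H.repr_mem a) h.1 hv) ?_)
  change Finsupp.linearCombination k D.val _ = 0
  rw [map_sub, h.2, H.linearCombination_repr, sub_self]

/-- `D.repr` as a linear map. -/
def reprLinear (H : D.IsAdmissible len) : A →ₗ[k] (Mon →₀ k) where
  toFun := D.repr
  map_add' a b := H.repr_eq (isRepr_iff.2 ⟨add_mem (H.repr_mem a) (H.repr_mem b), by
    rw [map_add, H.linearCombination_repr, H.linearCombination_repr]⟩)
  map_smul' t a := H.repr_eq (isRepr_iff.2 ⟨Submodule.smul_mem _ t (H.repr_mem a), by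
    rw [map_smul, H.linearCombination_repr, RingHom.id_apply]⟩)

theorem repr_val (H : D.IsAdmissible len) {w : Mon} (hw : w ∈ D.G ∨ w = 1) :
    D.repr (D.val w) = single w 1 :=
  H.repr_eq (isRepr_iff.2 ⟨Finsupp.single_mem_supported _ _ hw, by simp⟩)

theorem eq_or_lt_of_repr_ne_zero (H : D.IsAdmissible len) {v w : Mon}
    (h : D.repr (D.val w) v ≠ 0) : v = w ∨ D.lt v w := by
  obtain ⟨r, hr, hlt⟩ := H.exists_repr w
  rw [H.repr_eq hr] at h
  exact hlt v (Finsupp.mem_support_iff.2 h)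

theorem nontrivial (H : D.IsAdmissible len) : Nontrivial A := by
  refine nontrivial_of_ne 1 0 fun h => one_ne_zero (α := k) ?_
  have hzero := H.repr_eq (isRepr_iff.2 ⟨zero_mem _, (map_zero _).trans h.symm⟩)
  have hone := H.repr_val (.inr rfl)
  rw [map_one, hzero] at hone
  simpa using (DFunLike.congr_fun hone 1).symm

theorem env_nontrivial (H : D.IsAdmissible len) : Nontrivial (Env k A) := by
  have := H.nontrivial
  infer_instance

end IsAdmissible

theorem exists_of_contraction_ne_zero {p : List Mon} {w : Mon} {s l : List Mon}
    (h : D.contraction p w s l ≠ 0) : ∃ v, D.repr (D.val w) v ≠ 0 ∧ l = p ++ v :: s := by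
  classical
  rw [contraction, Finsupp.sum_apply] at h
  obtain ⟨v, hv, hne⟩ := Finset.exists_ne_zero_of_sum_ne_zero h
  refine ⟨v, Finsupp.mem_support_iff.1 hv, ?_⟩
  dsimp only at hne
  rw [Finsupp.single_apply] at hne
  simpa [eq_comm] using (ite_ne_right_iff.1 hne).1

theorem take_append_cons_cons_drop (l : List Mon) (j : ℕ) (h : j + 1 < l.length) :
    l = l.take j ++ l.getD j 1 :: l.getD (j + 1) 1 :: l.drop (j + 2) := by
  conv_lhs => rw [← List.take_append_drop j l, List.drop_eq_getElem_cons (by omega),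
    List.drop_eq_getElem_cons h]
  rw [List.getD_eq_getElem _ _ (by omega), List.getD_eq_getElem _ _ h]

theorem bdCoeff_eq {c : D.Cell} {w : Mon} {t : List Mon} (hc : c.1 = w :: t) (c' : D.Cell) :
    D.bdCoeff c c' = single t (D.val w ⊗ₜ[k] 1) c'.1 +
      ∑ j ∈ Finset.range t.length, (-1 : Env k A) ^ (j + 1) •
        D.contraction (c.1.take j) (c.1.getD j 1 * c.1.getD (j + 1) 1) (c.1.drop (j + 2)) c'.1 +
      single c.1.dropLast ((-1 : Env k A) ^ (t.length + 1) *
        (1 ⊗ₜ[k] MulOpposite.op (D.val (c.1.getLastD 1)))) c'.1 := by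
  rw [bdCoeff, hc, boundary, Finsupp.add_apply, Finsupp.add_apply, Finsupp.finsetSum_apply]
  rfl

theorem exists_of_bdCoeff_notMem (I : Ideal (Env k A)) {c c' : D.Cell} (h : D.bdCoeff c c' ∉ I) :
    (∃ w, c.1 = w :: c'.1 ∧ (D.val w ⊗ₜ[k] 1 : Env k A) ∉ I) ∨
    (∃ w, c.1 = c'.1 ++ [w] ∧ (1 ⊗ₜ[k] MulOpposite.op (D.val w) : Env k A) ∉ I) ∨
    ∃ p a b s v, c.1 = p ++ a :: b :: s ∧ c'.1 = p ++ v :: s ∧ D.repr (D.val (a * b)) v ≠ 0 := by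
  classical
  by_contra! hcon
  obtain ⟨hleft, hright, hinner⟩ := hcon
  refine h ?_
  rcases hc : c.1 with _ | ⟨w, t⟩
  · simp [bdCoeff, hc, boundary]
  rw [bdCoeff_eq hc]
  refine I.add_mem (I.add_mem ?_ (I.sum_mem fun j hj => I.smul_mem _ ?_)) ?_
  · rw [Finsupp.single_apply]
    split_ifs with ht
    · exact hleft w (by rw [hc, ht])
    · exact I.zero_mem
  · by_contra hne
    obtain ⟨v, hv, hv'⟩ := exists_of_contraction_ne_zero fun h0 => hne (h0 ▸ I.zero_mem)
    have hsplit := take_append_cons_cons_drop c.1 j (by simpa [hc] using hj)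
    exact hv (hinner _ _ _ _ v hsplit hv')
  · rw [Finsupp.single_apply]
    split_ifs with ht
    · refine I.mul_mem_left _ (hright _ ?_)
      rw [← ht, hc, List.getLastD_cons, ← List.getLast_eq_getLastD,
        List.dropLast_append_getLast (List.cons_ne_nil w t)]
      exact List.cons_ne_nil w t
    · exact I.zero_mem

theorem exists_of_bdCoeff_ne_zero {c c' : D.Cell} (h : D.bdCoeff c c' ≠ 0) :
    (∃ w, c.1 = w :: c'.1) ∨ (∃ w, c.1 = c'.1 ++ [w]) ∨
    ∃ p a b s v, c.1 = p ++ a :: b :: s ∧ c'.1 = p ++ v :: s ∧ D.repr (D.val (a * b)) v ≠ 0 := by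
  rcases exists_of_bdCoeff_notMem ⊥ (c := c) (c' := c') (by simpa using h) with
    ⟨w, hw, -⟩ | ⟨w, hw, -⟩ | hinner
  exacts [.inl ⟨w, hw⟩, .inr (.inl ⟨w, hw⟩), .inr (.inr hinner)]

theorem deg_of_bdCoeff_ne_zero {c c' : D.Cell} (h : D.bdCoeff c c' ≠ 0) :
    D.deg c = D.deg c' + 1 := by
  unfold deg
  rcases exists_of_bdCoeff_ne_zero h with ⟨w, h⟩ | ⟨w, h⟩ | ⟨p, a, b, s, v, h, h', -⟩
  · simp [h]
  · simp [h]
  · simp only [h, h', List.length_append, List.length_cons]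
    omega

theorem getElem?_merge_of_lt {α : Type*} {p s : List α} {a b v : α} {i : ℕ} (h : i < p.length) :
    (p ++ v :: s)[i]? = (p ++ a :: b :: s)[i]? := by
  rw [List.getElem?_append_left h, List.getElem?_append_left h]

theorem getElem?_merge_of_gt {α : Type*} {p s : List α} {a b v : α} {i : ℕ} (h : p.length < i) :
    (p ++ v :: s)[i]? = (p ++ a :: b :: s)[i + 1]? := by
  obtain ⟨j, rfl⟩ := Nat.exists_eq_add_of_lt h
  rw [List.getElem?_append_right (by omega), List.getElem?_append_right (by omega),
    show p.length + j + 1 - p.length = j + 1 by omega,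
    show p.length + j + 1 + 1 - p.length = j + 2 by omega]
  simp

theorem length_eq_of_merge_eq_merge {α : Type*} {p q s t l l' : List α} {u v x a b y : α}
    (hl : l = p ++ u :: v :: s) (hl' : l' = p ++ x :: s) (hu : u ≠ x) (hv : v ≠ x)
    (hm : l = q ++ a :: b :: t) (hm' : l' = q ++ y :: t) : q.length = p.length := by
  have hx : l'[p.length]? = some x := by simp [hl']
  rcases lt_trichotomy q.length p.length with h | h | h
  · rw [hm', getElem?_merge_of_gt h (a := a) (b := b), ← hm, hl] at hx
    exact absurd (by simpa using hx) hv
  · exact h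
  · rw [hm', getElem?_merge_of_lt h (a := a) (b := b), ← hm, hl] at hx
    exact absurd (by simpa using hx) hu

theorem IsAdmissible.bdCoeff_of_mul (H : D.IsAdmissible len) {c c' : D.Cell} {p s : List Mon}
    {u v : Mon} (hc : c.1 = p ++ u :: v :: s) (hc' : c'.1 = p ++ (u * v) :: s) :
    D.bdCoeff c c' = (-1) ^ (p.length + 1) := by
  have huv : u * v ∈ D.G := c'.2 _ (by simp [hc'])
  have hu : u ≠ u * v := H.order.ne_mul _ (H.ne_one (c.2 v (by simp [hc])))
  have hv : v ≠ u * v := H.order.ne_mul_left (H.ne_one (c.2 u (by simp [hc]))) _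
  obtain ⟨w, t, hwt⟩ : ∃ w t, c.1 = w :: t := by cases p <;> simp [hc]
  have hlen : t.length + 1 = p.length + s.length + 2 := by
    rw [← List.length_cons (a := w), ← hwt, hc]
    simp only [List.length_append, List.length_cons]
    omega
  have hleft : t ≠ c'.1 := by
    rintro rfl
    rw [hc'] at hwt
    have := congrArg (·[p.length + 1]?) (hc.symm.trans hwt)
    exact hv (by simpa using this)
  have hright : c.1.dropLast ≠ c'.1 := by
    intro h
    have := congrArg (·[p.length]?) h
    exact hu (by simpa [hc, hc'] using this)
  have hinner : ∀ j ∈ Finset.range t.length, j ≠ p.length → (-1 : Env k A) ^ (j + 1) •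
      D.contraction (c.1.take j) (c.1.getD j 1 * c.1.getD (j + 1) 1) (c.1.drop (j + 2)) c'.1
        = 0 := by
    intro j hj hne
    have hj' : j + 1 < c.1.length := by simpa [hwt] using hj
    by_contra h0
    obtain ⟨x, -, hx⟩ := exists_of_contraction_ne_zero (right_ne_zero_of_smul h0)
    have hlen := length_eq_of_merge_eq_merge hc hc' hu hv
      (take_append_cons_cons_drop c.1 j hj') hx
    exact hne (by rw [← hlen, List.length_take]; omega)
  rw [bdCoeff_eq hwt, Finsupp.single_eq_of_ne' hleft, Finsupp.single_eq_of_ne' hright,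
    Finset.sum_eq_single_of_mem p.length (by rw [Finset.mem_range]; omega) hinner]
  have hsplit : D.contraction (c.1.take p.length) (c.1.getD p.length 1 * c.1.getD (p.length + 1) 1)
      (c.1.drop (p.length + 2)) = D.contraction p (u * v) s := by
    simp [hc, List.drop_append, List.drop_eq_nil_of_le]
  rw [hsplit, contraction, H.repr_val (.inl huv), Finsupp.sum_single_index (by simp)]
  simp [hc', ← Algebra.TensorProduct.one_def]

end StdMonomials

/-! ### Acyclicity -/

namespace StdMonomials

variable {k A Mon : Type*} [Field k] [Ring A] [Algebra k A] [Monoid Mon]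
  {D : StdMonomials k A Mon} {len : Mon → ℕ}

open Classical in
/-- The monomial `u` such that the matching splits the entry `w` after the reversed list `p` as
`u * v`, or `1` if there is none. -/
def leadingDivisor (D : StdMonomials k A Mon) (p : List Mon) (w : Mon) : Mon :=
  if h : ∃ u, IsLeadingDivisor D.lt (D.Survives p) w u then h.choose else 1

open Classical in
/-- A list of monomials that weakly increases along the edges that preserve the product of the
entries. It is `[…,u,1]` for the upper end of the matching edge `[…|u|v|…] ⟶ […|uv|…]`, and `[…,u]`
for the lower one. -/
def key (D : StdMonomials k A Mon) : List Mon → List Mon → List Mon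
  | _, [] => [1]
  | p, w :: s => if DvdMinimal (D.Survives p) w then w :: key D (w :: p) s else
      if D.Survives p w then [D.leadingDivisor p w] else [1]

/-- The relation that decreases along the edges of the graph of the matching: first compare the
products of the entries, then the keys (in the opposite order), then the number of entries. -/
def Below (D : StdMonomials k A Mon) : D.Cell → D.Cell → Prop :=
  InvImage (Prod.Lex D.lt (Prod.Lex (Function.swap (List.Lex D.lt)) (· < ·)))
    fun c => (c.1.prod, D.key [] c.1, c.1.length)

theorem key_of_dvdMinimal {p : List Mon} {w : Mon} {s : List Mon}
    (h : DvdMinimal (D.Survives p) w) : D.key p (w :: s) = w :: D.key (w :: p) s := by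
  rw [key, if_pos h]

theorem key_of_survives {p : List Mon} {w : Mon} {s : List Mon}
    (hmin : ¬ DvdMinimal (D.Survives p) w) (hw : D.Survives p w) :
    D.key p (w :: s) = [D.leadingDivisor p w] := by
  rw [key, if_neg hmin, if_pos hw]

theorem key_of_not_survives {p : List Mon} {w : Mon} {s : List Mon} (hw : ¬ D.Survives p w) :
    D.key p (w :: s) = [1] := by
  rw [key, if_neg fun h => hw h.1, if_neg hw]

theorem key_append {p : List Mon} {w : Mon} (hw : D.Survives p w) (s : List Mon) :
    D.key [] (p.reverse ++ s) = p.reverse ++ D.key p s := by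
  induction p generalizing w s with
  | nil => simp
  | cons u p ih =>
    rw [List.reverse_cons, List.append_assoc, List.append_assoc, List.singleton_append,
      ih hw.2.1.1, key_of_dvdMinimal hw.2.1]
    rfl

theorem key_source {p : List Mon} {u v : Mon} {s : List Mon} (huv : u * v ∈ D.G)
    (h : IsLeadingDivisor D.lt (D.Survives p) (u * v) u) :
    D.key [] (p.reverse ++ u :: v :: s) = p.reverse ++ [u, 1] := by
  rw [key_append h.1.1, key_of_dvdMinimal h.1, key_of_not_survives]
  exact fun hv => hv.2.2 ⟨huv, h⟩

namespace IsAdmissible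

theorem leadingDivisor_eq (H : D.IsAdmissible len) {p : List Mon} {w u : Mon}
    (h : IsLeadingDivisor D.lt (D.Survives p) w u) : D.leadingDivisor p w = u := by
  have hex : ∃ u, IsLeadingDivisor D.lt (D.Survives p) w u := ⟨u, h⟩
  rw [leadingDivisor, dif_pos hex]
  exact hex.choose_spec.unique H.order h

theorem isLeadingDivisor_leadingDivisor (H : D.IsAdmissible len) {p : List Mon} {w : Mon}
    (h : D.Survives p w) : IsLeadingDivisor D.lt (D.Survives p) w (D.leadingDivisor p w) := by
  obtain ⟨u, hu⟩ := exists_isLeadingDivisor H.order h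
  rwa [H.leadingDivisor_eq hu]

theorem key_target (H : D.IsAdmissible len) {p : List Mon} {u v : Mon} {s : List Mon}
    (hv : v ∈ D.G) (huv : u * v ∈ D.G) (h : IsLeadingDivisor D.lt (D.Survives p) (u * v) u) :
    D.key [] (p.reverse ++ (u * v) :: s) = p.reverse ++ [u] := by
  rw [key_append h.1.1, key_of_survives _ (H.survives_of_dvd h.1.1 (dvd_mul_right _ _) huv),
    H.leadingDivisor_eq h]
  exact fun hmin => hmin.2 u (dvd_mul_right _ _) (H.order.ne_mul u (H.ne_one hv)) h.1.1

theorem exists_key_of_mem_matching (H : D.IsAdmissible len) {c c' : D.Cell}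
    (h : (c, c') ∈ D.matching) : ∃ (p : List Mon) (u v : Mon) (s : List Mon), u ∈ D.G ∧
      c.1 = p.reverse ++ u :: v :: s ∧ D.key [] c.1 = p.reverse ++ [u, 1] ∧
      c'.1 = p.reverse ++ (u * v) :: s ∧ D.key [] c'.1 = p.reverse ++ [u] := by
  obtain ⟨p, u, v, s, hc, hc', hlead⟩ := H.mem_matching_iff.1 h
  have huv : u * v ∈ D.G := c'.2 _ (by simp [hc'])
  have hv : v ∈ D.G := c.2 _ (by simp [hc])
  refine ⟨p, u, v, s, hlead.1.1.mem_G, hc, ?_, hc', ?_⟩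
  · rw [hc, key_source huv hlead]
  · rw [hc', H.key_target hv huv hlead]

theorem eq_of_mem_matching_source (H : D.IsAdmissible len) {c l l' : D.Cell}
    (h : (c, l) ∈ D.matching) (h' : (c, l') ∈ D.matching) : l = l' := by
  obtain ⟨p, u, v, s, -, hc, hkey, hl, -⟩ := H.exists_key_of_mem_matching h
  obtain ⟨p', u', v', s', -, hc', hkey', hl', -⟩ := H.exists_key_of_mem_matching h'
  have hp := hkey.symm.trans hkey'
  obtain ⟨rfl, -⟩ := reverse_append_inj hp (by simpa using congrArg List.length hp)
  obtain ⟨rfl, rfl, rfl⟩ := by simpa using hc.symm.trans hc'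
  exact Subtype.ext (hl.trans hl'.symm)

theorem eq_of_mem_matching_target (H : D.IsAdmissible len) {c c' l : D.Cell}
    (h : (c, l) ∈ D.matching) (h' : (c', l) ∈ D.matching) : c = c' := by
  obtain ⟨p, u, v, s, -, hc, -, hl, hkey⟩ := H.exists_key_of_mem_matching h
  obtain ⟨p', u', v', s', -, hc', -, hl', hkey'⟩ := H.exists_key_of_mem_matching h'
  have hp := hkey.symm.trans hkey'
  obtain ⟨rfl, hu⟩ := reverse_append_inj hp (by simpa using congrArg List.length hp)
  obtain rfl : u = u' := by simpa using hu
  obtain ⟨huv, rfl⟩ : u * v = u * v' ∧ s = s' := by simpa using hl.symm.trans hl'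
  obtain rfl := H.order.cancel _ _ _ huv
  exact Subtype.ext (hc.trans hc'.symm)

theorem source_ne_target (H : D.IsAdmissible len) {c l c' l' : D.Cell}
    (h : (c, l) ∈ D.matching) (h' : (c', l') ∈ D.matching) : c ≠ l' := by
  rintro rfl
  obtain ⟨p, u, _, _, -, -, hkey, -⟩ := H.exists_key_of_mem_matching h
  obtain ⟨p', u', _, _, hu', -, -, -, hkey'⟩ := H.exists_key_of_mem_matching h'
  have hlast := congrArg List.getLast? (hkey.symm.trans hkey')
  exact H.ne_one hu' (by simpa [eq_comm] using hlast)

theorem matching_unique (H : D.IsAdmissible len) : ∀ e ∈ D.matching, ∀ e' ∈ D.matching,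
    (e.1 = e'.1 ∨ e.1 = e'.2 ∨ e.2 = e'.1 ∨ e.2 = e'.2) → e = e' := by
  rintro ⟨c, l⟩ he ⟨c', l'⟩ he' (rfl | h | h | rfl)
  · rw [H.eq_of_mem_matching_source he he']
  · exact absurd h (H.source_ne_target he he')
  · exact absurd h.symm (H.source_ne_target he' he)
  · rw [H.eq_of_mem_matching_target he he']

theorem key_cons_cons_le (H : D.IsAdmissible len) {p : List Mon} {a b : Mon} {s : List Mon}
    (hab : a * b ∈ D.G) (hb : b ≠ 1) (ha : D.Survives p a)
    (hlead : ¬ IsLeadingDivisor D.lt (D.Survives p) (a * b) a) :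
    Relation.ReflGen (List.Lex D.lt) (D.key p (a :: b :: s)) (D.key p ((a * b) :: s)) := by
  have hsurv := H.survives_of_dvd ha (dvd_mul_right a b) hab
  have hab_lead := H.isLeadingDivisor_leadingDivisor hsurv
  rw [key_of_survives (fun h => h.2 a (dvd_mul_right _ _) (H.order.ne_mul a hb) ha) hsurv]
  have := H.order.toIsStrictTotalOrder
  by_cases hmin : DvdMinimal (D.Survives p) a
  · rw [key_of_dvdMinimal hmin]
    rcases trichotomous_of D.lt a (D.leadingDivisor p (a * b)) with h | h | h
    · exact .single (.rel h)
    · exact absurd (by rwa [← h] at hab_lead) hlead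
    · exact absurd h (hab_lead.2.2 a hmin (dvd_mul_right _ _))
  · rw [key_of_survives hmin ha]
    have ha_lead := H.isLeadingDivisor_leadingDivisor ha
    rcases trichotomous_of D.lt (D.leadingDivisor p a) (D.leadingDivisor p (a * b)) with h | h | h
    · exact .single (.rel h)
    · rw [h]
    · exact absurd h (hab_lead.2.2 _ ha_lead.1 (ha_lead.2.1.mul_right b))

theorem singleton_one_le_key (H : D.IsAdmissible len) {p : List Mon} {w : Mon} {s : List Mon}
    (hw : w ∈ D.G) : Relation.ReflGen (List.Lex D.lt) [1] (D.key p (w :: s)) := by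
  by_cases hmin : DvdMinimal (D.Survives p) w
  · rw [key_of_dvdMinimal hmin]
    exact .single (.rel (H.order.one_lt (H.ne_one hw)))
  · by_cases hsurv : D.Survives p w
    · rw [key_of_survives hmin hsurv]
      have hlead := H.isLeadingDivisor_leadingDivisor hsurv
      exact .single (.rel (H.order.one_lt (H.ne_one hlead.1.1.mem_G)))
    · rw [key_of_not_survives hsurv]

theorem key_merge_le (H : D.IsAdmissible len) {a b : Mon} {s : List Mon} (hab : a * b ∈ D.G)
    (hb : b ≠ 1) (q p : List Mon)
    (hlead : ¬ IsLeadingDivisor D.lt (D.Survives (q.reverse ++ p)) (a * b) a) :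
    Relation.ReflGen (List.Lex D.lt) (D.key p (q ++ a :: b :: s))
      (D.key p (q ++ (a * b) :: s)) := by
  induction q generalizing p with
  | nil =>
    by_cases ha : D.Survives p a
    · exact H.key_cons_cons_le hab hb ha hlead
    · rw [List.nil_append, key_of_not_survives ha]
      exact H.singleton_one_le_key hab
  | cons x q ih =>
    simp only [List.cons_append]
    by_cases hmin : DvdMinimal (D.Survives p) x
    · rw [key_of_dvdMinimal hmin, key_of_dvdMinimal hmin]
      have htail := ih (x :: p) (by simpa using hlead)
      rw [Relation.reflGen_iff] at htail ⊢
      exact htail.imp (congrArg _) .cons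
    · by_cases hsurv : D.Survives p x
      · rw [key_of_survives hmin hsurv, key_of_survives hmin hsurv]
      · rw [key_of_not_survives hsurv, key_of_not_survives hsurv]

end IsAdmissible

theorem below_iff {c' c : D.Cell} : D.Below c' c ↔ D.lt c'.1.prod c.1.prod ∨
    c'.1.prod = c.1.prod ∧ (List.Lex D.lt (D.key [] c.1) (D.key [] c'.1) ∨
      D.key [] c'.1 = D.key [] c.1 ∧ c'.1.length < c.1.length) := by
  simp only [Below, InvImage, Prod.lex_def, Function.swap]

namespace IsAdmissible

theorem isStrictOrder_below (H : D.IsAdmissible len) : IsStrictOrder D.Cell D.Below := by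
  have := H.order.toIsStrictTotalOrder
  have hirrefl : Std.Irrefl (Function.swap (List.Lex D.lt)) :=
    ⟨List.lex_irrefl (irrefl_of D.lt)⟩
  have htrans : IsTrans _ (Function.swap (List.Lex D.lt)) :=
    ⟨fun _ _ _ h h' => List.lex_trans (trans_of D.lt) h' h⟩
  unfold Below
  exact {
    irrefl c := irrefl_of (Prod.Lex D.lt (Prod.Lex (Function.swap (List.Lex D.lt)) (· < ·))) _
    trans _ _ _ h h' :=
      trans_of (Prod.Lex D.lt (Prod.Lex (Function.swap (List.Lex D.lt)) (· < ·))) h h' }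

theorem length_le_len_prod (H : D.IsAdmissible len) {l : List Mon} (hl : ∀ w ∈ l, w ∈ D.G) :
    l.length ≤ len l.prod := by
  induction l with
  | nil => simp
  | cons a l ih =>
    rw [List.forall_mem_cons] at hl
    have := ih hl.2
    have := H.order.len_pos (H.ne_one hl.1)
    rw [List.prod_cons, H.order.len_mul, List.length_cons]
    omega

theorem finite_setOf_len_prod_le (H : D.IsAdmissible len) (N : ℕ) :
    {c : D.Cell | len c.1.prod ≤ N}.Finite := by
  have := (H.order.finite N).to_subtype
  have hfin : ((·.map Subtype.val) '' {l : List {w | len w ≤ N} | l.length ≤ N}).Finite :=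
    (List.finite_length_le _ N).image _
  refine Set.Finite.of_finite_image (f := Subtype.val) (hfin.subset ?_)
    Subtype.val_injective.injOn
  rintro _ ⟨c, hc, rfl⟩
  refine ⟨c.1.pmap Subtype.mk fun w hw => (H.order.len_le_len_prod hw).trans hc, ?_, ?_⟩
  · simpa using (H.length_le_len_prod c.2).trans hc
  · simp [List.map_pmap]

theorem wellFounded_below (H : D.IsAdmissible len) : WellFounded D.Below := by
  have := H.isStrictOrder_below
  refine wellFounded_of_finite_setOf_rel fun b =>
    (H.finite_setOf_len_prod_le (len b.1.prod)).subset fun a hab => ?_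
  rcases below_iff.1 hab with h | ⟨h, -⟩
  · exact H.order.len_le h
  · exact (congrArg len h).le

theorem below_of_merge (H : D.IsAdmissible len) {c c' : D.Cell} {p s : List Mon} {a b : Mon}
    (hc : c.1 = p ++ a :: b :: s) (hc' : c'.1 = p ++ (a * b) :: s) (h : (c, c') ∉ D.matching) :
    D.Below c' c := by
  have hab : a * b ∈ D.G := c'.2 _ (by simp [hc'])
  have hb : b ∈ D.G := c.2 _ (by simp [hc])
  have hlead : ¬ IsLeadingDivisor D.lt (D.Survives (p.reverse ++ [])) (a * b) a := fun hlead =>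
    h (H.mem_matching_iff.2 ⟨p.reverse, a, b, s, by simpa using hc, by simpa using hc',
      by simpa using hlead⟩)
  have hkey := H.key_merge_le (s := s) hab (H.ne_one hb) p [] hlead
  rw [← hc, ← hc', Relation.reflGen_iff] at hkey
  refine below_iff.2 (.inr ⟨by simp [hc, hc', mul_assoc], ?_⟩)
  rcases hkey with hkey | hkey
  · exact .inr ⟨hkey, by simp [hc, hc']⟩
  · exact .inl hkey

theorem below_of_bdCoeff_ne_zero (H : D.IsAdmissible len) {c c' : D.Cell}
    (hne : D.bdCoeff c c' ≠ 0) (h : (c, c') ∉ D.matching) : D.Below c' c := by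
  rcases exists_of_bdCoeff_ne_zero hne with ⟨w, hw⟩ | ⟨w, hw⟩ | ⟨p, a, b, s, v, hc, hc', hv⟩
  · have := H.order.len_pos (H.ne_one (c.2 w (by simp [hw])))
    refine below_iff.2 (.inl (H.order.lt_of_len_lt _ _ ?_))
    rw [hw, List.prod_cons, H.order.len_mul]
    omega
  · have := H.order.len_pos (H.ne_one (c.2 w (by simp [hw])))
    refine below_iff.2 (.inl (H.order.lt_of_len_lt _ _ ?_))
    rw [hw, List.prod_append, H.order.len_mul, List.prod_singleton]
    omega
  · rcases H.eq_or_lt_of_repr_ne_zero hv with rfl | hlt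
    · exact H.below_of_merge hc hc' h
    · have := H.order.mul_lt _ _ p.prod s.prod hlt
      exact below_iff.2 (.inl (by simpa [hc, hc', mul_assoc] using this))

theorem below_of_mem_matching (H : D.IsAdmissible len) {c c' : D.Cell}
    (h : (c, c') ∈ D.matching) : D.Below c c' := by
  obtain ⟨p, u, v, s, -, hc, hkey, hc', hkey'⟩ := H.exists_key_of_mem_matching h
  refine below_iff.2 (.inr ⟨by simp [hc, hc', mul_assoc], .inl ?_⟩)
  rw [hkey, hkey']
  generalize p.reverse = q
  induction q with
  | nil => exact .cons .nil
  | cons x q ih => exact .cons ih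

theorem below_of_mEdge (H : D.IsAdmissible len) {c c' : D.Cell}
    (h : AlgMorse.MEdge D.deg D.bdCoeff D.matching c c') : D.Below c' c := by
  rcases h with ⟨hedge, hM⟩ | ⟨-, hM⟩
  exacts [H.below_of_bdCoeff_ne_zero hedge.2 hM, H.below_of_mem_matching hM]

theorem wellFounded_mEdge (H : D.IsAdmissible len) :
    WellFounded fun c' c => AlgMorse.MEdge D.deg D.bdCoeff D.matching c c' :=
  Subrelation.wf H.below_of_mEdge H.wellFounded_below

theorem exists_bdCoeff_eq_neg_one_pow (H : D.IsAdmissible len) {e : D.Cell × D.Cell}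
    (he : e ∈ D.matching) : ∃ n, D.bdCoeff e.1 e.2 = (-1) ^ n := by
  obtain ⟨p, u, v, s, hc, hc', -⟩ := H.mem_matching_iff.1 he
  exact ⟨_, H.bdCoeff_of_mul hc hc'⟩

theorem isUnit_bdCoeff (H : D.IsAdmissible len) {e : D.Cell × D.Cell} (he : e ∈ D.matching) :
    IsUnit (D.bdCoeff e.1 e.2) := by
  obtain ⟨n, hn⟩ := H.exists_bdCoeff_eq_neg_one_pow he
  rw [hn]
  exact (isUnit_one (M := Env k A)).neg.pow n

theorem isAcyclicMatching (H : D.IsAdmissible len) : D.IsAcyclicMatching where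
  edge e he := by
    have := H.env_nontrivial
    have hne := (H.isUnit_bdCoeff he).ne_zero
    exact ⟨deg_of_bdCoeff_ne_zero hne, hne⟩
  matching := H.matching_unique
  central e he := by
    obtain ⟨n, hn⟩ := H.exists_bdCoeff_eq_neg_one_pow he
    rw [hn]
    exact pow_mem (neg_mem (one_mem _)) n
  invertible e he := H.isUnit_bdCoeff he
  acyclic c hc := H.wellFounded_mEdge.transGen.irrefl.irrefl c
    (Relation.transGen_swap.1 hc)

end IsAdmissible

end StdMonomials

/-! ### The bar resolution and its contracting homotopy -/

namespace Env

variable {k A : Type*} [Field k] [Ring A] [Algebra k A]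

theorem isScalarTower : IsScalarTower k (Env k A) A where
  smul_assoc t e x := by
    induction e using TensorProduct.induction_on with
    | zero =>
      have h : (0 : Env k A) • x = 0 := zero_smul (Env k A) x
      rw [smul_zero, h, smul_zero]
    | add e e' h h' => rw [smul_add, add_smul, h, h', add_smul, smul_add]
    | tmul a b =>
      obtain ⟨b, rfl⟩ := MulOpposite.op_surjective b
      rw [TensorProduct.smul_tmul', tmul_smul, tmul_smul, smul_mul_assoc, smul_mul_assoc]

end Env

namespace StdMonomials

open AlgMorse

variable {k A Mon : Type*} [Field k] [Ring A] [Algebra k A] [Monoid Mon]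

section Bar

variable (D : StdMonomials k A Mon)

/-- The direct sum of all terms of the normalized Hochschild complex. -/
abbrev Bar : Type _ := D.Cell →₀ Env k A

/-- The projection that omits the tuples that are not cells. -/
def restrict : (List Mon →₀ Env k A) →ₗ[Env k A] D.Bar :=
  Finsupp.lsubtypeDomain {l : List Mon | ∀ w ∈ l, w ∈ D.G}

/-- The differential of the normalized Hochschild complex. -/
def barD : D.Bar →ₗ[Env k A] D.Bar :=
  Finsupp.linearCombination (Env k A) fun c => D.restrict (D.boundary c.1)

/-- The cell `[]`. -/
def nilCell : D.Cell := ⟨[], by simp⟩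

open Classical in
/-- The augmentation `[] ↦ 1` of the normalized Hochschild complex, extended by zero to the terms
of positive degree. -/
def barAug : D.Bar →ₗ[Env k A] A :=
  Finsupp.linearCombination (Env k A) fun c => if c.1 = [] then (1 : A) else 0

/-- The map `b ↦ (1 ⊗ b)[w₁|…|w_l]`, which is zero if `[w₁|…|w_l]` is not a cell. -/
def rightCell (l : List Mon) : Aᵐᵒᵖ →ₗ[k] D.Bar :=
  D.restrict.restrictScalars k ∘ₗ Finsupp.lsingle l ∘ₗ TensorProduct.mk k A Aᵐᵒᵖ 1

/-- The augmentation followed by its section `a ↦ (1 ⊗ a)[]`. -/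
def augSection : D.Bar →ₗ[k] D.Bar :=
  haveI : IsScalarTower k (Env k A) A := Env.isScalarTower
  D.rightCell [] ∘ₗ (MulOpposite.opLinearEquiv k).toLinearMap ∘ₗ D.barAug.restrictScalars k

/-- Multiplication by an element of the enveloping algebra, as a linear map over the field. -/
def envSMul (e : Env k A) : D.Bar →ₗ[k] D.Bar where
  toFun x := e • x
  map_add' := smul_add e
  map_smul' t x := smul_comm e t x

end Bar

variable {D : StdMonomials k A Mon} {len : Mon → ℕ}

theorem restrict_single (c : D.Cell) (e : Env k A) : D.restrict (single c.1 e) = single c e := by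
  classical
  ext c'
  change single c.1 e c'.1 = _
  rw [Finsupp.single_apply, Finsupp.single_apply]
  exact if_congr Subtype.ext_iff.symm rfl rfl

theorem restrict_single_of_not {l : List Mon} (h : ¬ ∀ w ∈ l, w ∈ D.G) (e : Env k A) :
    D.restrict (single l e) = 0 := by
  ext c
  change single l e c.1 = 0
  rw [Finsupp.single_eq_of_ne fun hl : c.1 = l => h (hl ▸ c.2)]

theorem restrict_single_mul (l : List Mon) (e e' : Env k A) :
    D.restrict (single l (e * e')) = e • D.restrict (single l e') := by
  rw [← map_smul, Finsupp.smul_single, smul_eq_mul]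

theorem single_mul (c : D.Cell) (e e' : Env k A) :
    (single c (e * e') : D.Bar) = e • single c e' := by
  rw [Finsupp.smul_single, smul_eq_mul]

theorem rightCell_apply (l : List Mon) (b : Aᵐᵒᵖ) :
    D.rightCell l b = D.restrict (single l (1 ⊗ₜ[k] b)) := rfl

theorem rightCell_eq_single (c : D.Cell) (b : Aᵐᵒᵖ) :
    D.rightCell c.1 b = single c (1 ⊗ₜ[k] b) := by
  rw [rightCell_apply, restrict_single]

theorem rightCell_mul (l : List Mon) (b b' : Aᵐᵒᵖ) :
    D.rightCell l (b * b') = (1 ⊗ₜ[k] b : Env k A) • D.rightCell l b' := by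
  rw [rightCell_apply, rightCell_apply, ← restrict_single_mul,
    Algebra.TensorProduct.tmul_mul_tmul, one_mul]

theorem rightCell_one_cons (h : 1 ∉ D.G) (l : List Mon) (b : Aᵐᵒᵖ) :
    D.rightCell (1 :: l) b = 0 := by
  rw [rightCell_apply, restrict_single_of_not fun hl => h (hl 1 List.mem_cons_self)]

theorem restrict_contraction (p : List Mon) (w : Mon) (s : List Mon) :
    D.restrict (D.contraction p w s) =
      (D.repr (D.val w)).sum fun v a => a • D.rightCell (p ++ [v] ++ s) 1 := by
  rw [contraction, Finsupp.sum, map_sum]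
  refine Finset.sum_congr rfl fun v _ => ?_
  dsimp only
  rw [← map_smul, rightCell_apply, TensorProduct.tmul_smul, ← Algebra.TensorProduct.one_def,
    ← Algebra.algebraMap_eq_smul_one]

theorem restrict_contraction_one_cons (h : 1 ∉ D.G) (p : List Mon) (w : Mon) (s : List Mon) :
    D.restrict (D.contraction (1 :: p) w s) = 0 := by
  simp only [restrict_contraction, List.cons_append, rightCell_one_cons h, smul_zero,
    Finsupp.sum_fun_zero]

theorem neg_one_pow_succ_smul (n : ℕ) (x : D.Bar) :
    (-1 : Env k A) ^ (n + 1) • x = -((-1 : Env k A) ^ n • x) := by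
  have h {R M : Type _} [Ring R] [AddCommGroup M] [Module R M] (y : M) :
      (-1 : R) ^ (n + 1) • y = -((-1 : R) ^ n • y) := by
    rw [pow_succ, mul_neg_one, neg_smul]
  exact h x

theorem restrict_boundary_nil : D.restrict (D.boundary []) = 0 := by
  rw [boundary, map_zero]

theorem rightCell_add_restrict_boundary_singleton (v : Mon) :
    D.rightCell [] (MulOpposite.op (D.val v)) + D.restrict (D.boundary [v]) =
      single D.nilCell (D.val v ⊗ₜ[k] 1) := by
  rw [boundary, map_add, map_add, restrict_single_mul, List.length_nil, neg_one_pow_succ_smul,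
    pow_zero, one_smul, Finset.sum_range_zero, map_zero, add_zero]
  change _ + (D.restrict (single D.nilCell.1 _) + -D.rightCell [] (MulOpposite.op (D.val v))) = _
  rw [restrict_single]
  abel

theorem barD_single (c : D.Cell) (e : Env k A) :
    D.barD (single c e) = e • D.restrict (D.boundary c.1) :=
  Finsupp.linearCombination_single _ _ _

theorem barD_single_one (c : D.Cell) : D.barD (single c 1) = D.restrict (D.boundary c.1) := by
  rw [barD, Finsupp.linearCombination_single, one_smul]

theorem barD_single_one_apply (c c' : D.Cell) : D.barD (single c 1) c' = D.bdCoeff c c' := by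
  rw [barD_single_one]
  rfl

theorem barD_rightCell (c : D.Cell) (b : Aᵐᵒᵖ) :
    D.barD (D.rightCell c.1 b) = (1 ⊗ₜ[k] b : Env k A) • D.restrict (D.boundary c.1) := by
  rw [rightCell_eq_single, barD_single]

theorem barD_rightCell_nil (b : Aᵐᵒᵖ) : D.barD (D.rightCell [] b) = 0 :=
  (barD_rightCell D.nilCell b).trans ((congrArg _ restrict_boundary_nil).trans (smul_zero _))

theorem barAug_single_nil (a b : A) :
    D.barAug (single D.nilCell (a ⊗ₜ[k] MulOpposite.op b)) = a * b := by
  rw [barAug, Finsupp.linearCombination_single, if_pos (show D.nilCell.1 = [] from rfl),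
    Env.tmul_smul, mul_one]

theorem barAug_single_of_ne_nil {c : D.Cell} (hc : c.1 ≠ []) (e : Env k A) :
    D.barAug (single c e) = 0 := by
  rw [barAug, Finsupp.linearCombination_single, if_neg hc, smul_zero]

theorem barAug_rightCell_nil (b : A) : D.barAug (D.rightCell [] (MulOpposite.op b)) = b :=
  (congrArg D.barAug (rightCell_eq_single D.nilCell _)).trans
    ((barAug_single_nil 1 b).trans (one_mul b))

theorem rightCell_mem_gr (l : List Mon) (b : Aᵐᵒᵖ) :
    D.rightCell l b ∈ gr (Env k A) D.deg l.length := by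
  by_cases h : ∀ w ∈ l, w ∈ D.G
  · obtain ⟨c, rfl⟩ : ∃ c : D.Cell, c.1 = l := ⟨⟨l, h⟩, rfl⟩
    rw [rightCell_eq_single]
    exact Finsupp.single_mem_supported _ _ rfl
  · rw [rightCell_apply, restrict_single_of_not h]
    exact zero_mem _

theorem barD_eq_zero_of_mem_gr_zero {x : D.Bar} (hx : x ∈ gr (Env k A) D.deg 0) :
    D.barD x = 0 := by
  refine map_eq_map_of_single_eq (f := D.barD) (g := 0) (fun c hc => ?_) hx
  rw [barD_single_one, List.length_eq_zero_iff.1 (show c.1.length = 0 from hc),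
    restrict_boundary_nil, LinearMap.zero_apply]

theorem barAug_eq_zero_of_mem_gr {i : ℕ} {x : D.Bar} (hx : x ∈ gr (Env k A) D.deg (i + 1)) :
    D.barAug x = 0 :=
  map_eq_map_of_single_eq (g := 0)
    (fun _ hc => barAug_single_of_ne_nil (List.ne_nil_of_length_eq_add_one hc) 1) hx

theorem envSMul_apply (e : Env k A) (x : D.Bar) : D.envSMul e x = e • x := rfl

theorem augSection_apply (x : D.Bar) :
    D.augSection x = D.rightCell [] (MulOpposite.op (D.barAug x)) := rfl

theorem augSection_smul (b : Aᵐᵒᵖ) (x : D.Bar) :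
    D.augSection ((1 ⊗ₜ[k] b : Env k A) • x) = (1 ⊗ₜ[k] b : Env k A) • D.augSection x := by
  obtain ⟨b, rfl⟩ := MulOpposite.op_surjective b
  rw [augSection_apply, augSection_apply, map_smul, Env.tmul_smul, one_mul, MulOpposite.op_mul,
    rightCell_mul]

theorem augSection_eq_zero {x : D.Bar} (h : D.barAug x = 0) : D.augSection x = 0 := by
  rw [augSection_apply, h, MulOpposite.op_zero, map_zero]

theorem augSection_single_of_ne_nil {c : D.Cell} (hc : c.1 ≠ []) (e : Env k A) :
    D.augSection (single c e) = 0 :=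
  augSection_eq_zero (barAug_single_of_ne_nil hc e)

theorem barAug_barD (x : D.Bar) : D.barAug (D.barD x) = 0 := by
  suffices D.barAug ∘ₗ D.barD = 0 from LinearMap.congr_fun this x
  refine linearMap_ext_single_one fun c => ?_
  rw [LinearMap.comp_apply, LinearMap.zero_apply, barD_single_one]
  rcases hc : c.1 with _ | ⟨w, _ | ⟨w', t⟩⟩
  · rw [restrict_boundary_nil, map_zero]
  · have h := congrArg D.barAug (rightCell_add_restrict_boundary_singleton (D := D) w)
    rwa [map_add, barAug_rightCell_nil, ← MulOpposite.op_one, barAug_single_nil, mul_one,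
      add_eq_left] at h
  · refine barAug_eq_zero_of_mem_gr (i := t.length) fun c' hc' => ?_
    rw [← hc, ← barD_single_one, Finset.mem_coe, Finsupp.mem_support_iff,
      barD_single_one_apply] at hc'
    have := deg_of_bdCoeff_ne_zero hc'
    rw [Set.mem_ofPred_eq]
    simp only [deg, hc, List.length_cons] at this ⊢
    omega

namespace IsAdmissible

/-- The contracting homotopy `(a ⊗ b)[w₁|…|w_l] ↦ ∑ v, a_v (1 ⊗ b)[v|w₁|…|w_l]`, where
`a = ∑ v, a_v v` is the representation of `a` by standard monomials. -/
def homotopy (H : D.IsAdmissible len) : D.Bar →ₗ[k] D.Bar :=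
  Finsupp.lsum k fun t : D.Cell =>
    TensorProduct.lift
      (Finsupp.linearCombination k (fun u => D.rightCell (u :: t.1)) ∘ₗ H.reprLinear)

variable (H : D.IsAdmissible len)
include H

theorem barMap_ext {N : Type*} [AddCommGroup N] [Module k N] {f g : D.Bar →ₗ[k] N}
    (h : ∀ (t : D.Cell) (v : Mon) (b : Aᵐᵒᵖ), v ∈ D.G ∨ v = 1 →
      f (single t (D.val v ⊗ₜ[k] b)) = g (single t (D.val v ⊗ₜ[k] b))) :
    f = g := by
  refine Finsupp.lhom_ext' fun t => TensorProduct.ext' fun a b => ?_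
  rw [← (H.isRepr_repr a).2, Finsupp.sum, TensorProduct.sum_tmul, map_sum, map_sum]
  refine Finset.sum_congr rfl fun v hv => ?_
  rw [← TensorProduct.smul_tmul', map_smul, map_smul]
  exact congrArg _ (h t v b ((H.isRepr_repr a).1 v hv))

theorem homotopy_single (t : D.Cell) (a : A) (b : Aᵐᵒᵖ) :
    H.homotopy (single t (a ⊗ₜ[k] b)) =
      (D.repr a).sum fun u x => x • D.rightCell (u :: t.1) b := by
  rw [homotopy, Finsupp.lsum_single, TensorProduct.lift.tmul, LinearMap.comp_apply,
    Finsupp.linearCombination_apply, Finsupp.sum, LinearMap.sum_apply]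
  rfl

theorem homotopy_single_val (t : D.Cell) {v : Mon} (hv : v ∈ D.G ∨ v = 1) (b : Aᵐᵒᵖ) :
    H.homotopy (single t (D.val v ⊗ₜ[k] b)) = D.rightCell (v :: t.1) b := by
  rw [homotopy_single, H.repr_val hv, Finsupp.sum_single_index (by simp), one_smul]

theorem homotopy_smul (b : Aᵐᵒᵖ) (x : D.Bar) :
    H.homotopy ((1 ⊗ₜ[k] b : Env k A) • x) = (1 ⊗ₜ[k] b : Env k A) • H.homotopy x := by
  suffices H.homotopy ∘ₗ D.envSMul (1 ⊗ₜ[k] b) = D.envSMul (1 ⊗ₜ[k] b) ∘ₗ H.homotopy from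
    LinearMap.congr_fun this x
  refine H.barMap_ext (N := D.Bar) fun t v b' hv => ?_
  rw [LinearMap.comp_apply, LinearMap.comp_apply, envSMul_apply, envSMul_apply, ← single_mul,
    Algebra.TensorProduct.tmul_mul_tmul, one_mul, H.homotopy_single_val t hv,
    H.homotopy_single_val t hv, rightCell_mul]

theorem homotopy_rightCell {v : Mon} (hv : v ∈ D.G ∨ v = 1) (l : List Mon) (b : Aᵐᵒᵖ) :
    H.homotopy ((D.val v ⊗ₜ[k] 1 : Env k A) • D.rightCell l b) = D.rightCell (v :: l) b := by
  by_cases hl : ∀ w ∈ l, w ∈ D.G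
  · obtain ⟨c, rfl⟩ : ∃ c : D.Cell, c.1 = l := ⟨⟨l, hl⟩, rfl⟩
    rw [rightCell_eq_single, ← single_mul, Algebra.TensorProduct.tmul_mul_tmul, one_mul, mul_one,
      H.homotopy_single_val _ hv]
  · rw [rightCell_apply, restrict_single_of_not hl, smul_zero, map_zero, rightCell_apply,
      restrict_single_of_not fun h => hl fun w hw => h w (List.mem_cons_of_mem v hw)]

theorem homotopy_contraction {v : Mon} (hv : v ∈ D.G ∨ v = 1) (p : List Mon) (w : Mon)
    (s : List Mon) :
    H.homotopy ((D.val v ⊗ₜ[k] 1 : Env k A) • D.restrict (D.contraction p w s)) =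
      D.restrict (D.contraction (v :: p) w s) := by
  rw [restrict_contraction, restrict_contraction, Finsupp.sum, Finset.smul_sum, map_sum]
  refine Finset.sum_congr rfl fun u _ => ?_
  rw [smul_comm, map_smul, H.homotopy_rightCell hv]
  rfl

theorem homotopy_smul_single {v w : Mon} {t : List Mon} (ht : ∀ x ∈ t, x ∈ D.G) :
    H.homotopy ((D.val v ⊗ₜ[k] 1 : Env k A) • D.restrict (single t (D.val w ⊗ₜ[k] 1))) =
      D.restrict (D.contraction [] (v * w) t) := by
  obtain ⟨c, rfl⟩ : ∃ c : D.Cell, c.1 = t := ⟨⟨t, ht⟩, rfl⟩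
  rw [restrict_single c, ← single_mul, Algebra.TensorProduct.tmul_mul_tmul, one_mul, ← map_mul,
    homotopy_single, restrict_contraction]
  rfl

theorem homotopy_smul_neg_one_pow_smul (n : ℕ) (e : Env k A) (x : D.Bar) :
    H.homotopy (e • ((-1 : Env k A) ^ n • x)) = (-1 : Env k A) ^ n • H.homotopy (e • x) := by
  have h (x : D.Bar) : (-1 : Env k A) ^ n • x = (-1 : k) ^ n • x := by
    rw [← algebraMap_smul (Env k A) ((-1 : k) ^ n) x, map_pow, map_neg, map_one]
  rw [h, h, ← envSMul_apply, map_smul, map_smul, envSMul_apply]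

theorem homotopy_smul_boundary_add_boundary {v : Mon} (hv : v ∈ D.G ∨ v = 1) (w : Mon)
    {t : List Mon} (ht : ∀ x ∈ t, x ∈ D.G) :
    H.homotopy ((D.val v ⊗ₜ[k] 1 : Env k A) • D.restrict (D.boundary (w :: t))) +
      D.restrict (D.boundary (v :: w :: t)) = D.restrict (single (w :: t) (D.val v ⊗ₜ[k] 1)) := by
  have hs (s : Finset ℕ) (f : ℕ → D.Bar) : ∑ x ∈ s, -f x = -∑ x ∈ s, f x :=
    Finset.sum_neg_distrib f
  rw [boundary, boundary, List.length_cons, Finset.sum_range_succ']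
  simp only [map_add, map_sum, smul_add, Finset.smul_sum, map_smul, restrict_single_mul,
    ← rightCell_apply, H.homotopy_smul_neg_one_pow_smul, H.homotopy_smul_single ht,
    H.homotopy_contraction hv, H.homotopy_rightCell hv, List.take_succ_cons, List.getD_cons_succ,
    List.getD_cons_zero, List.drop_succ_cons, List.take_zero, List.drop_zero,
    List.dropLast_cons_cons, List.getLastD_cons]
  simp only [neg_one_pow_succ_smul, pow_zero, one_smul, hs]
  abel

end IsAdmissible

end StdMonomials

namespace StdMonomials

open AlgMorse

variable {k A Mon : Type*} [Field k] [Ring A] [Algebra k A] [Monoid Mon]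
  {D : StdMonomials k A Mon} {len : Mon → ℕ}

theorem aug_eq_barAug_comp_critIncl :
    D.aug = D.barAug ∘ₗ critIncl (Env k A) D.deg D.matching 0 := by
  refine linearMap_ext_single_one fun e => ?_
  rw [LinearMap.comp_apply, critIncl_single, aug, barAug, Finsupp.linearCombination_single,
    Finsupp.linearCombination_single, if_pos (List.length_eq_zero_iff.1 e.2.2)]

namespace IsAdmissible

variable (H : D.IsAdmissible len)
include H

theorem restrict_boundary_one_cons (t : D.Cell) : D.restrict (D.boundary (1 :: t.1)) = 0 := by
  rcases ht : t.1 with _ | ⟨w, s⟩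
  · have h := rightCell_add_restrict_boundary_singleton (D := D) 1
    rw [map_one] at h
    exact add_eq_left.1 (h.trans (rightCell_eq_single D.nilCell 1).symm)
  · have hw : w ∈ D.G := t.2 w (by rw [ht]; exact List.mem_cons_self)
    have hface : D.restrict (D.contraction [] w s) =
        D.restrict (single (w :: s) (1 ⊗ₜ[k] 1)) := by
      rw [restrict_contraction, H.repr_val (Or.inl hw), Finsupp.sum_single_index (by simp),
        one_smul]
      rfl
    rw [boundary, List.length_cons, Finset.sum_range_succ']
    simp only [map_add, map_sum, map_smul, map_one, restrict_single_mul, ← rightCell_apply,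
      List.take_succ_cons, List.getD_cons_succ, List.getD_cons_zero, List.drop_succ_cons,
      List.take_zero, List.drop_zero, List.dropLast_cons_cons,
      restrict_contraction_one_cons H.one_notMem, rightCell_one_cons H.one_notMem, smul_zero,
      Finset.sum_const_zero, one_mul, hface, neg_one_pow_succ_smul, pow_zero, one_smul]
    abel

theorem barD_rightCell_cons {v : Mon} (hv : v ∈ D.G ∨ v = 1) (t : D.Cell) (b : Aᵐᵒᵖ) :
    D.barD (D.rightCell (v :: t.1) b) =
      (1 ⊗ₜ[k] b : Env k A) • D.restrict (D.boundary (v :: t.1)) := by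
  rcases hv with hv | rfl
  · exact barD_rightCell ⟨v :: t.1, List.forall_mem_cons.2 ⟨hv, t.2⟩⟩ b
  · rw [rightCell_one_cons H.one_notMem, map_zero, H.restrict_boundary_one_cons, smul_zero]

theorem homotopy_identity_single_val (t : D.Cell) {v : Mon} (hv : v ∈ D.G ∨ v = 1) :
    H.homotopy ((D.val v ⊗ₜ[k] 1 : Env k A) • D.restrict (D.boundary t.1)) +
      D.restrict (D.boundary (v :: t.1)) + D.augSection (single t (D.val v ⊗ₜ[k] 1)) =
    single t (D.val v ⊗ₜ[k] 1) := by
  rcases ht : t.1 with _ | ⟨w, s⟩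
  · obtain rfl : t = D.nilCell := Subtype.ext ht
    rw [restrict_boundary_nil, smul_zero, map_zero, zero_add, augSection_apply,
      ← MulOpposite.op_one, barAug_single_nil, mul_one, add_comm]
    exact rightCell_add_restrict_boundary_singleton v
  · have hs : ∀ x ∈ s, x ∈ D.G := fun x hx => t.2 x (by rw [ht]; exact List.mem_cons_of_mem w hx)
    rw [H.homotopy_smul_boundary_add_boundary hv w hs, ← ht, restrict_single,
      augSection_single_of_ne_nil (by rw [ht]; exact List.cons_ne_nil w s), add_zero]

theorem homotopy_identity (x : D.Bar) :
    H.homotopy (D.barD x) + D.barD (H.homotopy x) + D.augSection x = x := by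
  suffices H.homotopy ∘ₗ D.barD.restrictScalars k + D.barD.restrictScalars k ∘ₗ H.homotopy +
      D.augSection = LinearMap.id from LinearMap.congr_fun this x
  refine H.barMap_ext (N := D.Bar) fun t v b hv => ?_
  change H.homotopy (D.barD _) + D.barD (H.homotopy _) + D.augSection _ = single t _
  have hmul : (D.val v ⊗ₜ[k] b : Env k A) = (1 ⊗ₜ[k] b) * (D.val v ⊗ₜ[k] 1) := by
    rw [Algebra.TensorProduct.tmul_mul_tmul, one_mul, mul_one]
  rw [H.homotopy_single_val t hv, H.barD_rightCell_cons hv, hmul, single_mul,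
    augSection_smul, map_smul, barD_single, H.homotopy_smul, ← smul_add, ← smul_add,
    H.homotopy_identity_single_val t hv]

theorem barD_barD (x : D.Bar) : D.barD (D.barD x) = 0 := by
  suffices D.barD ∘ₗ D.barD = 0 from LinearMap.congr_fun this x
  refine linearMap_ext_single_one (R := Env k A) (N := D.Bar) fun c => ?_
  rw [LinearMap.comp_apply, LinearMap.zero_apply]
  induction hl : c.1 generalizing c with
  | nil => rw [barD_single_one, hl, restrict_boundary_nil, map_zero]
  | cons v l ih =>
    obtain ⟨hv, h⟩ := List.forall_mem_cons.1 (hl ▸ c.2)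
    obtain ⟨t, rfl⟩ : ∃ t : D.Cell, t.1 = l := ⟨⟨l, h⟩, rfl⟩
    -- `c` is `homotopy y`, so the claim follows from the homotopy identities of `y` and `∂y`.
    set y : D.Bar := single t (D.val v ⊗ₜ[k] 1) with hy
    have hcell : single c (1 : Env k A) = H.homotopy y := by
      rw [hy, H.homotopy_single_val t (Or.inl hv), ← hl, rightCell_eq_single]
      rfl
    have hddy : D.barD (D.barD y) = 0 := by
      rw [hy, single_eq_smul_single_one, map_smul, map_smul, ih t rfl, smul_zero]
    have hid := H.homotopy_identity (D.barD y)
    rw [hddy, map_zero, zero_add, augSection_eq_zero (barAug_barD y), add_zero] at hid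
    have hdid := congrArg D.barD (H.homotopy_identity y)
    rw [map_add, map_add, augSection_apply, barD_rightCell_nil, add_zero, hid, add_eq_left] at hdid
    rw [hcell, hdid]

theorem homotopy_mem_gr {i : ℕ} {x : D.Bar} (hx : x ∈ gr (Env k A) D.deg i) :
    H.homotopy x ∈ gr (Env k A) D.deg (i + 1) := by
  rw [← Finsupp.sum_single x, Finsupp.sum, map_sum]
  refine Submodule.sum_mem _ fun c hc => ?_
  have hd : D.deg c = i := hx hc
  generalize x c = e
  induction e using TensorProduct.induction_on with
  | zero => rw [Finsupp.single_zero, map_zero]; exact zero_mem _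
  | add e e' h h' => rw [Finsupp.single_add, map_add]; exact add_mem h h'
  | tmul a b =>
    rw [homotopy_single]
    refine Submodule.sum_mem _ fun u _ => ?_
    dsimp only
    rw [← map_smul, ← hd]
    exact rightCell_mem_gr (u :: c.1) _

theorem isMatchedComplex : IsMatchedComplex D.deg D.bdCoeff D.matching D.barD :=
  ⟨H.isAcyclicMatching, H.wellFounded_mEdge, barD_single_one_apply,
    fun h => deg_of_bdCoeff_ne_zero h, H.barD_barD⟩

theorem finitePaths : D.FinitePaths :=
  H.isMatchedComplex.pathsFrom_finite

theorem critical_of_deg_eq_zero {c : D.Cell} (hc : D.deg c = 0) : Critical D.matching c := by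
  have hnil : c.1 = [] := List.length_eq_zero_iff.1 hc
  rintro ⟨a, b⟩ he
  obtain ⟨p, u, v, s, ha, hb, -⟩ := H.mem_matching_iff.1 he
  refine ⟨fun h : a = c => ?_, fun h : b = c => ?_⟩
  · rw [h, hnil] at ha
    simp at ha
  · rw [h, hnil] at hb
    simp at hb

theorem isFreeResolution : D.IsFreeResolution := by
  rw [IsFreeResolution, aug_eq_barAug_comp_critIncl]
  refine H.isMatchedComplex.isFreeRes (fun c hc => H.critical_of_deg_eq_zero hc) D.barAug
    (fun i x hx hdx => ⟨H.homotopy x, H.homotopy_mem_gr hx, ?_⟩) (fun x _ => barAug_barD x)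
    (fun x hx hεx => ⟨H.homotopy x, H.homotopy_mem_gr hx, ?_⟩)
    (fun a => ⟨single D.nilCell (a ⊗ₜ[k] MulOpposite.op 1),
      Finsupp.single_mem_supported _ _ rfl, ?_⟩)
  · have hid := H.homotopy_identity x
    rwa [hdx, map_zero, zero_add, augSection_eq_zero (barAug_eq_zero_of_mem_gr hx),
      add_zero] at hid
  · have hid := H.homotopy_identity x
    rwa [barD_eq_zero_of_mem_gr_zero hx, map_zero, zero_add, augSection_eq_zero hεx,
      add_zero] at hid
  · rw [barAug_single_nil, mul_one]

end IsAdmissible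

end StdMonomials

/-! ### Minimality -/

namespace StdMonomials

open AlgMorse

variable {k A Mon : Type*} [Field k] [Ring A] [Algebra k A] [Monoid Mon]
  {D : StdMonomials k A Mon} {len : Mon → ℕ} {m : Ideal (Env k A)}

theorem contracts_of_bdCoeff_notMem (hl : ∀ w ∈ D.G, (D.val w ⊗ₜ[k] 1 : Env k A) ∈ m)
    (hr : ∀ w ∈ D.G, (1 ⊗ₜ[k] MulOpposite.op (D.val w) : Env k A) ∈ m) {c c' : D.Cell}
    (h : D.bdCoeff c c' ∉ m) : D.Contracts c c' := by
  obtain ⟨w, hc, hw⟩ | ⟨w, hc, hw⟩ | ⟨p, a, b, s, v, hc, hc', hv⟩ := exists_of_bdCoeff_notMem m h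
  · exact absurd (hl w (c.2 w (by simp [hc]))) hw
  · exact absurd (hr w (c.2 w (by simp [hc]))) hw
  · exact ⟨p, s, a, b, v, by simp [hc], by simp [hc'], hv⟩

namespace IsAdmissible

variable (H : D.IsAdmissible len)
include H

/-- A path to a critical cell one degree below alternates between downward and upward steps. If no
downward step has its weight in `m`, then all of them are contractions, and the path is a sequence
of reductions of type I followed by one of type II. -/
theorem pathWeight_mem [m.IsTwoSided] (hT : D.NoTypeII)
    (hl : ∀ w ∈ D.G, (D.val w ⊗ₜ[k] 1 : Env k A) ∈ m)
    (hr : ∀ w ∈ D.G, (1 ⊗ₜ[k] MulOpposite.op (D.val w) : Env k A) ∈ m)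
    {e f : D.Cell} (he : D.Crit e) (hf : D.Crit f) : ∀ (p : List D.Cell) (c : D.Cell),
      Relation.ReflTransGen D.TypeI e c → (∀ u, (u, c) ∉ D.matching) → D.deg c = D.deg f + 1 →
      p ∈ paths D.deg D.bdCoeff D.matching c f → pathWeight D.deg D.bdCoeff p ∈ m := by
  intro p
  induction hn : p.length using Nat.strong_induction_on generalizing p with
  | _ n ih =>
  intro c hec hc hdeg hp
  have hM := H.isAcyclicMatching
  obtain ⟨-, rfl⟩ | ⟨c', ⟨⟨hdeg', hne⟩, hnot⟩ | ⟨-, hup⟩, q, hq, rfl⟩ := mem_paths_iff.1 hp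
  · omega
  swap
  · exact absurd hup (hc c')
  rw [pathWeight_cons hq.1, stepWeight, if_neg (by omega)]
  by_cases hw : D.bdCoeff c c' ∈ m
  · exact m.mul_mem_right _ hw
  have hcontracts := contracts_of_bdCoeff_notMem hl hr hw
  refine m.mul_mem_left _ ?_
  obtain ⟨-, rfl⟩ | ⟨c'', ⟨hdown, -⟩ | ⟨⟨hdeg'', -⟩, hup⟩, r, hr', rfl⟩ := mem_paths_iff.1 hq
  · exact absurd ⟨hf, hcontracts⟩ (hT e c _ he hec)
  · have := (hM.deg_of_mem_paths hf r c'' hr').1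
    have := hdown.1
    omega
  rw [pathWeight_cons hr'.1]
  have hreduction : D.TypeI c c'' :=
    ⟨by rintro rfl; exact hnot hup, c', hcontracts, hup⟩
  exact m.mul_mem_left _ (ih r.length (by simp only [List.length_cons] at hn; omega) r rfl c''
    (hec.tail hreduction) (fun u hu => hM.target_not_source hu hup) (by omega) hr')

theorem isMinimal [m.IsTwoSided] (hT : D.NoTypeII)
    (hl : ∀ w ∈ D.G, (D.val w ⊗ₜ[k] 1 : Env k A) ∈ m)
    (hr : ∀ w ∈ D.G, (1 ⊗ₜ[k] MulOpposite.op (D.val w) : Env k A) ∈ m) : D.IsMinimal m := by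
  intro i x
  let T : Submodule (Env k A) (D.F i) :=
    { carrier := {y | ∀ f, y f ∈ m}
      add_mem' := fun hy hz f => m.add_mem (hy f) (hz f)
      zero_mem' := fun _ => m.zero_mem
      smul_mem' := fun e y hy f => m.mul_mem_left e (hy f) }
  suffices D.d i x ∈ T from this
  refine map_mem_of_single_mem (s := Set.univ) (fun e _ => ?_) (by simp)
  rw [d, morseD, Finsupp.linearCombination_single, one_smul]
  refine finsum_induction (· ∈ T) T.zero_mem (fun _ _ => T.add_mem) fun f g => ?_
  have hGam : Gam D.deg D.bdCoeff D.matching e.1 f.1 ∈ m :=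
    finsum_mem_induction (· ∈ m) m.zero_mem (fun _ _ => m.add_mem) fun p hp =>
      H.pathWeight_mem hT hl hr e.2.1 f.2.1 p e.1 .refl e.2.1.notMem_target
        (by rw [e.2.2, f.2.2]) hp
  obtain rfl | hfg := eq_or_ne g f
  · rwa [Finsupp.single_eq_same]
  · rw [Finsupp.single_eq_of_ne hfg]
    exact m.zero_mem

end IsAdmissible

section EnvIdeal

variable {ι : Type*} {x : ι → A}

theorem val_tmul_mem_envIdeal (hx : ∀ w, w ≠ 1 → ∃ i w', D.val w = D.val w' * x i) {w : Mon}
    (hw : w ≠ 1) (b : Aᵐᵒᵖ) : (D.val w ⊗ₜ[k] b : Env k A) ∈ envIdeal k x := by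
  obtain ⟨i, w', h⟩ := hx w hw
  have hfactor : (D.val w ⊗ₜ[k] b : Env k A) = (D.val w' ⊗ₜ[k] b) * (x i ⊗ₜ[k] 1) := by
    rw [Algebra.TensorProduct.tmul_mul_tmul, h, mul_one]
  rw [hfactor]
  exact Ideal.mul_mem_left _ _ (Ideal.subset_span (.inl ⟨i, rfl⟩))

theorem tmul_op_val_mem_envIdeal (hx : ∀ w, w ≠ 1 → ∃ i w', D.val w = x i * D.val w') {w : Mon}
    (hw : w ≠ 1) (a : A) : (a ⊗ₜ[k] MulOpposite.op (D.val w) : Env k A) ∈ envIdeal k x := by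
  obtain ⟨i, w', h⟩ := hx w hw
  have hfactor : (a ⊗ₜ[k] MulOpposite.op (D.val w) : Env k A) =
      (a ⊗ₜ[k] MulOpposite.op (D.val w')) * (1 ⊗ₜ[k] MulOpposite.op (x i)) := by
    rw [Algebra.TensorProduct.tmul_mul_tmul, h, mul_one, MulOpposite.op_mul]
  rw [hfactor]
  exact Ideal.mul_mem_left _ _ (Ideal.subset_span (.inr ⟨i, rfl⟩))

theorem IsAdmissible.val_mul_tmul_mem_envIdeal (H : D.IsAdmissible len)
    (hx : ∀ w, w ≠ 1 → ∃ i w', D.val w = D.val w' * x i) {v : Mon} (hv : v ≠ 1) (a : A)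
    (b : Aᵐᵒᵖ) : ((D.val v * a) ⊗ₜ[k] b : Env k A) ∈ envIdeal k x := by
  let φ : A →ₗ[k] Env k A := (TensorProduct.mk k A Aᵐᵒᵖ).flip b ∘ₗ LinearMap.mulLeft k (D.val v)
  suffices Submodule.span k (Set.range D.val) ≤ ((envIdeal k x).restrictScalars k).comap φ from
    this (H.span a)
  rw [Submodule.span_le]
  rintro _ ⟨w, rfl⟩
  change ((D.val v * D.val w) ⊗ₜ[k] b : Env k A) ∈ envIdeal k x
  rw [← map_mul]
  exact val_tmul_mem_envIdeal hx (H.order.mul_ne_one (.inl hv)) b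

theorem IsAdmissible.tmul_op_mul_val_mem_envIdeal (H : D.IsAdmissible len)
    (hx : ∀ w, w ≠ 1 → ∃ i w', D.val w = x i * D.val w') {v : Mon} (hv : v ≠ 1) (a b : A) :
    (a ⊗ₜ[k] MulOpposite.op (b * D.val v) : Env k A) ∈ envIdeal k x := by
  let φ : A →ₗ[k] Env k A := TensorProduct.mk k A Aᵐᵒᵖ a ∘ₗ
    (MulOpposite.opLinearEquiv k).toLinearMap ∘ₗ LinearMap.mulRight k (D.val v)
  suffices Submodule.span k (Set.range D.val) ≤ ((envIdeal k x).restrictScalars k).comap φ from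
    this (H.span b)
  rw [Submodule.span_le]
  rintro _ ⟨w, rfl⟩
  change (a ⊗ₜ[k] MulOpposite.op (D.val w * D.val v) : Env k A) ∈ envIdeal k x
  rw [← map_mul]
  exact tmul_op_val_mem_envIdeal hx (H.order.mul_ne_one (.inr hv)) a

theorem IsAdmissible.isTwoSided_envIdeal (H : D.IsAdmissible len)
    (hval : ∀ i, ∃ w, w ≠ 1 ∧ x i = D.val w)
    (hl : ∀ w, w ≠ 1 → ∃ i w', D.val w = x i * D.val w')
    (hr : ∀ w, w ≠ 1 → ∃ i w', D.val w = D.val w' * x i) : (envIdeal k x).IsTwoSided := by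
  refine ⟨fun {y} e hy => ?_⟩
  induction hy using Submodule.span_induction with
  | zero => rw [zero_mul]; exact zero_mem _
  | add y y' _ _ h h' => rw [add_mul]; exact add_mem h h'
  | smul e' y _ h => rw [smul_mul_assoc]; exact Submodule.smul_mem _ e' h
  | mem y hy =>
    induction e using TensorProduct.induction_on with
    | zero => rw [mul_zero]; exact zero_mem _
    | add e e' h h' => rw [mul_add]; exact add_mem h h'
    | tmul a b =>
      obtain ⟨i, rfl⟩ | ⟨i, rfl⟩ := hy <;> obtain ⟨v, hv, hxv⟩ := hval i <;> dsimp only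
      · rw [Algebra.TensorProduct.tmul_mul_tmul, one_mul, hxv]
        exact H.val_mul_tmul_mem_envIdeal hr hv a b
      · obtain ⟨b, rfl⟩ := MulOpposite.op_surjective b
        rw [Algebra.TensorProduct.tmul_mul_tmul, one_mul, hxv, ← MulOpposite.op_mul]
        exact H.tmul_op_mul_val_mem_envIdeal hl hv a b

theorem IsAdmissible.isMinimal_envIdeal (H : D.IsAdmissible len) (hT : D.NoTypeII)
    (hval : ∀ i, ∃ w, w ≠ 1 ∧ x i = D.val w)
    (hl : ∀ w, w ≠ 1 → ∃ i w', D.val w = x i * D.val w')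
    (hr : ∀ w, w ≠ 1 → ∃ i w', D.val w = D.val w' * x i) : D.IsMinimal (envIdeal k x) :=
  have := H.isTwoSided_envIdeal hval hl hr
  H.isMinimal hT (fun _ hw => val_tmul_mem_envIdeal hr (H.ne_one hw) 1)
    fun _ hw => tmul_op_val_mem_envIdeal hl (H.ne_one hw) 1

end EnvIdeal

end StdMonomials

/-! ### Presentations by a Gröbner basis -/

namespace Groebner

variable {k P A Mon : Type*} [Field k] [Monoid Mon] {coef : P → Mon → k} {lt : Mon → Mon → Prop}
  {len : Mon → ℕ} {S : Finset P} {I : Set P}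

theorem Factor.trans {a b c : Mon} (h : Factor a b) (h' : Factor b c) : Factor a c := by
  obtain ⟨x, y, rfl⟩ := h
  obtain ⟨z, w, rfl⟩ := h'
  exact ⟨z * x, y * w, by simp only [mul_assoc]⟩

theorem factor_mul_right (a b : Mon) : Factor a (a * b) := ⟨1, b, by rw [one_mul]⟩

theorem factor_mul_left (a b : Mon) : Factor b (a * b) := ⟨a, 1, by rw [mul_one]⟩

theorem mem_std_of_factor {a b : Mon} (h : b ∈ Std coef lt S) (hab : Factor a b) :
    a ∈ Std coef lt S := fun f hf u hu hua => h f hf u hu (hua.trans hab)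

variable [Ring P]

/-- `S` is a Gröbner basis of `I`, not necessarily a reduced one: the leading monomial of every
nonzero element of `I` is divisible by that of some element of `S`. -/
structure IsBasis (coef : P → Mon → k) (lt : Mon → Mon → Prop) (I : Set P) (S : Finset P) :
    Prop where
  subset : ∀ f ∈ S, f ∈ I
  exists_factor : ∀ p ∈ I, p ≠ 0 → ∃ f ∈ S, ∃ u w, IsLead lt (coef f) u ∧ IsLead lt (coef p) w ∧
    Factor u w

theorem IsReduced.isBasis (h : IsReduced coef lt I S) : IsBasis coef lt I S := ⟨h.subset, h.basis⟩

variable [Algebra k P] [Ring A] [Algebra k A]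

/-- `π` exhibits `A` as the quotient of the algebra `P`, whose monomials form the basis `b`, by an
ideal `I` with Gröbner basis `S`, and `D` consists of the resulting standard monomials. -/
structure IsPresentation (coef : P → Mon → k) (b : Module.Basis Mon k P) (π : P →ₐ[k] A)
    (I : Set P) (D : StdMonomials k A Mon) (S : Finset P) : Prop where
  coef_eq : ∀ p w, coef p w = b.repr p w
  surjective : Function.Surjective π
  mem_iff : ∀ p, p ∈ I ↔ π p = 0
  val_eq : ∀ w, D.val w = π (b w)
  mem_G : ∀ w, w ∈ D.G ↔ w ∈ Std coef D.lt S ∧ w ≠ 1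
  isBasis : IsBasis coef D.lt I S

namespace IsPresentation

variable {b : Module.Basis Mon k P} {π : P →ₐ[k] A} {D : StdMonomials k A Mon}

theorem sum_repr_smul_val (h : IsPresentation coef b π I D S) (p : P) :
    (b.repr p).sum (fun v t => t • D.val v) = π p := by
  conv_rhs => rw [← b.linearCombination_repr p, Finsupp.linearCombination_apply, map_finsuppSum]
  simp only [map_smul, h.val_eq]

theorem sum_repr_smul_val_mul (h : IsPresentation coef b π I D S) {f : P} (hf : f ∈ I)
    (a c : Mon) : (b.repr f).sum (fun v t => t • D.val (a * v * c)) = 0 := by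
  have : D.val a * (b.repr f).sum (fun v t => t • D.val v) * D.val c = 0 := by
    rw [h.sum_repr_smul_val, (h.mem_iff f).1 hf, mul_zero, zero_mul]
  simpa only [Finsupp.sum, Finset.mul_sum, Finset.sum_mul, mul_smul_comm, smul_mul_assoc,
    map_mul] using this

theorem one_mem_std [Nontrivial A] (h : IsPresentation coef b π I D S)
    (H : IsGradedOrder D.lt len) : (1 : Mon) ∈ Std coef D.lt S := by
  rintro f hf u hu ⟨a, c, hac⟩
  have hu1 : u = 1 := by
    have := congrArg len hac
    rw [H.len_mul, H.len_mul, H.len_one] at this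
    exact H.len_eq_zero u (by omega)
  subst hu1
  have hconst : b.repr f = single 1 (coef f 1) := by
    ext v
    rw [← h.coef_eq]
    by_cases hv : v = 1
    · rw [hv, Finsupp.single_eq_same]
    · rw [Finsupp.single_eq_of_ne hv]
      by_contra hne
      exact H.irrefl v (H.trans _ _ _ (hu.2 v hne hv) (H.one_lt hv))
  have hzero := h.sum_repr_smul_val f
  rw [hconst, Finsupp.sum_single_index (by rw [zero_smul]), map_one,
    (h.mem_iff f).1 (h.isBasis.subset f hf)] at hzero
  exact smul_ne_zero hu.1 one_ne_zero hzero

theorem val_mem_span (h : IsPresentation coef b π I D S) (H : IsGradedOrder D.lt len) (w : Mon) :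
    D.val w ∈ Submodule.span k (D.val '' {v | v ∈ Std coef D.lt S ∧ (v = w ∨ D.lt v w)}) := by
  classical
  induction w using H.wellFounded.induction with
  | _ w ih =>
  by_cases hw : w ∈ Std coef D.lt S
  · exact Submodule.subset_span ⟨w, ⟨hw, Or.inl rfl⟩, rfl⟩
  simp only [Std, Set.mem_ofPred_eq, not_forall, not_not] at hw
  obtain ⟨f, hf, u, hu, a, c, rfl⟩ := hw
  have hrewrite := h.sum_repr_smul_val_mul (h.isBasis.subset f hf) a c
  rw [Finsupp.sum, ← Finset.add_sum_erase _ _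
    (Finsupp.mem_support_iff.2 (h.coef_eq f u ▸ hu.1)), ← h.coef_eq] at hrewrite
  rw [← Submodule.smul_mem_iff _ hu.1, eq_neg_of_add_eq_zero_left hrewrite]
  refine neg_mem (Submodule.sum_mem _ fun v hv => Submodule.smul_mem _ _ ?_)
  rw [Finset.mem_erase, Finsupp.mem_support_iff, ← h.coef_eq] at hv
  have hlt := H.mul_lt _ _ a c (hu.2 v hv.2 hv.1)
  refine Submodule.span_mono (Set.image_mono ?_) (ih _ hlt)
  rintro x ⟨hx, rfl | hxv⟩
  exacts [⟨hx, Or.inr hlt⟩, ⟨hx, Or.inr (H.trans _ _ _ hxv hlt)⟩]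

theorem exists_isRepr (h : IsPresentation coef b π I D S) (H : IsGradedOrder D.lt len) (w : Mon) :
    ∃ r, D.IsRepr (D.val w) r ∧ ∀ v ∈ r.support, v = w ∨ D.lt v w := by
  obtain ⟨r, hr, hrw⟩ := (Finsupp.mem_span_image_iff_linearCombination k).1 (h.val_mem_span H w)
  refine ⟨r, ⟨fun v hv => ?_, hrw⟩, fun v hv => (hr hv).2⟩
  rw [h.mem_G, or_iff_not_imp_right]
  exact fun hv1 => ⟨(hr hv).1, hv1⟩

theorem eq_zero_of_sum_smul_val [Nontrivial A] (h : IsPresentation coef b π I D S)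
    (H : IsGradedOrder D.lt len) {r : Mon →₀ k} (hr : ∀ v ∈ r.support, v ∈ D.G ∨ v = 1)
    (h0 : r.sum (fun v t => t • D.val v) = 0) : r = 0 := by
  by_contra hne
  obtain ⟨p, rfl⟩ := b.repr.surjective r
  have hp : p ∈ I := by rw [h.mem_iff, ← h.sum_repr_smul_val, h0]
  obtain ⟨f, hf, u, w, hu, hw, huw⟩ := h.isBasis.exists_factor p hp (by simpa using hne)
  have hstd : w ∈ Std coef D.lt S := by
    rcases hr w (Finsupp.mem_support_iff.2 (h.coef_eq p w ▸ hw.1)) with hw | rfl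
    exacts [((h.mem_G w).1 hw).1, h.one_mem_std H]
  exact hstd f hf u hu huw

theorem isAdmissible [Nontrivial A] (h : IsPresentation coef b π I D S)
    (H : IsGradedOrder D.lt len) : D.IsAdmissible len where
  order := H
  left_mem u v huv hu :=
    (h.mem_G u).2 ⟨mem_std_of_factor ((h.mem_G _).1 huv).1 (factor_mul_right u v), hu⟩
  right_mem u v huv hv :=
    (h.mem_G v).2 ⟨mem_std_of_factor ((h.mem_G _).1 huv).1 (factor_mul_left u v), hv⟩
  one_notMem h1 := ((h.mem_G 1).1 h1).2 rfl
  exists_repr := h.exists_isRepr H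
  indep _ := h.eq_zero_of_sum_smul_val H
  span a := by
    obtain ⟨p, rfl⟩ := h.surjective a
    rw [← h.sum_repr_smul_val p]
    exact Submodule.sum_mem _ fun v _ => Submodule.smul_mem _ _ (Submodule.subset_span ⟨v, rfl⟩)

theorem G_eq_empty [Subsingleton A] (h : IsPresentation coef b π I D S) : D.G = ∅ := by
  rw [Set.eq_empty_iff_forall_notMem]
  intro w hw
  have h1 : b 1 ∈ I := (h.mem_iff _).2 (Subsingleton.elim _ _)
  obtain ⟨f, hf, u, v, hu, hv, huv⟩ := h.isBasis.exists_factor _ h1 (b.ne_zero 1)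
  obtain rfl : v = 1 := by
    by_contra hne
    exact hv.1 (by rw [h.coef_eq, b.repr_self, Finsupp.single_eq_of_ne hne])
  exact ((h.mem_G w).1 hw).1 f hf u hu (huv.trans ⟨1, w, by rw [mul_one, one_mul]⟩)

end IsPresentation

end Groebner

namespace StdMonomials

variable {k A Mon : Type*} [Field k] [Ring A] [Algebra k A] [Monoid Mon]
  {D : StdMonomials k A Mon}

theorem matching_eq_empty (hG : D.G = ∅) : D.matching = ∅ := by
  refine Set.eq_empty_of_forall_notMem fun e he => ?_
  obtain ⟨j, hj⟩ := Set.mem_iUnion.1 he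
  obtain ⟨-, -, p, s, u, v, -, h, -⟩ := hj
  exact (hG ▸ e.1.2 u (by simp [h]) : u ∈ (∅ : Set Mon))

theorem cell_eq_nil (hG : D.G = ∅) (c : D.Cell) : c.1 = [] :=
  List.eq_nil_iff_forall_not_mem.2 fun w hw => (hG ▸ c.2 w hw : w ∈ (∅ : Set Mon))

theorem not_mEdge (hG : D.G = ∅) (c c' : D.Cell) :
    ¬ AlgMorse.MEdge D.deg D.bdCoeff D.matching c c' := by
  rintro (⟨⟨h, -⟩, -⟩ | ⟨⟨h, -⟩, -⟩) <;>
    simp [deg, cell_eq_nil hG] at h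

theorem isAcyclicMatching_of_eq_empty (hG : D.G = ∅) : D.IsAcyclicMatching where
  edge := by simp [matching_eq_empty hG]
  matching := by simp [matching_eq_empty hG]
  central := by simp [matching_eq_empty hG]
  invertible := by simp [matching_eq_empty hG]
  acyclic c h := by
    obtain ⟨c', -, h⟩ := Relation.TransGen.tail'_iff.1 h
    exact not_mEdge hG _ _ h

theorem finitePaths_of_eq_empty (hG : D.G = ∅) : D.FinitePaths :=
  AlgMorse.pathsFrom_finite ⟨fun c => ⟨c, fun _ h => (not_mEdge hG _ _ h).elim⟩⟩ fun c => by
    simp [not_mEdge hG c]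

theorem crit_of_eq_empty (hG : D.G = ∅) (c : D.Cell) : D.Crit c := by
  simp [Crit, AlgMorse.Critical, matching_eq_empty hG]

theorem isFreeResolution_of_subsingleton [Subsingleton A] : D.IsFreeResolution := by
  have : Subsingleton (Env k A) := Module.subsingleton A (Env k A)
  exact
    { free i := inferInstance
      exact i y := ⟨fun _ => ⟨0, Subsingleton.elim _ _⟩, fun _ => Subsingleton.elim _ _⟩
      exact_zero y := ⟨fun _ => ⟨0, Subsingleton.elim _ _⟩, fun _ => Subsingleton.elim _ _⟩
      surjective y := ⟨0, Subsingleton.elim _ _⟩ }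

theorem isMinimal_of_subsingleton [Subsingleton A] (m : Ideal (Env k A)) : D.IsMinimal m := by
  have : Subsingleton (Env k A) := Module.subsingleton A (Env k A)
  intro i x f
  rw [Subsingleton.elim (D.d i x f) 0]
  exact m.zero_mem

end StdMonomials

namespace Groebner.IsPresentation

variable {k P A Mon : Type*} [Field k] [Monoid Mon] {coef : P → Mon → k} {len : Mon → ℕ}
  {S : Finset P} {I : Set P} [Ring P] [Algebra k P] [Ring A] [Algebra k A]
  {b : Module.Basis Mon k P} {π : P →ₐ[k] A} {D : StdMonomials k A Mon}

theorem isAcyclicMatching (h : IsPresentation coef b π I D S) (H : IsGradedOrder D.lt len) :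
    D.IsAcyclicMatching := by
  rcases subsingleton_or_nontrivial A
  exacts [StdMonomials.isAcyclicMatching_of_eq_empty h.G_eq_empty,
    (h.isAdmissible H).isAcyclicMatching]

theorem finitePaths (h : IsPresentation coef b π I D S) (H : IsGradedOrder D.lt len) :
    D.FinitePaths := by
  rcases subsingleton_or_nontrivial A
  exacts [StdMonomials.finitePaths_of_eq_empty h.G_eq_empty, (h.isAdmissible H).finitePaths]

theorem isFreeResolution (h : IsPresentation coef b π I D S) (H : IsGradedOrder D.lt len) :
    D.IsFreeResolution := by
  rcases subsingleton_or_nontrivial A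
  exacts [StdMonomials.isFreeResolution_of_subsingleton, (h.isAdmissible H).isFreeResolution]

theorem isMinimal_envIdeal (h : IsPresentation coef b π I D S) (H : IsGradedOrder D.lt len)
    {ι : Type*} {x : ι → A} (hval : ∀ i, ∃ w, w ≠ 1 ∧ x i = D.val w)
    (hl : ∀ w, w ≠ 1 → ∃ i w', D.val w = x i * D.val w')
    (hr : ∀ w, w ≠ 1 → ∃ i w', D.val w = D.val w' * x i) (hT : D.NoTypeII) :
    D.IsMinimal (envIdeal k x) := by
  rcases subsingleton_or_nontrivial A
  exacts [StdMonomials.isMinimal_of_subsingleton _,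
    (h.isAdmissible H).isMinimal_envIdeal hT hval hl hr]

end Groebner.IsPresentation

namespace NonComm

variable {k : Type u} [Field k] {n : ℕ}

theorem lex_append {α : Type*} {r : α → α → Prop} {a b : List α} (h : List.Lex r a b)
    (hl : a.length = b.length) (e : List α) : List.Lex r (a ++ e) (b ++ e) := by
  induction h with
  | nil => simp at hl
  | rel h => exact .rel h
  | cons _ ih => exact .cons (ih (by simpa using hl))

theorem lt_iff_shortlex (v w : FreeMonoid (Fin n)) :
    lt v w ↔ List.Shortlex (fun i j : Fin n => j < i) v.toList w.toList :=
  List.shortlex_def.symm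

theorem isGradedOrder : IsGradedOrder (lt (n := n)) FreeMonoid.length where
  irrefl a h := by
    rw [lt_iff_shortlex] at h
    exact irrefl _ h
  trans a b c h h' := by
    rcases h with h | ⟨hab, h⟩ <;> rcases h' with h' | ⟨hbc, h'⟩
    · exact Or.inl (h.trans h')
    · exact Or.inl (hbc ▸ h)
    · exact Or.inl (hab ▸ h')
    · exact Or.inr ⟨hab.trans hbc, List.lex_trans (fun hxy hyz => hyz.trans hxy) h h'⟩
  trichotomous a b h h' := by
    rw [lt_iff_shortlex] at h h'
    exact FreeMonoid.toList.injective (Std.Trichotomous.trichotomous _ _ h h')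
  mul_lt a b c e h := by
    rcases h with h | ⟨hlen, h⟩
    · left
      simp only [FreeMonoid.length_mul]
      omega
    · refine Or.inr ⟨by simp only [FreeMonoid.length_mul, hlen], ?_⟩
      have : (c.toList ++ a.toList).length = (c.toList ++ b.toList).length := by
        rw [List.length_append, List.length_append]
        exact congrArg _ hlen
      exact lex_append (List.Lex.append_left _ h _) this _
  cancel a b c h := mul_left_cancel h
  len_mul := FreeMonoid.length_mul
  len_eq_zero a h := FreeMonoid.length_eq_zero.1 h
  lt_of_len_lt a b h := Or.inl h
  finite N := List.finite_length_le (Fin n) N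

variable {S : Finset (FreeAlgebra k (Fin n))}

/-- `S` is a Gröbner basis, not necessarily a reduced one, of the two-sided ideal that it
generates. -/
def IsGB (S : Finset (FreeAlgebra k (Fin n))) : Prop :=
  Groebner.IsBasis coef lt {p | p ∈ TwoSidedIdeal.span (S : Set (FreeAlgebra k (Fin n)))} S

theorem isPresentation (hS : IsGB S) :
    Groebner.IsPresentation coef (FreeAlgebra.basisFreeMonoid k (Fin n))
      ({ mk S with commutes' := fun _ => rfl } : FreeAlgebra k (Fin n) →ₐ[k] Quot S)
      {p | p ∈ TwoSidedIdeal.span (S : Set (FreeAlgebra k (Fin n)))} (std S) S where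
  coef_eq p w := rfl
  surjective := RingCon.mk'_surjective _
  mem_iff p := by
    rw [Set.mem_ofPred_eq, TwoSidedIdeal.mem_iff]
    exact (RingCon.eq _).symm
  val_eq w := by
    refine congrArg (mk S) ?_
    simp [FreeAlgebra.basisFreeMonoid, FreeAlgebra.equivMonoidAlgebraFreeMonoid]
  mem_G w := Iff.rfl
  isBasis := hS

end NonComm

namespace Comm

variable {k : Type u} [Field k] {n : ℕ}

theorem isGradedOrder :
    IsGradedOrder (lt (n := n)) (fun w => Finsupp.degree w.toAdd) where
  irrefl _ h := lt_irrefl _ h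
  trans _ _ _ h h' := lt_trans h h'
  trichotomous _ _ h h' := Multiplicative.toAdd.injective <|
    toDegLex.injective (le_antisymm (not_lt.1 h') (not_lt.1 h))
  mul_lt _ _ c e h :=
    add_lt_add_left (add_lt_add_right h (toDegLex c.toAdd)) (toDegLex e.toAdd)
  cancel _ _ _ h := mul_left_cancel h
  len_mul _ _ := map_add _ _ _
  len_eq_zero _ h := (Finsupp.degree_eq_zero_iff _).1 h
  lt_of_len_lt _ _ h := Finsupp.DegLex.lt_iff.2 (Or.inl h)
  finite N := Finsupp.finite_of_degree_le N

variable {S : Finset (MvPolynomial (Fin n) k)}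

/-- `S` is a Gröbner basis, not necessarily a reduced one, of the ideal that it generates. -/
def IsGB (S : Finset (MvPolynomial (Fin n) k)) : Prop :=
  Groebner.IsBasis coef lt (Ideal.span (S : Set (MvPolynomial (Fin n) k)) : Set _) S

theorem isPresentation (hS : IsGB S) :
    Groebner.IsPresentation coef
      ((MvPolynomial.basisMonomials (Fin n) k).reindex Multiplicative.ofAdd)
      ({ mk S with commutes' := fun _ => rfl } : MvPolynomial (Fin n) k →ₐ[k] Quot S)
      (Ideal.span (S : Set (MvPolynomial (Fin n) k)) : Set _) (std S) S where
  coef_eq _ _ := by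
    rw [Module.Basis.repr_reindex_apply]
    rfl
  surjective := Ideal.Quotient.mk_surjective
  mem_iff _ := Ideal.Quotient.eq_zero_iff_mem.symm
  val_eq _ := by
    rw [Module.Basis.reindex_apply, MvPolynomial.coe_basisMonomials]
    rfl
  mem_G _ := Iff.rfl
  isBasis := hS

end Comm

/-! ### Fully attached tuples -/

namespace StdMonomials

variable {k A Mon : Type*} [Field k] [Ring A] [Algebra k A] [Monoid Mon]
  {D : StdMonomials k A Mon} {len : Mon → ℕ}

/-- Each entry of the tuple `l`, preceded by the reversed tuple `p`, is minimal for divisibility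
among the monomials that survive the matchings in the coordinates before it. -/
def MinEntries (D : StdMonomials k A Mon) : List Mon → List Mon → Prop
  | _, [] => True
  | p, w :: s => DvdMinimal (D.Survives p) w ∧ MinEntries D (w :: p) s

theorem minEntries_iff (p l : List Mon) : D.MinEntries p l ↔
    ∀ p' w s, l = p'.reverse ++ w :: s → DvdMinimal (D.Survives (p' ++ p)) w := by
  induction l generalizing p with
  | nil => simp [MinEntries]
  | cons v l ih =>
    rw [MinEntries, ih]
    constructor
    · rintro ⟨hv, hl⟩ p' w s h
      rcases List.eq_nil_or_concat p' with rfl | ⟨p', x, rfl⟩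
      · obtain ⟨rfl, -⟩ : v = w ∧ l = s := by simpa using h
        exact hv
      · obtain ⟨rfl, hl'⟩ : v = x ∧ l = p'.reverse ++ w :: s := by simpa using h
        simpa using hl p' w s hl'
    · refine fun h => ⟨h [] v l rfl, fun p' w s hl => ?_⟩
      have := h (p' ++ [v]) w s (by simp [hl])
      rwa [List.append_assoc] at this

namespace IsAdmissible

variable (H : D.IsAdmissible len) {c : D.Cell} {p s : List Mon}
include H

theorem dvdMinimal_of_crit (hcr : D.Crit c) {w : Mon} (hc : c.1 = p.reverse ++ w :: s)
    (hw : D.Survives p w) : DvdMinimal (D.Survives p) w := by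
  by_contra hmin
  obtain ⟨u, hu⟩ := exists_isLeadingDivisor H.order hw
  obtain ⟨v, rfl⟩ := hu.2.1
  have hv : v ∈ D.G := H.right_mem _ _ hw.mem_G fun h => hmin (by simpa [h] using hu.1)
  have hcell : ∀ x ∈ p.reverse ++ u :: v :: s, x ∈ D.G :=
    forall_mem_of_replace (l := [u * v]) (l' := [u, v]) (hc ▸ c.2) (by simp [hu.1.1.mem_G, hv])
  exact (hcr _ (H.mem_matching_iff (c := ⟨_, hcell⟩).2 ⟨p, u, v, s, rfl, hc, hu⟩)).2 rfl

theorem survives_of_crit (hcr : D.Crit c) {u w : Mon} (hc : c.1 = p.reverse ++ u :: w :: s)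
    (hu : DvdMinimal (D.Survives p) u) : D.Survives (u :: p) w := by
  refine ⟨c.2 w (by simp [hc]), hu, ?_⟩
  rintro ⟨huw, hlead⟩
  have hcell : ∀ x ∈ p.reverse ++ (u * w) :: s, x ∈ D.G :=
    forall_mem_of_replace (l := [u, w]) (l' := [u * w]) (hc ▸ c.2) (by simpa using huw)
  exact (hcr _ (H.mem_matching_iff (c' := ⟨_, hcell⟩).2 ⟨p, u, w, s, hc, rfl, hlead⟩)).1 rfl

theorem minEntries_of_crit (hcr : D.Crit c) : D.MinEntries [] c.1 := by
  simp only [minEntries_iff, List.append_nil]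
  intro p
  induction p with
  | nil => exact fun w s hc => H.dvdMinimal_of_crit hcr hc (c.2 w (by simp [hc]))
  | cons u p ih =>
    intro w s hc
    have hc' : c.1 = p.reverse ++ u :: w :: s := by simp [hc]
    exact H.dvdMinimal_of_crit hcr hc (H.survives_of_crit hcr hc' (ih u (w :: s) hc'))

theorem crit_iff_minEntries (c : D.Cell) : D.Crit c ↔ D.MinEntries [] c.1 := by
  refine ⟨H.minEntries_of_crit, fun h => ?_⟩
  simp only [minEntries_iff, List.append_nil] at h
  rintro ⟨c₁, c₂⟩ he
  obtain ⟨p, u, v, s, h₁, h₂, hlead⟩ := H.mem_matching_iff.1 he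
  constructor
  · rintro rfl
    exact (h (u :: p) v s (by simp [h₁])).1.2.2 ⟨c₂.2 _ (by simp [h₂]), hlead⟩
  · rintro rfl
    exact (h p _ s h₂).2 u (dvd_mul_right _ _)
      (H.order.ne_mul _ (H.ne_one (c₁.2 v (by simp [h₁])))) hlead.1.1

end IsAdmissible

end StdMonomials

namespace Groebner

variable {k P Mon : Type*} [Field k] [Monoid Mon] {coef : P → Mon → k}
  {lt : Mon → Mon → Prop} {len : Mon → ℕ} {S : Finset P}

theorem Factor.len_lt (H : IsGradedOrder lt len) {u w : Mon} (h : Factor u w) (hne : u ≠ w) :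
    len u < len w := by
  obtain ⟨a, b, rfl⟩ := h
  by_contra! hle
  rw [H.len_mul, H.len_mul] at hle
  exact hne (by rw [H.len_eq_zero a (by omega), H.len_eq_zero b (by omega), one_mul, mul_one])

theorem exists_minGen_factor (H : IsGradedOrder lt len) {w : Mon} (hw : w ∉ Std coef lt S) :
    ∃ m ∈ MinGen coef lt S, Factor m w := by
  obtain ⟨m, ⟨hm, hmw⟩, hmin⟩ := (measure len).wf.has_min {m | m ∉ Std coef lt S ∧ Factor m w}
    ⟨w, hw, 1, 1, by rw [one_mul, mul_one]⟩
  refine ⟨m, ⟨hm, fun x hxm hne => ?_⟩, hmw⟩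
  by_contra hx
  exact hmin x ⟨hx, hxm.trans hmw⟩ (hxm.len_lt H hne)

end Groebner

namespace NonComm

open StdMonomials Groebner

variable {k : Type u} [Field k] {n : ℕ} {S : Finset (FreeAlgebra k (Fin n))}

theorem dvd_or_dvd_of_mul_eq_mul {a b c d : FreeMonoid (Fin n)} (h : a * b = c * d) :
    a ∣ c ∨ c ∣ a := by
  have h' : a.toList ++ b.toList = c.toList ++ d.toList := congrArg FreeMonoid.toList h
  rcases List.append_eq_append_iff.1 h' with ⟨x, hx, -⟩ | ⟨x, hx, -⟩
  · exact Or.inl ⟨FreeMonoid.ofList x, FreeMonoid.toList.injective hx⟩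
  · exact Or.inr ⟨FreeMonoid.ofList x, FreeMonoid.toList.injective hx⟩

theorem isLeadingDivisor_of_dvdMinimal {T : FreeMonoid (Fin n) → Prop} {u : FreeMonoid (Fin n)}
    (h : DvdMinimal T u) (v : FreeMonoid (Fin n)) : IsLeadingDivisor lt T (u * v) u := by
  refine ⟨h, dvd_mul_right _ _, fun u' hu' ⟨x, hx⟩ => ?_⟩
  have : u = u' := by
    by_contra hne
    rcases dvd_or_dvd_of_mul_eq_mul hx with hdvd | hdvd
    · exact hu'.2 u hdvd hne h.1
    · exact h.2 u' hdvd (Ne.symm hne) hu'.1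
  exact this ▸ isGradedOrder.irrefl u

/-- The relation between consecutive entries of a critical tuple: `u v` is not standard, but `u q`
is standard for each proper prefix `q` of `v`. -/
def Attached (S : Finset (FreeAlgebra k (Fin n))) (u v : FreeMonoid (Fin n)) : Prop :=
  u * v ∉ (std S).G ∧ ∀ q, q ∣ v → q ≠ v → u * q ∈ (std S).G

section Critical

variable {len : FreeMonoid (Fin n) → ℕ} {p l : List (FreeMonoid (Fin n))}
  {u v w : FreeMonoid (Fin n)}

theorem survives_cons_iff (hu : DvdMinimal ((std S).Survives p) u) :
    (std S).Survives (u :: p) w ↔ w ∈ (std S).G ∧ u * w ∉ (std S).G :=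
  and_congr_right fun _ => ⟨fun h huw => h.2 ⟨huw, isLeadingDivisor_of_dvdMinimal hu w⟩,
    fun h => ⟨hu, fun huw => h huw.1⟩⟩

theorem dvdMinimal_survives_cons_iff (H : (std S).IsAdmissible len)
    (hu : DvdMinimal ((std S).Survives p) u) (hv : v ∈ (std S).G) :
    DvdMinimal ((std S).Survives (u :: p)) v ↔ Attached S u v := by
  simp only [DvdMinimal, survives_cons_iff hu, Attached, hv, true_and]
  refine and_congr_right fun _ => forall₃_congr fun q hq _ => ?_
  obtain ⟨x, rfl⟩ := hq
  by_cases hq1 : q = 1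
  · subst hq1
    simp [H.one_notMem, hu.1.mem_G]
  · simp [H.left_mem q x hv hq1]

theorem minEntries_iff_isChain (H : (std S).IsAdmissible len)
    (hu : DvdMinimal ((std S).Survives p) u) (hl : ∀ w ∈ l, w ∈ (std S).G) :
    (std S).MinEntries (u :: p) l ↔ (u :: l).IsChain (Attached S) := by
  induction l generalizing u p with
  | nil => simp [MinEntries]
  | cons v l ih =>
    rw [List.forall_mem_cons] at hl
    rw [MinEntries, List.isChain_cons_cons, dvdMinimal_survives_cons_iff H hu hl.1]
    exact and_congr_right fun h => ih ((dvdMinimal_survives_cons_iff H hu hl.1).2 h) hl.2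

theorem dvdMinimal_survives_nil_iff (H : (std S).IsAdmissible FreeMonoid.length)
    (hw : w ∈ (std S).G) : DvdMinimal ((std S).Survives []) w ↔ w.length = 1 := by
  constructor
  · intro h
    induction w using FreeMonoid.casesOn with
    | one => exact absurd rfl (H.ne_one hw)
    | of_mul x w =>
      by_contra hne
      refine h.2 (FreeMonoid.of x) (dvd_mul_right _ _) (fun heq => hne ?_)
        (H.left_mem _ w hw (FreeMonoid.of_ne_one x))
      rw [← heq, FreeMonoid.length_of]
  · refine fun h => ⟨hw, fun q hdvd hne hq => ?_⟩
    have hlt := H.order.len_lt_of_dvd hdvd hne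
    have hpos := H.order.len_pos (H.ne_one (w := q) hq)
    omega

theorem crit_iff_isChain (H : (std S).IsAdmissible FreeMonoid.length) (c : (std S).Cell) :
    (std S).Crit c ↔ c.1 = [] ∨ ∃ w l, c.1 = w :: l ∧ w.length = 1 ∧
      (w :: l).IsChain (Attached S) := by
  rw [H.crit_iff_minEntries]
  rcases hc : c.1 with _ | ⟨w, l⟩
  · simp [MinEntries]
  have hw : w ∈ (std S).G := c.2 w (by simp [hc])
  have hl : ∀ x ∈ l, x ∈ (std S).G := fun x hx => c.2 x (by simp [hc, hx])
  have hentries : (std S).MinEntries [] (w :: l) ↔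
      w.length = 1 ∧ (w :: l).IsChain (Attached S) := by
    rw [MinEntries, ← dvdMinimal_survives_nil_iff H hw]
    exact and_congr_right fun hmin => minEntries_iff_isChain H hmin hl
  rw [hentries]
  constructor
  · exact fun h => Or.inr ⟨w, l, rfl, h⟩
  · rintro (h | ⟨_, _, h, h'⟩) <;> cases h
    exact h'

end Critical

theorem exists_eq_mul_of_factor_mul {u v m : FreeMonoid (Fin n)} (h : Factor m (u * v))
    (hu : ¬ Factor m u) (hv : ¬ Factor m v) (hq : ∀ q, q ∣ v → q ≠ v → ¬ Factor m (u * q)) :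
    ∃ a b, u = a * b ∧ b ≠ 1 ∧ m = b * v := by
  obtain ⟨x, y, hxy⟩ := h
  have hy : y = 1 := by
    by_contra hy
    rcases dvd_or_dvd_of_mul_eq_mul hxy with ⟨q, hxm⟩ | ⟨q, rfl⟩
    · have hvq : v = q * y := mul_left_cancel (a := u) (by rw [hxy, hxm, mul_assoc])
      exact hq q ⟨y, hvq⟩ (hvq ▸ isGradedOrder.ne_mul q hy) (hxm ▸ factor_mul_left x m)
    · exact hu ⟨x, q, rfl⟩
  rw [hy, mul_one] at hxy
  rcases dvd_or_dvd_of_mul_eq_mul hxy with ⟨q, rfl⟩ | ⟨b, rfl⟩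
  · rw [mul_assoc] at hxy
    exact absurd (mul_left_cancel hxy ▸ factor_mul_left q m) hv
  · rw [mul_assoc] at hxy
    have hm := mul_left_cancel hxy
    refine ⟨x, b, rfl, ?_, hm.symm⟩
    rintro rfl
    exact hv ⟨1, 1, by rw [← hm]; simp only [one_mul, mul_one]⟩

theorem Attached.exists_minGen {u v : FreeMonoid (Fin n)} (h : Attached S u v)
    (hu : u ∈ (std S).G) (hv : v ∈ (std S).G) :
    ∃ a b, u = a * b ∧ b ≠ 1 ∧ b * v ∈ MinGen coef lt S := by
  have huv : u * v ∉ Std coef lt S := fun hstd =>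
    h.1 ⟨hstd, isGradedOrder.mul_ne_one (.inl hu.2)⟩
  obtain ⟨m, hm, hmuv⟩ := exists_minGen_factor isGradedOrder huv
  have hfac : ∀ {w}, w ∈ (std S).G → ¬ Factor m w := fun hw hmw =>
    hm.1 (mem_std_of_factor hw.1 hmw)
  obtain ⟨a, b, hab, hb, rfl⟩ := exists_eq_mul_of_factor_mul hmuv (hfac hu) (hfac hv)
    fun q hqv hne => hfac (h.2 q hqv hne)
  exact ⟨a, b, hab, hb, hm⟩

theorem attached_of_mul_mem_minGen {u w : FreeMonoid (Fin n)} (hu : u ≠ 1)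
    (h : u * w ∈ MinGen coef lt S) : Attached S u w := by
  refine ⟨fun huw => h.1 huw.1, fun q ⟨x, hx⟩ hne =>
    ⟨h.2 _ ?_ fun heq => hne (mul_left_cancel heq), isGradedOrder.mul_ne_one (.inl hu)⟩⟩
  rw [hx, ← mul_assoc]
  exact factor_mul_right _ _

/-- The conditions on the words `u j`, `v j`, `t j`, `j < r`, of a fully attached tuple. -/
structure IsAttaching (S : Finset (FreeAlgebra k (Fin n))) (r : ℕ)
    (u v t : ℕ → FreeMonoid (Fin n)) : Prop where
  mem_minGen : ∀ j < r, u j * v j * t j ∈ MinGen coef lt S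
  link : ∀ j, j + 1 < r → u (j + 1) = t j
  prefix_mem : ∀ j, j + 1 < r → ∀ q, q ∣ v (j + 1) * t (j + 1) → q ≠ v (j + 1) * t (j + 1) →
    v j * t j * q ∈ (std S).G

theorem IsAttaching.attached_succ {r : ℕ} {u v t : ℕ → FreeMonoid (Fin n)}
    (h : IsAttaching S r u v t) {j : ℕ} (hj : j + 1 < r) :
    Attached S (v j * t j) (v (j + 1) * t (j + 1)) := by
  refine ⟨fun hmem => (h.mem_minGen _ hj).1 (mem_std_of_factor hmem.1 ?_), h.prefix_mem j hj⟩
  rw [h.link j hj, mul_assoc, mul_assoc]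
  exact factor_mul_left _ _

theorem IsAttaching.isChain {r : ℕ} {u v t : ℕ → FreeMonoid (Fin n)}
    (h : IsAttaching S (r + 1) u v t) (hu : u 0 ≠ 1) :
    (u 0 :: (List.range (r + 1)).map fun j => v j * t j).IsChain (Attached S) := by
  rw [List.isChain_cons, List.isChain_map, List.isChain_range_succ]
  refine ⟨fun w hw => ?_, fun j hj => h.attached_succ (by omega)⟩
  obtain rfl : v 0 * t 0 = w := by simpa [List.range_succ_eq_map] using hw
  refine attached_of_mul_mem_minGen hu ?_
  rw [← mul_assoc]
  exact h.mem_minGen 0 (by omega)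

theorem IsAttaching.of_mem_minGen {b x : FreeMonoid (Fin n)} (h : b * x ∈ MinGen coef lt S) :
    IsAttaching S 1 (fun _ => b) (fun _ => x) fun _ => 1 where
  mem_minGen _ _ := by rwa [mul_one]
  link _ hj := absurd hj (by omega)
  prefix_mem _ hj := absurd hj (by omega)

theorem IsAttaching.cons {r : ℕ} {u v t : ℕ → FreeMonoid (Fin n)} (h : IsAttaching S r u v t)
    {a b : FreeMonoid (Fin n)} (hmin : b * (a * u 0) ∈ MinGen coef lt S)
    (hatt : Attached S (a * u 0) (v 0 * t 0)) :
    IsAttaching S (r + 1) (fun j => j.casesOn b u) (fun j => j.casesOn a v)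
      fun j => j.casesOn (u 0) t where
  mem_minGen
    | 0, _ => by rwa [← mul_assoc] at hmin
    | j + 1, hj => h.mem_minGen j (by omega)
  link
    | 0, _ => rfl
    | j + 1, hj => h.link j (by omega)
  prefix_mem
    | 0, _ => hatt.2
    | j + 1, hj => h.prefix_mem j (by omega)

/-- Every chain of attached words comes from an attaching sequence, except that its first word `w`
may be longer than `u 0`; in the induction this excess is the next `v`. -/
theorem exists_isAttaching {x : FreeMonoid (Fin n)} {l : List (FreeMonoid (Fin n))}
    (w : FreeMonoid (Fin n)) (hG : ∀ y ∈ w :: x :: l, y ∈ (std S).G)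
    (hchain : (w :: x :: l).IsChain (Attached S)) :
    ∃ r u v t a, IsAttaching S (r + 1) u v t ∧ w = a * u 0 ∧ u 0 ≠ 1 ∧
      x :: l = (List.range (r + 1)).map fun j => v j * t j := by
  rw [List.isChain_cons_cons] at hchain
  obtain ⟨a, b, hw, hb, hmin⟩ :=
    hchain.1.exists_minGen (hG w (by simp)) (hG x (by simp))
  induction l generalizing w x a b with
  | nil => exact ⟨0, _, _, _, a, .of_mem_minGen hmin, hw, hb, by simp⟩
  | cons y l ih =>
    have htail := List.isChain_cons_cons.1 hchain.2
    obtain ⟨a', b', hx, hb', hmin'⟩ :=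
      htail.1.exists_minGen (hG x (by simp)) (hG y (by simp))
    obtain ⟨r, u, v, t, a', h, rfl, -, hl⟩ :=
      ih x (fun z hz => hG z (List.mem_cons_of_mem _ hz)) htail a' b' hx hb' hmin'
    have hy : y = v 0 * t 0 := by
      rw [List.range_succ_eq_map] at hl
      exact (List.cons.inj hl).1
    refine ⟨r + 1, _, _, _, a, h.cons hmin (hy ▸ htail.1), hw, hb, ?_⟩
    rw [List.range_succ_eq_map, List.map_cons, List.map_map, hl]
    rfl

theorem fullyAttached_iff_isChain (c : (std S).Cell) :
    FullyAttached S c ↔ c.1 = [] ∨ ∃ w l, c.1 = w :: l ∧ w.length = 1 ∧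
      (w :: l).IsChain (Attached S) := by
  constructor
  · rintro (h | ⟨i, h⟩ | ⟨r, hr, u, v, t, hc, hu, hmin, hlink, hprefix⟩)
    · exact Or.inl h
    · exact Or.inr ⟨_, [], h, FreeMonoid.length_of i, List.isChain_singleton _⟩
    · obtain ⟨r, rfl⟩ := Nat.exists_eq_add_of_le' hr
      refine Or.inr ⟨_, _, hc, hu, IsAttaching.isChain ⟨hmin, hlink, hprefix⟩ fun h => ?_⟩
      simp [h] at hu
  · rintro (h | ⟨w, _ | ⟨x, l⟩, hc, hw, hchain⟩)
    · exact Or.inl h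
    · obtain ⟨i, rfl⟩ := FreeMonoid.length_eq_one.1 hw
      exact Or.inr (Or.inl ⟨i, hc⟩)
    · obtain ⟨r, u, v, t, a, ⟨hmin, hlink, hprefix⟩, rfl, hu, hl⟩ :=
        exists_isAttaching w (hc ▸ c.2) hchain
      have hpos := isGradedOrder.len_pos hu
      rw [FreeMonoid.length_mul] at hw
      obtain rfl : a = 1 := FreeMonoid.length_eq_zero.1 (by omega)
      refine Or.inr (Or.inr ⟨r + 1, by omega, u, v, t, ?_, ?_, hmin, hlink, hprefix⟩)
      · rw [hc, hl, one_mul]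
      · rwa [FreeMonoid.length_one, zero_add] at hw

end NonComm

/-! ### The two cases -/

namespace NonComm

variable {k : Type u} [Field k] {n : ℕ} {S : Finset (FreeAlgebra k (Fin n))}

theorem crit_iff_fullyAttached (hS : IsGB S) (c : (std S).Cell) :
    (std S).Crit c ↔ FullyAttached S c := by
  have hP := isPresentation hS
  rcases subsingleton_or_nontrivial (Quot S) with hA | hA
  · have hG := hP.G_eq_empty
    exact iff_of_true (StdMonomials.crit_of_eq_empty hG c)
      (Or.inl (StdMonomials.cell_eq_nil hG c))
  · exact (crit_iff_isChain (hP.isAdmissible isGradedOrder) c).trans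
      (fullyAttached_iff_isChain c).symm

theorem val_of (i : Fin n) : (std S).val (FreeMonoid.of i) = mk S (FreeAlgebra.ι k i) :=
  congrArg (mk S) (FreeMonoid.lift_eval_of _ _)

theorem exists_eq_mul_of (w : FreeMonoid (Fin n)) (hw : w ≠ 1) :
    ∃ i w', w = w' * FreeMonoid.of i := by
  rcases List.eq_nil_or_concat w.toList with h | ⟨w', i, h⟩
  · exact absurd (FreeMonoid.toList.injective h) hw
  · exact ⟨i, FreeMonoid.ofList w', FreeMonoid.toList.injective (by simpa using h)⟩

theorem isMinimal (hS : IsGB S) (hT : (std S).NoTypeII) : (std S).IsMinimal (maxIdeal S) := by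
  refine (isPresentation hS).isMinimal_envIdeal isGradedOrder
    (fun i => ⟨FreeMonoid.of i, FreeMonoid.of_ne_one i, (val_of i).symm⟩) (fun w hw => ?_)
    (fun w hw => ?_) hT
  · induction w using FreeMonoid.casesOn with
    | one => exact absurd rfl hw
    | of_mul i w => exact ⟨i, w, by rw [map_mul, val_of]⟩
  · obtain ⟨i, w', rfl⟩ := exists_eq_mul_of w hw
    exact ⟨i, w', by rw [map_mul, val_of]⟩

end NonComm

namespace Comm

variable {k : Type u} [Field k] {n : ℕ} {S : Finset (MvPolynomial (Fin n) k)}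

theorem exists_eq_ofAdd_single_mul (w : Multiplicative (Fin n →₀ ℕ)) (hw : w ≠ 1) :
    ∃ i w', w = Multiplicative.ofAdd (single i 1) * w' := by
  obtain ⟨i, hi⟩ : ∃ i, w.toAdd i ≠ 0 := by
    by_contra! h
    exact hw (Multiplicative.toAdd.injective (Finsupp.ext h))
  refine ⟨i, Multiplicative.ofAdd (w.toAdd - single i 1), ?_⟩
  exact Multiplicative.toAdd.injective (add_tsub_cancel_of_le
    (Finsupp.single_le_iff.2 (Nat.one_le_iff_ne_zero.2 hi))).symm

theorem val_ofAdd_single (i : Fin n) :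
    (std S).val (Multiplicative.ofAdd (single i 1)) = mk S (MvPolynomial.X i) := rfl

theorem isMinimal (hS : IsGB S) (hT : (std S).NoTypeII) : (std S).IsMinimal (maxIdeal S) := by
  refine (isPresentation hS).isMinimal_envIdeal isGradedOrder
    (fun i => ⟨Multiplicative.ofAdd (single i 1), ?_, (val_ofAdd_single i).symm⟩)
    (fun w hw => ?_) (fun w hw => ?_) hT
  · exact fun h => one_ne_zero (Finsupp.single_eq_zero.1 (congrArg Multiplicative.toAdd h))
  all_goals obtain ⟨i, w', rfl⟩ := exists_eq_ofAdd_single_mul w hw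
  · exact ⟨i, w', by rw [map_mul, val_ofAdd_single]⟩
  · exact ⟨i, w', by rw [mul_comm, map_mul, val_ofAdd_single]⟩

end Comm

end

theorem mainTheorem9_general {k : Type u} [Field k] (n : ℕ) :
    (∀ S : Finset (FreeAlgebra k (Fin n)), NonComm.IsGB S →
      (NonComm.std S).IsAcyclicMatching ∧
      (∀ c, (NonComm.std S).Crit c ↔ NonComm.FullyAttached S c) ∧
      (NonComm.std S).FinitePaths ∧
      (NonComm.std S).IsFreeResolution ∧
      ((NonComm.std S).NoTypeII → (NonComm.std S).IsMinimal (NonComm.maxIdeal S))) ∧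
    (∀ S : Finset (MvPolynomial (Fin n) k), Comm.IsGB S →
      (Comm.std S).IsAcyclicMatching ∧
      (Comm.std S).FinitePaths ∧
      (Comm.std S).IsFreeResolution ∧
      ((Comm.std S).NoTypeII → (Comm.std S).IsMinimal (Comm.maxIdeal S))) := by
  refine ⟨fun S hS => ?_, fun S hS => ?_⟩
  · have hP := NonComm.isPresentation hS
    have H := NonComm.isGradedOrder (n := n)
    exact ⟨hP.isAcyclicMatching H, NonComm.crit_iff_fullyAttached hS, hP.finitePaths H,
      hP.isFreeResolution H, NonComm.isMinimal hS⟩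
  · have hP := Comm.isPresentation hS
    have H := Comm.isGradedOrder (n := n)
    exact ⟨hP.isAcyclicMatching H, hP.finitePaths H, hP.isFreeResolution H, Comm.isMinimal hS⟩

theorem mainTheorem9 {k : Type u} [Field k] (n : ℕ) :
    (∀ S : Finset (FreeAlgebra k (Fin n)), NonComm.IsReducedGB S →
      (NonComm.std S).IsAcyclicMatching ∧
      (∀ c, (NonComm.std S).Crit c ↔ NonComm.FullyAttached S c) ∧
      (NonComm.std S).FinitePaths ∧
      (NonComm.std S).IsFreeResolution ∧
      ((NonComm.std S).NoTypeII → (NonComm.std S).IsMinimal (NonComm.maxIdeal S))) ∧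
    (∀ S : Finset (MvPolynomial (Fin n) k), Comm.IsReducedGB S →
      (Comm.std S).IsAcyclicMatching ∧
      (Comm.std S).FinitePaths ∧
      (Comm.std S).IsFreeResolution ∧
      ((Comm.std S).NoTypeII → (Comm.std S).IsMinimal (Comm.maxIdeal S))) :=
  ⟨fun S hS => (mainTheorem9_general n).1 S hS.isBasis,
    fun S hS => (mainTheorem9_general n).2 S hS.isBasis⟩
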